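/- **Setting.** $(V,E)$ is a finite directed multigraph with $N\ge 1$ origin/destination pairs. Pair $i$ has an origin $O^i$, a destination $D^i\neq O^i$, a demand $m_i>0$ and an acyclic subgraph with edge set $E^i$ (with a fixed topological order) which contains at least one path from $O^i$ to $D^i$. Let $\mathcal P^i$ be the set of these paths, $P=\sum_i|\mathcal P^i|$, $M_{\rm tot}=\sum_i m_i$. A flow is $f=(f^i_p)_{p\in\mathcal P^i}$ with $f\ge 0$ and $\sum_{p\in\mathcal P^i}f^i_p=m_i$; its load on $e$ is $\ell_e(f)=\sum_i\sum_{p\ni e}f^i_p$. Edge costs $c_e(x,\omega)$ depend on the load $x\in[0,M_{\rm tot}]$ and on a random state $\omega\sim\mu$; they are measurable in $\omega$ and nondecreasing, uniformly bounded and $L$-Lipschitz in $x$. Put $\bar c_e(x)=\mathbb E\,c_e(x,\omega)$, $\Phi(f)=\sum_e\int_0^{\ell_e(f)}\bar c_e(x)\,dx$, $\mathrm{Gap}(f)=\Phi(f)-\min\Phi$. For $u\in\mathbb R^E$ let $\|u\|=\max_{p}\sum_{e\in p}|u_e|$ (maximum over all paths of all pairs), and let $\sigma^2=\sup_f\mathbb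 E\,\|(c_e(\ell_e(f),\omega)-\bar c_e(\ell_e(f)))_e\|^2$. A profile of local flows $y=(y^i_e)_{e\in E^i}$ sends the share $y^i_e$ of the type-$i$ traffic that arrives at the tail of $e$ along $e$. The arriving masses $a^i_v$ and the loads $\ell^i_e(y)=y^i_e\,a^i_{\mathrm{tail}(e)}$ are defined recursively by $a^i_{O^i}=m_i$ and $a^i_v=\sum_{e\in \mathrm{In}^i(v)}\ell^i_e(y)$ for $v\ne O^i$; put $\ell_e(y)=\sum_i\ell^i_e(y)$. **PushPullMatch**$(z,w,\alpha,A)$, for each pair $i$ (with $0/0=0$): *push backward* (reversed topological order) $b_{D^i}=1$, $b_v=\sum_{e\in \mathrm{Out}^i(v)}e^{w^i_e}b_{\mathrm{head}(e)}$ for $v\neq D^i$, and $q_e=e^{w^i_e}b_{\mathrm{head}(e)}/b_{\mathrm{tail}(e)}$; *pull forward* (topological order) $\lambda_e=q_e\cdot(\text{mass arriving at } \mathrm{tail}(e))$, where mass $m_i$ arrives at $O^i$ and $\sum_{e'\in \mathrm{In}^i(v)}\lambda_{e'}$ at every other $v$; averaged loads $\bar\lambda_e=(\alpha\lambda_e+z^i_e)/A$;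 new anchor $z^i_e+\alpha\lambda_e$; *match* $y^i_e=\bar\lambda_e/a_{\mathrm{tail}(e)}$ with $a_{O^i}=m_i$ and $a_v=\sum_{e'\in \mathrm{In}^i(v)}\bar\lambda_{e'}$ otherwise. It returns $y$ and the new anchor. **AdaLight** with $\alpha_t=t$: start with $w^1=z^1=0$, $\eta^1=1$. At $t=1,2,\dots$, with $A_t=\sum_{s\le t}\alpha_s$: let $\tilde y^t$ be the local flows returned by PushPullMatch$(z^t,\eta^tw^t,\alpha_t,A_t)$ (the anchor is not updated), observe $\tilde c^t_e=c_e(\ell_e(\tilde y^t),\tilde\omega^t)$, set $\tilde w^{t,i}_e=w^{t,i}_e-\alpha_t\tilde c^t_e$; let $y^t,z^{t+1}$ be the output of PushPullMatch$(z^t,\eta^t\tilde w^t,\alpha_t,A_t)$, observe $c^t_e=c_e(\ell_e(y^t),\omega^t)$, set $w^{t+1,i}_e=w^{t,i}_e-\alpha_tc^t_e$ and $\eta^{t+1}=\bigl(1+\sum_{s\le t}(\alpha_s\|c^s-\tilde c^s\|)^2\bigr)^{-1/2}$. The states $\tilde\omega^1,\omega^1,\tilde\omega^2,\omega^2,\dots$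 are i.i.d. with law $\mu$. The norm $\|\cdot\|$ is computed by the Bellman–Ford algorithm with edge weights $-|c^t_e-\tilde c^t_e|$. **Theorem.** (i) For all $N,K,L,M$ there is a constant $C$ such that for every network with $N$ pairs, demands at most $M$ and paths of at most $K$ edges, every such $L$-Lipschitz cost model, and every $T\ge 1$, the induced path flows $x^{T,i}_p=m_i\prod_{e\in p}y^{T,i}_e$ form a feasible flow, its gap is integrable, and $$\mathbb E[\mathrm{Gap}(x^T)]\le C(\log P)^{3/2}\Bigl(\frac{\sigma}{\sqrt T}+\frac1{T^2}\Bigr).$$ In the static case (costs that do not depend on $\omega$), $\mathrm{Gap}(x^T)\le C(\log P)^{3/2}/T^2$ surely. (ii) There is an absolute constant $C$ such that each iteration of AdaLight takes at most $C\,N\,|V|\,|E|$ elementary operations (arithmetic operations, comparisons, exponentials, square roots, queries of a cost, creation or writing of a table entry), in every network. In particular the Bellman–Ford routine computes $\|\cdot\|$ exactly. -/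

import Mathlib

open MeasureTheory ProbabilityTheory

/-! ## Networks, routes, flows -/

/-- `IsWalk tail head S u v p`: the list `p` of edges of `S` is a directed walk from `u` to `v`. -/
def IsWalk {V E : Type} (tail head : E → V) (S : Finset E) : V → V → List E → Prop
  | u, v, [] => u = v
  | u, v, e :: p => e ∈ S ∧ tail e = u ∧ IsWalk tail head S (head e) v p

/-- A directed multigraph with `N` origin/destination pairs.  Pair `i` comes with a subgraph (given
by its edge set), a demand, and a fixed topological order of that subgraph; the existence of the
order says that the subgraph is acyclic. -/
structure RoutingNetwork (V E : Type) [Fintype V] [DecidableEq V] [Fintype E] [DecidableEq E]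
    (N : ℕ) where
  tail : E → V
  head : E → V
  subgraph : Fin N → Finset E
  origin : Fin N → V
  dest : Fin N → V
  origin_ne_dest : ∀ i, origin i ≠ dest i
  demand : Fin N → ℝ
  demand_pos : ∀ i, 0 < demand i
  order : Fin N → List V
  order_nodup : ∀ i, (order i).Nodup
  mem_order : ∀ i v, v ∈ order i
  order_lt : ∀ i, ∀ e ∈ subgraph i, (order i).idxOf (tail e) < (order i).idxOf (head e)
  exists_route : ∀ i, ∃ p, IsWalk tail head (subgraph i) (origin i) (dest i) p

/-! ## Counting elementary operations -/

/-- A value together with the number of elementary operations spent on computing it. -/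
structure Counted (α : Type) where
  val : α
  ops : ℕ

namespace Counted

instance : Monad Counted where
  pure a := ⟨a, 0⟩
  bind x f := ⟨(f x.val).val, x.ops + (f x.val).ops⟩

/-- One elementary operation with result `a`. -/
def op {α : Type} (a : α) : Counted α := ⟨a, 1⟩

noncomputable def add (x y : ℝ) : Counted ℝ := op (x + y)
noncomputable def sub (x y : ℝ) : Counted ℝ := op (x - y)
noncomputable def mul (x y : ℝ) : Counted ℝ := op (x * y)
noncomputable def div (x y : ℝ) : Counted ℝ := op (x / y)
noncomputable def neg (x : ℝ) : Counted ℝ := op (-x)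
noncomputable def abs (x : ℝ) : Counted ℝ := op |x|
noncomputable def exp (x : ℝ) : Counted ℝ := op (Real.exp x)
noncomputable def sqrt (x : ℝ) : Counted ℝ := op (Real.sqrt x)
noncomputable def max (x y : ℝ) : Counted ℝ := op (x ⊔ y)

/-- Addition and minimum of distances, which may be `+∞`. -/
noncomputable def addDist (x : WithTop ℝ) (y : ℝ) : Counted (WithTop ℝ) := op (x + (y : WithTop ℝ))
noncomputable def minDist (x y : WithTop ℝ) : Counted (WithTop ℝ) := op (x ⊓ y)

/-- Creating a table with constant entries costs one operation per entry. -/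
def alloc {κ α : Type} [Fintype κ] (a : α) : Counted (κ → α) := ⟨fun _ => a, Fintype.card κ⟩

/-- Writing one entry of a table. -/
def write {κ α : Type} [DecidableEq κ] (f : κ → α) (k : κ) (a : α) : Counted (κ → α) :=
  op (Function.update f k a)

/-- Summation of a list of computed terms. -/
noncomputable def sumOver {κ : Type} (l : List κ) (f : κ → Counted ℝ) : Counted ℝ :=
  l.foldlM (fun s k => do
    let x ← f k
    add s x) 0

end Counted

/-- State of the algorithm before an iteration: the edge weights `w`, the anchor loads `z`, the
learning rate, the sums `∑ α` and `∑ (α max …)²`, and the local flows recommended last. -/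
structure AdaState (E : Type) (N : ℕ) where
  weight : Fin N → E → ℝ
  anchor : Fin N → E → ℝ
  rate : ℝ
  stepSum : ℝ
  rateSum : ℝ
  localFlow : Fin N → E → ℝ

namespace RoutingNetwork

variable {V E : Type} [Fintype V] [DecidableEq V] [Fintype E] [DecidableEq E] {N : ℕ}
  (G : RoutingNetwork V E N)

/-- The routes of pair `i`: paths from its origin to its destination in its subgraph. -/
def Route (i : Fin N) : Type :=
  {p : List E // IsWalk G.tail G.head (G.subgraph i) (G.origin i) (G.dest i) p}

theorem walk_idx_lt (i : Fin N) :
    ∀ (p : List E) (u v : V), IsWalk G.tail G.head (G.subgraph i) u v p →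
      ∀ e ∈ p, (G.order i).idxOf u < (G.order i).idxOf (G.head e)
  | [], _, _, _, e, he => by simp at he
  | a :: p, u, v, ⟨ha, hu, hp⟩, e, he => by
    have h1 := G.order_lt i a ha
    rw [hu] at h1
    rcases List.mem_cons.1 he with rfl | he
    · exact h1
    · exact h1.trans (walk_idx_lt i p _ v hp e he)

theorem walk_nodup (i : Fin N) :
    ∀ (p : List E) (u v : V), IsWalk G.tail G.head (G.subgraph i) u v p → p.Nodup
  | [], _, _, _ => List.nodup_nil
  | a :: p, u, v, ⟨_, _, hp⟩ => by
    refine List.nodup_cons.2 ⟨fun h => ?_, walk_nodup i p _ v hp⟩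
    exact lt_irrefl _ (G.walk_idx_lt i p _ v hp a h)

instance (i : Fin N) : Finite (G.Route i) :=
  Finite.of_injective (β := {l : List E // l.Nodup})
    (fun p => ⟨p.1, G.walk_nodup i p.1 _ _ p.2⟩)
    (fun _ _ h => Subtype.ext (congrArg (fun l : {l : List E // l.Nodup} => l.1) h))

noncomputable instance (i : Fin N) : Fintype (G.Route i) := Fintype.ofFinite _

instance (i : Fin N) : Nonempty (G.Route i) :=
  let ⟨p, hp⟩ := G.exists_route i
  ⟨⟨p, hp⟩⟩

/-- Total number of routes. -/
noncomputable def numRoutes : ℕ := ∑ i, Fintype.card (G.Route i)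

noncomputable def totalDemand : ℝ := ∑ i, G.demand i

/-- Feasible path flows. -/
def IsFlow (f : ∀ i, G.Route i → ℝ) : Prop :=
  ∀ i, (∀ p, 0 ≤ f i p) ∧ ∑ p, f i p = G.demand i

/-- Load on the edge `e` under a path flow. -/
noncomputable def load (f : ∀ i, G.Route i → ℝ) (e : E) : ℝ :=
  ∑ i, ∑ p : G.Route i, if e ∈ p.1 then f i p else 0

/-- `max_p ∑_{e ∈ p} |u_e|` over all routes `p` of all pairs. -/
noncomputable def routeNorm (u : E → ℝ) : ℝ :=
  ⨆ r : (Σ i, G.Route i), (r.2.1.map fun e => |u e|).sum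

/-! ## Random costs and the potential -/

/-- `c e x s` is the cost of edge `e` at load `x` in state `s`: measurable in the state; monotone,
uniformly bounded and `L`-Lipschitz in the load. -/
structure IsCostModel {S : Type*} [MeasurableSpace S] (c : E → ℝ → S → ℝ) (L : ℝ) : Prop where
  measurable : ∀ e, ∀ x ∈ Set.Icc 0 G.totalDemand, Measurable (c e x)
  monotone : ∀ e s, MonotoneOn (fun x => c e x s) (Set.Icc 0 G.totalDemand)
  bounded : ∃ H : ℝ, ∀ e s, ∀ x ∈ Set.Icc 0 G.totalDemand, |c e x s| ≤ H
  lipschitz : ∀ e s, ∀ x ∈ Set.Icc 0 G.totalDemand, ∀ y ∈ Set.Icc 0 G.totalDemand,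
    |c e x s - c e y s| ≤ L * |x - y|

section Costs

variable {S : Type*} [MeasurableSpace S] (μ : Measure S) (c : E → ℝ → S → ℝ)

/-- The mean cost function of an edge. -/
noncomputable def meanCost (e : E) (x : ℝ) : ℝ := ∫ s, c e x s ∂μ

/-- The (mean) Beckmann-McGuire-Winsten potential. -/
noncomputable def potential (f : ∀ i, G.Route i → ℝ) : ℝ :=
  ∑ e, ∫ x in (0 : ℝ)..G.load f e, meanCost μ c e x

/-- Equilibrium gap: potential minus its minimum over feasible flows. -/
noncomputable def gap (f : ∀ i, G.Route i → ℝ) : ℝ :=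
  G.potential μ c f - sInf (G.potential μ c '' {g | G.IsFlow g})

/-- The noise level `σ`: `σ²` is the largest, over feasible flows, second moment of the deviation of
the costs from their means, measured in `routeNorm`. -/
noncomputable def noiseLevel : ℝ :=
  Real.sqrt (⨆ f : {f : ∀ i, G.Route i → ℝ // G.IsFlow f},
    ∫ s, G.routeNorm (fun e => c e (G.load f.1 e) s - meanCost μ c e (G.load f.1 e)) ^ 2 ∂μ)

end Costs

/-! ## Local flows -/

/-- Incoming and outgoing edges of a vertex in the subgraph of pair `i`. -/
def inEdges (i : Fin N) (v : V) : Finset E := {e ∈ G.subgraph i | G.head e = v}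
def outEdges (i : Fin N) (v : V) : Finset E := {e ∈ G.subgraph i | G.tail e = v}

/-- Mass of type-`i` traffic arriving at `v` under the local flow `y`; the entry `y e` is the share
of the traffic at the tail of `e` that is sent along `e`. -/
noncomputable def arrival (i : Fin N) (y : E → ℝ) (v : V) : ℝ :=
  if v = G.origin i then G.demand i
  else ∑ e : {e // e ∈ G.inEdges i v}, y e.1 * arrival i y (G.tail e.1)
termination_by (G.order i).idxOf v
decreasing_by
  have h := Finset.mem_filter.1 e.2
  simpa [h.2] using G.order_lt i e.1 h.1

/-- Total load on the edge `e` under a profile of local flows. -/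
noncomputable def localLoad (y : Fin N → E → ℝ) (e : E) : ℝ :=
  ∑ i, if e ∈ G.subgraph i then y i e * G.arrival i (y i) (G.tail e) else 0

/-- The path flow `x_p = m_i ∏_{e ∈ p} y_e` induced by a profile of local flows. -/
noncomputable def pathFlow (y : Fin N → E → ℝ) (i : Fin N) (p : G.Route i) : ℝ :=
  G.demand i * (p.1.map (y i)).prod

/-! ## The PushPullMatch dynamic program -/

open Counted

/-- Pushing backward: backward scores of the vertices, in reversed topological order, and the
resulting pivot local flow. -/
noncomputable def pushBackward (i : Fin N) (w : E → ℝ) : Counted (E → ℝ) := do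
  let bw₀ ← alloc (κ := V) (0 : ℝ)
  let q₀ ← alloc (κ := E) (0 : ℝ)
  let r ← (G.order i).reverse.foldlM (fun (a : (V → ℝ) × (E → ℝ)) v => do
    let b ← if v = G.dest i then pure 1 else
      sumOver (G.outEdges i v).toList (fun e => do
        let x ← exp (w e)
        mul (a.1 (G.head e)) x)
    let bw ← write a.1 v b
    let q ← (G.outEdges i v).toList.foldlM (fun q e => do
      let x ← exp (w e)
      let n ← mul x (bw (G.head e))
      let d ← div n b
      write q e d) a.2
    pure (bw, q)) (bw₀, q₀)
  pure r.2

/-- Pulling forward: the loads of the pivot local flow `q` in topological order, their averages with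
the anchor loads `z`, and the updated anchor.  Returns the averaged loads and the new anchor. -/
noncomputable def pullForward (i : Fin N) (q z : E → ℝ) (α A : ℝ) :
    Counted ((E → ℝ) × (E → ℝ)) := do
  let ld₀ ← alloc (κ := E) (0 : ℝ)
  let av₀ ← alloc (κ := E) (0 : ℝ)
  let r ← (G.order i).foldlM (fun (a : (E → ℝ) × (E → ℝ) × (E → ℝ)) v => do
    let fw ← if v = G.origin i then pure (G.demand i) else
      sumOver (G.inEdges i v).toList (fun e => pure (a.1 e))
    (G.outEdges i v).toList.foldlM (fun (b : (E → ℝ) × (E → ℝ) × (E → ℝ)) e => do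
      let l ← mul fw (q e)
      let ld ← write b.1 e l
      let αl ← mul α l
      let s ← add αl (b.2.2 e)
      let x ← div s A
      let av ← write b.2.1 e x
      let z' ← add (b.2.2 e) αl
      let an ← write b.2.2 e z'
      pure (ld, av, an)) a) (ld₀, av₀, z)
  pure r.2

/-- Matching: the local flow with the edge loads `av`.  (A vertex that carries no traffic gets the
local flow `0`, the value of `0 / 0`.) -/
noncomputable def matchLoad (i : Fin N) (av : E → ℝ) : Counted (E → ℝ) := do
  let y₀ ← alloc (κ := E) (0 : ℝ)
  (G.order i).foldlM (fun (y : E → ℝ) v => do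
    let ar ← if v = G.origin i then pure (G.demand i) else
      sumOver (G.inEdges i v).toList (fun e => pure (av e))
    (G.outEdges i v).toList.foldlM (fun y e => do
      let d ← div (av e) ar
      write y e d) y) y₀

/-- `PushPullMatch(z, w, α, A)`: returns the profile of local flows and the updated anchor. -/
noncomputable def pushPullMatch (z w : Fin N → E → ℝ) (α A : ℝ) :
    Counted ((Fin N → E → ℝ) × (Fin N → E → ℝ)) := do
  let Y₀ ← alloc (κ := Fin N) (0 : E → ℝ)
  (List.finRange N).foldlM (fun (r : (Fin N → E → ℝ) × (Fin N → E → ℝ)) i => do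
    let q ← G.pushBackward i (w i)
    let a ← G.pullForward i q (z i) α A
    let y ← G.matchLoad i a.1
    let Y ← write r.1 i y
    let Z ← write r.2 i a.2
    pure (Y, Z)) (Y₀, z)

/-! ## AdaLight -/

/-- Bellman-Ford: the distance from the origin to the destination of pair `i` for the edge weights
`r`, by relaxing all edges `|V|` times. -/
noncomputable def bellmanFord (i : Fin N) (r : E → ℝ) : Counted (WithTop ℝ) := do
  let d₀ ← alloc (κ := V) (⊤ : WithTop ℝ)
  let d₁ ← write d₀ (G.origin i) 0
  let d ← (List.range (Fintype.card V)).foldlM (fun d _ =>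
    (G.subgraph i).toList.foldlM (fun (d : V → WithTop ℝ) e => do
      let x ← addDist (d (G.tail e)) (r e)
      let m ← minDist (d (G.head e)) x
      write d (G.head e) m) d) d₁
  pure (d (G.dest i))

/-- Computes `routeNorm u` by shortest paths for the edge weights `-|u e|`. -/
noncomputable def routeNormProgram (u : E → ℝ) : Counted ℝ := do
  let r₀ ← alloc (κ := E) (0 : ℝ)
  let r ← (Finset.univ : Finset E).toList.foldlM (fun (r : E → ℝ) e => do
    let x ← abs (u e)
    let y ← neg x
    write r e y) r₀
  (List.finRange N).foldlM (fun m i => do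
    let d ← G.bellmanFord i r
    let x ← neg (d.untopD 0)
    max m x) 0

/-- Measuring the costs on all edges, one query per edge. -/
noncomputable def measureCosts (cost : E → ℝ) : Counted (E → ℝ) := do
  let t₀ ← alloc (κ := E) (0 : ℝ)
  (Finset.univ : Finset E).toList.foldlM (fun (t : E → ℝ) e => do
    let x ← op (cost e)
    write t e x) t₀

/-- Fills a table indexed by the pairs and the edges of their subgraphs. -/
noncomputable def tabulate (f : Fin N → E → Counted ℝ) : Counted (Fin N → E → ℝ) := do
  let W₀ ← alloc (κ := Fin N) (0 : E → ℝ)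
  (List.finRange N).foldlM (fun (W : Fin N → E → ℝ) i => do
    let row₀ ← alloc (κ := E) (0 : ℝ)
    let row ← (G.subgraph i).toList.foldlM (fun (row : E → ℝ) e => do
      let x ← f i e
      write row e x) row₀
    write W i row) W₀

/-- One iteration with step `α`.  `testCost y` and `cost y` are the edge costs that are observed
in the test phase and in the recommendation phase when the local flows `y` are used. -/
noncomputable def iteration (testCost cost : (Fin N → E → ℝ) → E → ℝ) (α : ℝ)
    (s : AdaState E N) : Counted (AdaState E N) := do
  let A ← add s.stepSum α
  let w₁ ← G.tabulate (fun i e => mul s.rate (s.weight i e))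
  let test ← G.pushPullMatch s.anchor w₁ α A
  let ct ← measureCosts (testCost test.1)
  let wt ← G.tabulate (fun i e => do
    let x ← mul α (ct e)
    sub (s.weight i e) x)
  let w₂ ← G.tabulate (fun i e => mul s.rate (wt i e))
  let rec' ← G.pushPullMatch s.anchor w₂ α A
  let cr ← measureCosts (cost rec'.1)
  let w' ← G.tabulate (fun i e => do
    let x ← mul α (cr e)
    sub (s.weight i e) x)
  let u₀ ← alloc (κ := E) (0 : ℝ)
  let u ← (Finset.univ : Finset E).toList.foldlM (fun (u : E → ℝ) e => do
    let x ← sub (cr e) (ct e)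
    write u e x) u₀
  let m ← G.routeNormProgram u
  let αm ← mul α m
  let sq ← mul αm αm
  let R ← add s.rateSum sq
  let R₁ ← add 1 R
  let root ← sqrt R₁
  let η ← div 1 root
  pure { weight := w', anchor := rec'.2, rate := η, stepSum := A, rateSum := R,
         localFlow := rec'.1 }

/-- The state after `t` iterations of AdaLight with steps `α_t = t`, where `ζ (t, false)` and
`ζ (t, true)` are the states of nature in the test and in the recommendation phase of epoch `t`. -/
noncomputable def adaLight {S : Type*} (c : E → ℝ → S → ℝ) (ζ : ℕ × Bool → S) :
    ℕ → AdaState E N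
  | 0 => { weight := 0, anchor := 0, rate := 1, stepSum := 0, rateSum := 0, localFlow := 0 }
  | t + 1 =>
    (G.iteration (fun y e => c e (G.localLoad y e) (ζ (t + 1, false)))
      (fun y e => c e (G.localLoad y e) (ζ (t + 1, true))) ((t : ℝ) + 1)
      (adaLight c ζ t)).val

/-- The path flow induced by the local flows recommended in epoch `t`. -/
noncomputable def adaLightFlow {S : Type*} (c : E → ℝ → S → ℝ) (ζ : ℕ × Bool → S) (t : ℕ) :
    ∀ i, G.Route i → ℝ :=
  G.pathFlow (G.adaLight c ζ t).localFlow

end RoutingNetwork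

/-! ## Values and operation counts of programs -/

namespace Counted

variable {α β κ : Type}

@[simp] theorem val_pure (a : α) : (pure a : Counted α).val = a := rfl
@[simp] theorem ops_pure (a : α) : (pure a : Counted α).ops = 0 := rfl
@[simp] theorem val_bind (x : Counted α) (f : α → Counted β) : (x >>= f).val = (f x.val).val := rfl
@[simp] theorem ops_bind (x : Counted α) (f : α → Counted β) :
    (x >>= f).ops = x.ops + (f x.val).ops := rfl
@[simp] theorem val_op (a : α) : (op a).val = a := rfl
@[simp] theorem ops_op (a : α) : (op a).ops = 1 := rfl
@[simp] theorem val_add (x y : ℝ) : (add x y).val = x + y := rfl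
@[simp] theorem ops_add (x y : ℝ) : (add x y).ops = 1 := rfl
@[simp] theorem val_sub (x y : ℝ) : (sub x y).val = x - y := rfl
@[simp] theorem ops_sub (x y : ℝ) : (sub x y).ops = 1 := rfl
@[simp] theorem val_mul (x y : ℝ) : (mul x y).val = x * y := rfl
@[simp] theorem ops_mul (x y : ℝ) : (mul x y).ops = 1 := rfl
@[simp] theorem val_div (x y : ℝ) : (div x y).val = x / y := rfl
@[simp] theorem ops_div (x y : ℝ) : (div x y).ops = 1 := rfl
@[simp] theorem val_neg (x : ℝ) : (neg x).val = -x := rfl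
@[simp] theorem ops_neg (x : ℝ) : (neg x).ops = 1 := rfl
@[simp] theorem val_abs (x : ℝ) : (abs x).val = |x| := rfl
@[simp] theorem ops_abs (x : ℝ) : (abs x).ops = 1 := rfl
@[simp] theorem val_exp (x : ℝ) : (exp x).val = Real.exp x := rfl
@[simp] theorem ops_exp (x : ℝ) : (exp x).ops = 1 := rfl
@[simp] theorem val_sqrt (x : ℝ) : (sqrt x).val = Real.sqrt x := rfl
@[simp] theorem ops_sqrt (x : ℝ) : (sqrt x).ops = 1 := rfl
@[simp] theorem val_max (x y : ℝ) : (max x y).val = x ⊔ y := rfl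
@[simp] theorem ops_max (x y : ℝ) : (max x y).ops = 1 := rfl
@[simp] theorem val_addDist (x : WithTop ℝ) (y : ℝ) : (addDist x y).val = x + (y : WithTop ℝ) := rfl
@[simp] theorem ops_addDist (x : WithTop ℝ) (y : ℝ) : (addDist x y).ops = 1 := rfl
@[simp] theorem val_minDist (x y : WithTop ℝ) : (minDist x y).val = x ⊓ y := rfl
@[simp] theorem ops_minDist (x y : WithTop ℝ) : (minDist x y).ops = 1 := rfl
@[simp] theorem val_alloc [Fintype κ] (a : α) : (alloc a : Counted (κ → α)).val = fun _ => a := rfl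
@[simp] theorem ops_alloc [Fintype κ] (a : α) :
    (alloc a : Counted (κ → α)).ops = Fintype.card κ := rfl
@[simp] theorem val_write [DecidableEq κ] (f : κ → α) (k : κ) (a : α) :
    (write f k a).val = Function.update f k a := rfl
@[simp] theorem ops_write [DecidableEq κ] (f : κ → α) (k : κ) (a : α) :
    (write f k a).ops = 1 := rfl

@[simp] theorem val_foldlM (f : β → α → Counted β) (l : List α) (b : β) :
    (l.foldlM f b).val = l.foldl (fun b a => (f b a).val) b := by
  induction l generalizing b with
  | nil => rfl
  | cons a l ih => rw [List.foldlM_cons, val_bind, ih, List.foldl_cons]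

theorem ops_bind_le {x : Counted α} {f : α → Counted β} {m n : ℕ} (hx : x.ops ≤ m)
    (hf : ∀ a, (f a).ops ≤ n) : (x >>= f).ops ≤ m + n :=
  Nat.add_le_add hx (hf _)

theorem ops_foldlM_le {k n : ℕ} (f : β → α → Counted β) (l : List α) (b : β)
    (h : ∀ b, ∀ a ∈ l, (f b a).ops ≤ k) (hn : l.length ≤ n) : (l.foldlM f b).ops ≤ n * k := by
  refine le_trans ?_ (Nat.mul_le_mul_right k hn)
  clear hn
  induction l generalizing b with
  | nil => simp
  | cons a l ih =>
    rw [List.foldlM_cons, ops_bind, List.length_cons, Nat.succ_mul, add_comm]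
    exact Nat.add_le_add (ih _ fun b a' ha' => h b a' (List.mem_cons_of_mem _ ha'))
      (h _ _ List.mem_cons_self)

@[simp] theorem val_sumOver (l : List κ) (f : κ → Counted ℝ) :
    (sumOver l f).val = (l.map fun k => (f k).val).sum := by
  have key : ∀ s : ℝ, l.foldl (fun s k => s + (f k).val) s = s + (l.map fun k => (f k).val).sum := by
    induction l with
    | nil => simp
    | cons a l ih => intro s; simp [ih, add_assoc]
  simpa [sumOver] using key 0

theorem ops_sumOver_le {k n : ℕ} (l : List κ) (f : κ → Counted ℝ) (h : ∀ a, (f a).ops ≤ k)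
    (hn : l.length ≤ n) : (sumOver l f).ops ≤ n * (k + 1) :=
  ops_foldlM_le _ _ _ (fun b a _ => by simpa using h a) hn

end Counted

namespace RoutingNetwork

variable {V E : Type} [Fintype V] [DecidableEq V] [Fintype E] [DecidableEq E] {N : ℕ}
  (G : RoutingNetwork V E N)

open Counted

/-! ## The cost of one iteration -/

omit [DecidableEq E] in
theorem length_toList_le (s : Finset E) : s.toList.length ≤ Fintype.card E := by
  rw [Finset.length_toList]; exact s.card_le_univ

theorem length_order (i : Fin N) : (G.order i).length = Fintype.card V := by
  rw [← List.toFinset_card_of_nodup (G.order_nodup i), ← Finset.card_univ]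
  congr 1
  ext v
  simp [G.mem_order i v]

theorem card_edges_pos (G : RoutingNetwork V E N) (i : Fin N) : 1 ≤ Fintype.card E := by
  obtain ⟨p, hp⟩ := G.exists_route i
  cases p with
  | nil => exact absurd hp (G.origin_ne_dest i)
  | cons e p => exact Fintype.card_pos_iff.2 ⟨e⟩

theorem card_vertices_pos (G : RoutingNetwork V E N) (i : Fin N) : 1 ≤ Fintype.card V :=
  Fintype.card_pos_iff.2 ⟨G.origin i⟩

theorem size_bounds (G : RoutingNetwork V E N) (i : Fin N) :
    1 ≤ Fintype.card V * Fintype.card E ∧ Fintype.card E ≤ Fintype.card V * Fintype.card E ∧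
      Fintype.card V ≤ Fintype.card V * Fintype.card E :=
  ⟨Nat.mul_pos (G.card_vertices_pos i) (G.card_edges_pos i),
    Nat.le_mul_of_pos_left _ (G.card_vertices_pos i),
    Nat.le_mul_of_pos_right _ (G.card_edges_pos i)⟩

theorem ops_pushBackward_le (i : Fin N) (w : E → ℝ) :
    (G.pushBackward i w).ops ≤ 10 * (Fintype.card V * Fintype.card E) := by
  have hE := G.card_edges_pos i
  obtain ⟨-, h2, h3⟩ := G.size_bounds i
  rw [show 10 * (Fintype.card V * Fintype.card E) = Fintype.card V * Fintype.card E +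
    (Fintype.card V * Fintype.card E + (Fintype.card V * (8 * Fintype.card E) + 0)) by ring]
  refine ops_bind_le h3 fun bw₀ => ops_bind_le h2 fun q₀ => ops_bind_le
    (ops_foldlM_le _ _ _ (fun a v _ => ?_) (by rw [List.length_reverse, G.length_order]))
    fun r => le_rfl
  have h8 : Fintype.card E * (2 + 1) + (1 + (Fintype.card E * 4 + 0)) ≤ 8 * Fintype.card E := by
    omega
  refine le_trans ?_ h8
  split_ifs
  · exact ops_bind_le (by simp) fun b => ops_bind_le le_rfl fun bw => ops_bind_le
      (ops_foldlM_le _ _ _ (by simp) (length_toList_le _)) fun q => le_rfl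
  · exact ops_bind_le (ops_sumOver_le _ _ (by simp) (length_toList_le _))
      fun b => ops_bind_le le_rfl fun bw => ops_bind_le
      (ops_foldlM_le _ _ _ (by simp) (length_toList_le _)) fun q => le_rfl

theorem ops_pullForward_le (i : Fin N) (q z : E → ℝ) (α A : ℝ) :
    (G.pullForward i q z α A).ops ≤ 11 * (Fintype.card V * Fintype.card E) := by
  obtain ⟨-, h2, h3⟩ := G.size_bounds i
  simp only [pullForward, ops_bind, ops_alloc, ops_pure]
  rw [show 11 * (Fintype.card V * Fintype.card E) = 2 * (Fintype.card V * Fintype.card E)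
    + Fintype.card V * (9 * Fintype.card E) by ring]
  have h := fun f hf => ops_foldlM_le (k := 9 * Fintype.card E) (n := Fintype.card V) f
    (G.order i) ((alloc (κ := E) (0 : ℝ)).val, (alloc (κ := E) (0 : ℝ)).val, z) hf
    (G.length_order i).le
  refine le_trans (Nat.add_le_add_left (Nat.add_le_add_left (Nat.add_le_add_right
    (h _ fun a v _ => ?_) 0) _) _) (by omega)
  rw [show 9 * Fintype.card E = Fintype.card E * (0 + 1) + Fintype.card E * 8 by ring]
  split_ifs
  · exact ops_bind_le (by simp) fun _ => ops_foldlM_le _ _ _ (by simp) (length_toList_le _)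
  · exact ops_bind_le (ops_sumOver_le _ _ (by simp) (length_toList_le _))
      fun _ => ops_foldlM_le _ _ _ (by simp) (length_toList_le _)

theorem ops_matchLoad_le (i : Fin N) (av : E → ℝ) :
    (G.matchLoad i av).ops ≤ 4 * (Fintype.card V * Fintype.card E) := by
  obtain ⟨-, h2, h3⟩ := G.size_bounds i
  simp only [matchLoad, ops_bind, ops_alloc]
  rw [show 4 * (Fintype.card V * Fintype.card E) = (Fintype.card V * Fintype.card E)
    + Fintype.card V * (3 * Fintype.card E) by ring]
  refine Nat.add_le_add h2 (ops_foldlM_le (k := 3 * Fintype.card E) _ _ _ (fun a v _ => ?_)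
    (G.length_order i).le)
  rw [show 3 * Fintype.card E = Fintype.card E * (0 + 1) + Fintype.card E * 2 by ring]
  split_ifs
  · exact ops_bind_le (by simp) fun _ => ops_foldlM_le _ _ _ (by simp) (length_toList_le _)
  · exact ops_bind_le (ops_sumOver_le _ _ (by simp) (length_toList_le _))
      fun _ => ops_foldlM_le _ _ _ (by simp) (length_toList_le _)

theorem le_size_mul (G : RoutingNetwork V E N) (n : ℕ) (hN : 1 ≤ N) :
    n ≤ n * (N * Fintype.card V * Fintype.card E) ∧
    Fintype.card E ≤ N * Fintype.card V * Fintype.card E ∧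
    N ≤ N * Fintype.card V * Fintype.card E := by
  have i : Fin N := ⟨0, hN⟩
  obtain ⟨h1, h2, h3⟩ := G.size_bounds i
  rw [mul_assoc N]
  exact ⟨Nat.le_mul_of_pos_right _ (Nat.mul_pos hN h1), h2.trans (Nat.le_mul_of_pos_left _ hN),
    Nat.le_mul_of_pos_right _ h1⟩

theorem ops_pushPullMatch_le (hN : 1 ≤ N) (z w : Fin N → E → ℝ) (α A : ℝ) :
    (G.pushPullMatch z w α A).ops ≤ 28 * (N * Fintype.card V * Fintype.card E) := by
  obtain ⟨-, -, h3⟩ := G.le_size_mul 1 hN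
  simp only [pushPullMatch, ops_bind, ops_alloc, Fintype.card_fin]
  rw [show 28 * (N * Fintype.card V * Fintype.card E) = (N * Fintype.card V * Fintype.card E)
    + N * (27 * (Fintype.card V * Fintype.card E)) by ring]
  refine Nat.add_le_add h3 (ops_foldlM_le _ _ _ (fun r i _ => ?_) (List.length_finRange (n := N)).le)
  obtain ⟨h1, -, -⟩ := G.size_bounds i
  have a1 := G.ops_pushBackward_le i (w i)
  have a2 := G.ops_pullForward_le i (G.pushBackward i (w i)).val (z i) α A
  have a3 := G.ops_matchLoad_le i (G.pullForward i (G.pushBackward i (w i)).val (z i) α A).val.1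
  simp only [ops_bind, ops_write, ops_pure]
  omega

theorem ops_bellmanFord_le (i : Fin N) (r : E → ℝ) :
    (G.bellmanFord i r).ops ≤ 5 * (Fintype.card V * Fintype.card E) := by
  obtain ⟨h1, h2, h3⟩ := G.size_bounds i
  simp only [bellmanFord, ops_bind, ops_alloc, ops_pure, ops_write]
  rw [show 5 * (Fintype.card V * Fintype.card E) = 2 * (Fintype.card V * Fintype.card E)
    + Fintype.card V * (Fintype.card E * 3) by ring, ← add_assoc]
  refine Nat.add_le_add (by omega) (ops_foldlM_le _ _ _ (fun d _ _ => ?_) (by simp))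
  exact ops_foldlM_le _ _ _ (by simp) (length_toList_le _)

theorem ops_routeNormProgram_le (hN : 1 ≤ N) (u : E → ℝ) :
    (G.routeNormProgram u).ops ≤ 11 * (N * Fintype.card V * Fintype.card E) := by
  obtain ⟨-, h2, h3⟩ := G.le_size_mul 1 hN
  simp only [routeNormProgram, ops_bind, ops_alloc]
  rw [show 11 * (N * Fintype.card V * Fintype.card E) = N * Fintype.card V * Fintype.card E +
    ((N * Fintype.card V * Fintype.card E) * 3 + N * (7 * (Fintype.card V * Fintype.card E)))
    by ring]
  refine Nat.add_le_add h2 (Nat.add_le_add ((ops_foldlM_le (k := 3) _ _ _ (by simp)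
    (length_toList_le _)).trans (Nat.mul_le_mul_right _ h2)) (ops_foldlM_le _ _ _ (fun m i _ => ?_)
      (List.length_finRange (n := N)).le))
  obtain ⟨h1, -, -⟩ := G.size_bounds i
  have := fun r => G.ops_bellmanFord_le i r
  simp only [ops_bind, ops_neg, ops_max]
  refine (Nat.add_le_add_right (this _) _).trans (by omega)

theorem ops_tabulate_le (hN : 1 ≤ N) (f : Fin N → E → Counted ℝ) (k : ℕ)
    (hf : ∀ i e, (f i e).ops ≤ k) :
    (G.tabulate f).ops ≤ (k + 4) * (N * Fintype.card V * Fintype.card E) := by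
  obtain ⟨-, h2, h3⟩ := G.le_size_mul 1 hN
  simp only [tabulate, ops_bind, ops_alloc, Fintype.card_fin]
  rw [show (k + 4) * (N * Fintype.card V * Fintype.card E) = N * Fintype.card V * Fintype.card E +
    N * ((k + 3) * (Fintype.card V * Fintype.card E)) by ring]
  refine Nat.add_le_add h3 (ops_foldlM_le _ _ _ (fun W i _ => ?_) (List.length_finRange (n := N)).le)
  obtain ⟨h1, h2, -⟩ := G.size_bounds i
  simp only [ops_bind, ops_alloc, ops_write]
  rw [show (k + 3) * (Fintype.card V * Fintype.card E) = Fintype.card V * Fintype.card E +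
    ((Fintype.card V * Fintype.card E) * (k + 1) + Fintype.card V * Fintype.card E) by ring]
  refine Nat.add_le_add h2 (Nat.add_le_add ((ops_foldlM_le (k := k + 1) _ _ _ (fun _ e _ => ?_)
    (length_toList_le _)).trans (Nat.mul_le_mul_right _ h2)) h1)
  simpa using hf i e

theorem ops_measureCosts_le (cost : E → ℝ) :
    (measureCosts cost).ops ≤ 3 * Fintype.card E := by
  simp only [measureCosts, ops_bind, ops_alloc]
  have := ops_foldlM_le (k := 2) (fun (t : E → ℝ) e => do
    let x ← op (cost e)
    write t e x) (Finset.univ : Finset E).toList (fun _ => 0) (by simp) (length_toList_le _)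
  simp only [val_alloc]
  omega

set_option maxHeartbeats 2000000 in
theorem ops_iteration_le (hN : 1 ≤ N) (testCost cost : (Fin N → E → ℝ) → E → ℝ) (α : ℝ)
    (s : AdaState E N) :
    (G.iteration testCost cost α s).ops ≤ 120 * (N * Fintype.card V * Fintype.card E) := by
  obtain ⟨h1, h2, h3⟩ := G.le_size_mul 1 hN
  have t1 : ∀ f : Fin N → E → Counted ℝ, (∀ i e, (f i e).ops ≤ 1) →
      (G.tabulate f).ops ≤ 5 * (N * Fintype.card V * Fintype.card E) :=
    fun f h => G.ops_tabulate_le hN f 1 h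
  have t2 : ∀ f : Fin N → E → Counted ℝ, (∀ i e, (f i e).ops ≤ 2) →
      (G.tabulate f).ops ≤ 6 * (N * Fintype.card V * Fintype.card E) :=
    fun f h => G.ops_tabulate_le hN f 2 h
  have pm := G.ops_pushPullMatch_le hN
  have mc := ops_measureCosts_le (E := E)
  have rn := G.ops_routeNormProgram_le hN
  have fd : ∀ a b u₀ : E → ℝ, ((Finset.univ : Finset E).toList.foldlM (fun (u : E → ℝ) e => do
      let x ← sub (a e) (b e)
      write u e x) u₀).ops ≤ Fintype.card E * 2 := fun a b u₀ =>
    ops_foldlM_le _ _ _ (by simp) (length_toList_le _)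
  have one : 1 ≤ N * Fintype.card V * Fintype.card E := hN.trans h3
  unfold iteration
  generalize N * Fintype.card V * Fintype.card E = X at *
  have e1 : X + (5 * X + (28 * X + (3 * X + (6 * X + (5 * X + (28 * X + (3 * X + (6 * X +
    (X + (2 * X + (11 * X + (X + (X + (X + (X + (X + (X + 0))))))))))))))))) ≤ 120 * X := by
    clear t1 t2 pm mc rn fd h1 h2 h3
    linarith
  refine le_trans ?_ e1
  refine ops_bind_le one fun _ => ?_
  refine ops_bind_le (t1 _ fun _ _ => by simp) fun _ => ?_
  refine ops_bind_le (pm _ _ _ _) fun _ => ?_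
  refine ops_bind_le ((mc _).trans (by linarith)) fun _ => ?_
  refine ops_bind_le (t2 _ fun _ _ => by simp) fun _ => ?_
  refine ops_bind_le (t1 _ fun _ _ => by simp) fun _ => ?_
  refine ops_bind_le (pm _ _ _ _) fun _ => ?_
  refine ops_bind_le ((mc _).trans (by linarith)) fun _ => ?_
  refine ops_bind_le (t2 _ fun _ _ => by simp) fun _ => ?_
  refine ops_bind_le h2 fun _ => ?_
  refine ops_bind_le ((fd _ _ _).trans (by linarith)) fun _ => ?_
  refine ops_bind_le (rn _) fun _ => ?_
  exact ops_bind_le one fun _ => ops_bind_le one fun _ => ops_bind_le one fun _ =>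
    ops_bind_le one fun _ => ops_bind_le one fun _ => ops_bind_le one fun _ => le_rfl

end RoutingNetwork

/-! ## Walks -/

theorem isWalk_append {V E : Type} {tail head : E → V} {S : Finset E} {u v : V} {p q : List E} :
    IsWalk tail head S u v (p ++ q) ↔
      ∃ x, IsWalk tail head S u x p ∧ IsWalk tail head S x v q := by
  induction p generalizing u with
  | nil => exact ⟨fun h => ⟨u, rfl, h⟩, fun ⟨x, hx, h⟩ => by obtain rfl : u = x := hx; exact h⟩
  | cons e p ih =>
    simp only [List.cons_append, IsWalk, ih]
    exact ⟨fun ⟨h1, h2, x, h3, h4⟩ => ⟨x, ⟨h1, h2, h3⟩, h4⟩,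
      fun ⟨x, ⟨h1, h2, h3⟩, h4⟩ => ⟨h1, h2, x, h3, h4⟩⟩

theorem IsWalk.mem {V E : Type} {tail head : E → V} {S : Finset E} {u v : V} {p : List E}
    (h : IsWalk tail head S u v p) {e : E} (he : e ∈ p) : e ∈ S := by
  induction p generalizing u with
  | nil => simp at he
  | cons a p ih =>
    rcases List.mem_cons.1 he with rfl | he
    · exact h.1
    · exact ih h.2.2 he

/-- Relaxation of the edge `e` with edge weights `r`. -/
noncomputable def relaxEdge {V E : Type} [DecidableEq V] (tail head : E → V) (r : E → ℝ)
    (d : V → WithTop ℝ) (e : E) : V → WithTop ℝ :=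
  Function.update d (head e) (d (head e) ⊓ (d (tail e) + (r e : WithTop ℝ)))

section Relax

variable {V E : Type} [DecidableEq V] {tail head : E → V} {r : E → ℝ}

theorem relaxEdge_le (d : V → WithTop ℝ) (e : E) (v : V) : relaxEdge tail head r d e v ≤ d v := by
  rw [relaxEdge, Function.update_apply]
  split_ifs with h
  · rw [h]; exact inf_le_left
  · exact le_rfl

theorem foldl_relaxEdge_le (l : List E) (d : V → WithTop ℝ) (v : V) :
    l.foldl (relaxEdge tail head r) d v ≤ d v := by
  induction l generalizing d with
  | nil => exact le_rfl
  | cons a l ih => exact (ih _).trans (relaxEdge_le d a v)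

theorem foldl_relaxEdge_head_le {l : List E} {e : E} (he : e ∈ l) (d : V → WithTop ℝ) :
    l.foldl (relaxEdge tail head r) d (head e) ≤ d (tail e) + (r e : WithTop ℝ) := by
  obtain ⟨l1, l2, rfl⟩ := List.append_of_mem he
  rw [List.foldl_append, List.foldl_cons]
  refine (foldl_relaxEdge_le _ _ _).trans ?_
  rw [relaxEdge, Function.update_self]
  exact inf_le_right.trans (add_le_add_left (foldl_relaxEdge_le l1 d _) _)

/-- Every finite distance is the weight of a walk from `o`. -/
def IsSoundDist (tail head : E → V) (S : Finset E) (r : E → ℝ) (o : V) (d : V → WithTop ℝ) :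
    Prop :=
  ∀ v, d v ≠ ⊤ → ∃ p, IsWalk tail head S o v p ∧ d v = ((p.map r).sum : ℝ)

theorem IsSoundDist.relaxEdge {S : Finset E} {o : V} {d : V → WithTop ℝ}
    (hd : IsSoundDist tail head S r o d) {e : E} (he : e ∈ S) :
    IsSoundDist tail head S r o (relaxEdge tail head r d e) := by
  intro v hv
  rw [_root_.relaxEdge, Function.update_apply] at hv ⊢
  split_ifs at hv ⊢ with h
  · rcases le_total (d (head e)) (d (tail e) + (r e : WithTop ℝ)) with hle | hle
    · rw [inf_eq_left.2 hle] at hv ⊢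
      rw [h]; exact hd _ hv
    · rw [inf_eq_right.2 hle] at hv ⊢
      obtain ⟨p, hp, hs⟩ := hd (tail e) (fun h' => hv (by rw [h', WithTop.top_add]))
      refine ⟨p ++ [e], isWalk_append.2 ⟨_, hp, he, rfl, h.symm⟩, ?_⟩
      rw [hs]; simp
  · exact hd v hv

theorem IsSoundDist.foldl_relaxEdge {S : Finset E} {o : V} {l : List E} (hl : ∀ e ∈ l, e ∈ S)
    {d : V → WithTop ℝ} (hd : IsSoundDist tail head S r o d) :
    IsSoundDist tail head S r o (l.foldl (_root_.relaxEdge tail head r) d) := by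
  induction l generalizing d with
  | nil => exact hd
  | cons a l ih =>
    exact ih (fun e he => hl e (List.mem_cons_of_mem _ he)) (hd.relaxEdge (hl a List.mem_cons_self))

/-- `k` rounds of relaxations. -/
noncomputable def relaxRounds (tail head : E → V) (r : E → ℝ) (l : List E) (d : V → WithTop ℝ)
    (k : ℕ) : V → WithTop ℝ :=
  (List.range k).foldl (fun d _ => l.foldl (relaxEdge tail head r) d) d

theorem relaxRounds_succ (l : List E) (d : V → WithTop ℝ) (k : ℕ) :
    relaxRounds tail head r l d (k + 1) =
      l.foldl (relaxEdge tail head r) (relaxRounds tail head r l d k) := by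
  simp [relaxRounds, List.range_succ]

theorem IsSoundDist.relaxRounds {S : Finset E} {o : V} {l : List E} (hl : ∀ e ∈ l, e ∈ S)
    {d : V → WithTop ℝ} (hd : IsSoundDist tail head S r o d) (k : ℕ) :
    IsSoundDist tail head S r o (relaxRounds tail head r l d k) := by
  induction k with
  | zero => exact hd
  | succ k ih => rw [relaxRounds_succ]; exact ih.foldl_relaxEdge hl

theorem relaxRounds_le_walk {S : Finset E} {o : V} {l : List E} (hl : ∀ e ∈ S, e ∈ l)
    {d : V → WithTop ℝ} (hd : d o ≤ 0) {k : ℕ} {v : V} {p : List E}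
    (hp : IsWalk tail head S o v p) (hk : p.length ≤ k) :
    relaxRounds tail head r l d k v ≤ ((p.map r).sum : ℝ) := by
  induction k generalizing v p with
  | zero =>
    obtain rfl : p = [] := List.length_eq_zero_iff.1 (Nat.le_zero.1 hk)
    obtain rfl : o = v := hp
    simpa [relaxRounds] using hd
  | succ k ih =>
    rw [relaxRounds_succ]
    rcases List.eq_nil_or_concat' p with rfl | ⟨p', e, rfl⟩
    · exact (foldl_relaxEdge_le _ _ _).trans (ih hp (Nat.zero_le _))
    · obtain ⟨x, hx, he, rfl, rfl⟩ := isWalk_append.1 hp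
      refine (foldl_relaxEdge_head_le (hl e he) _).trans ?_
      have := ih hx (by simpa using hk)
      simpa using add_le_add_left this (r e : WithTop ℝ)

end Relax

namespace RoutingNetwork

variable {V E : Type} [Fintype V] [DecidableEq V] [Fintype E] [DecidableEq E] {N : ℕ}
  (G : RoutingNetwork V E N)

open Counted

theorem walk_idx_add_length_le (i : Fin N) {u v : V} {p : List E}
    (h : IsWalk G.tail G.head (G.subgraph i) u v p) :
    (G.order i).idxOf u + p.length ≤ (G.order i).idxOf v := by
  induction p generalizing u with
  | nil => obtain rfl : u = v := h; simp
  | cons e p ih =>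
    have h1 := ih h.2.2
    have h2 := G.order_lt i e h.1
    rw [h.2.1] at h2
    simp only [List.length_cons]
    omega

theorem walk_length_le (i : Fin N) {u v : V} {p : List E}
    (h : IsWalk G.tail G.head (G.subgraph i) u v p) : p.length ≤ Fintype.card V := by
  have h1 := G.walk_idx_add_length_le i h
  have h2 := List.idxOf_lt_length_of_mem (G.mem_order i v)
  rw [G.length_order] at h2
  omega

theorem bellmanFord_val (i : Fin N) (r : E → ℝ) :
    (G.bellmanFord i r).val = relaxRounds G.tail G.head r (G.subgraph i).toList
      (Function.update (fun _ => ⊤) (G.origin i) 0) (Fintype.card V) (G.dest i) := by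
  simp only [bellmanFord, val_bind, val_pure, val_foldlM, val_alloc, val_write, val_minDist,
    val_addDist]
  rfl

theorem bellmanFord_spec (i : Fin N) (r : E → ℝ) :
    ∃ m : ℝ, (G.bellmanFord i r).val = m ∧ (∃ p : G.Route i, m = (p.1.map r).sum) ∧
      ∀ p : G.Route i, m ≤ (p.1.map r).sum := by
  rw [bellmanFord_val]
  have hc : ∀ p : G.Route i, relaxRounds G.tail G.head r (G.subgraph i).toList
      (Function.update (fun _ => ⊤) (G.origin i) 0) (Fintype.card V) (G.dest i) ≤
        ((p.1.map r).sum : ℝ) := fun p =>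
    relaxRounds_le_walk (S := G.subgraph i) (fun e he => Finset.mem_toList.2 he) (by simp) p.2
      (G.walk_length_le i p.2)
  have hs : IsSoundDist G.tail G.head (G.subgraph i) r (G.origin i)
      (Function.update (fun _ => ⊤) (G.origin i) (0 : WithTop ℝ)) := by
    intro v hv
    rw [Function.update_apply] at hv ⊢
    split_ifs at hv ⊢ with h
    · exact ⟨[], h.symm, by simp⟩
    · exact absurd rfl hv
  obtain ⟨p₀⟩ : Nonempty (G.Route i) := inferInstance
  obtain ⟨p, hp, hpe⟩ := hs.relaxRounds (l := (G.subgraph i).toList)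
    (fun e he => Finset.mem_toList.1 he) (Fintype.card V) (G.dest i)
    (fun h => by simpa [h] using hc p₀)
  refine ⟨_, hpe, ⟨⟨p, hp⟩, rfl⟩, fun p' => ?_⟩
  have := hc p'
  rw [hpe] at this
  exact WithTop.coe_le_coe.1 this

end RoutingNetwork

section Tables

variable {α β : Type}

theorem foldl_update [DecidableEq α] (l : List α) (f : α → β) (t : α → β) (a : α) :
    l.foldl (fun t a => Function.update t a (f a)) t a = if a ∈ l then f a else t a := by
  induction l generalizing t with
  | nil => simp
  | cons b l ih =>
    rw [List.foldl_cons, ih, Function.update_apply]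
    by_cases h1 : a ∈ l <;> by_cases h2 : a = b <;> simp [h1, h2]

end Tables

namespace RoutingNetwork

variable {V E : Type} [Fintype V] [DecidableEq V] [Fintype E] [DecidableEq E] {N : ℕ}
  (G : RoutingNetwork V E N)

open Counted

theorem routeNorm_bddAbove (u : E → ℝ) :
    BddAbove (Set.range fun r : (Σ i, G.Route i) => (r.2.1.map fun e => |u e|).sum) :=
  (Set.finite_range _).bddAbove

theorem le_routeNorm (u : E → ℝ) (i : Fin N) (p : G.Route i) :
    (p.1.map fun e => |u e|).sum ≤ G.routeNorm u :=
  le_ciSup (G.routeNorm_bddAbove u) ⟨i, p⟩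

theorem routeNorm_nonneg (u : E → ℝ) : 0 ≤ G.routeNorm u :=
  Real.iSup_nonneg fun _ => List.sum_nonneg (by simp)

theorem routeNorm_le {u : E → ℝ} {b : ℝ} (hb : 0 ≤ b)
    (h : ∀ i (p : G.Route i), (p.1.map fun e => |u e|).sum ≤ b) : G.routeNorm u ≤ b :=
  Real.iSup_le (fun r => h r.1 r.2) hb

theorem foldl_max_le {ι : Type} (l : List ι) (f : ι → ℝ) (m b : ℝ) :
    l.foldl (fun m i => m ⊔ f i) m ≤ b ↔ m ≤ b ∧ ∀ i ∈ l, f i ≤ b := by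
  induction l generalizing m with
  | nil => simp
  | cons a l ih => simp [ih, and_assoc]

theorem routeNormProgram_val (u : E → ℝ) : (G.routeNormProgram u).val = G.routeNorm u := by
  have hv : (G.routeNormProgram u).val = (List.finRange N).foldl
      (fun m i => m ⊔ -((G.bellmanFord i fun e => -|u e|).val.untopD 0)) 0 := by
    simp only [routeNormProgram, val_bind, val_foldlM, val_alloc, val_write, val_abs, val_neg,
      val_max]
    congr! 8 with m i
    ext e
    rw [foldl_update (f := fun e => -|u e|)]
    simp
  rw [hv]
  have hneg : ∀ p : List E, (p.map fun e => -|u e|).sum = -(p.map fun e => |u e|).sum := fun p => by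
    induction p with
    | nil => simp
    | cons a p ih => simp only [List.map_cons, List.sum_cons, ih]; ring
  refine eq_of_forall_ge_iff fun b => ?_
  rw [foldl_max_le]
  constructor
  · rintro ⟨h0, h⟩
    refine G.routeNorm_le h0 fun i p => ?_
    obtain ⟨m, hm, -, hle⟩ := G.bellmanFord_spec i fun e => -|u e|
    have := h i (List.mem_finRange i)
    rw [hm, WithTop.untopD_coe] at this
    have h2 := hle p
    rw [hneg] at h2
    linarith
  · intro h
    refine ⟨(G.routeNorm_nonneg u).trans h, fun i _ => ?_⟩
    obtain ⟨m, hm, ⟨p, hp⟩, -⟩ := G.bellmanFord_spec i fun e => -|u e|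
    rw [hm, WithTop.untopD_coe, hp, hneg, neg_neg]
    exact (G.le_routeNorm u i p).trans h

/-! ## Sums over walks to the destination -/

theorem finite_walks (i : Fin N) (v : V) :
    {p : List E | IsWalk G.tail G.head (G.subgraph i) v (G.dest i) p}.Finite :=
  (Set.finite_coe_iff.1 (inferInstance : Finite {l : List E // l.Nodup})).subset
    fun p hp => G.walk_nodup i p _ _ hp

/-- The walks from `v` to the destination of pair `i`. -/
noncomputable def walks (i : Fin N) (v : V) : Finset (List E) := (G.finite_walks i v).toFinset

variable {G} in
theorem mem_walks {i : Fin N} {v : V} {p : List E} :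
    p ∈ G.walks i v ↔ IsWalk G.tail G.head (G.subgraph i) v (G.dest i) p := by
  simp [walks]

theorem sum_route (i : Fin N) (F : List E → ℝ) :
    ∑ p : G.Route i, F p.1 = ∑ p ∈ G.walks i (G.origin i), F p :=
  Finset.sum_bij (fun p _ => p.1) (fun p _ => mem_walks.2 p.2) (fun _ _ _ _ h => Subtype.ext h)
    (fun p hp => ⟨⟨p, mem_walks.1 hp⟩, Finset.mem_univ _, rfl⟩) fun _ _ => rfl

theorem walks_dest (i : Fin N) : G.walks i (G.dest i) = {[]} := by
  ext p
  rw [mem_walks, Finset.mem_singleton]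
  constructor
  · intro h
    have := G.walk_idx_add_length_le i h
    exact List.length_eq_zero_iff.1 (by omega)
  · rintro rfl; rfl

theorem sum_walks_of_ne {i : Fin N} {v : V} (hv : v ≠ G.dest i) (F : List E → ℝ) :
    ∑ p ∈ G.walks i v, F p =
      ∑ e ∈ G.outEdges i v, ∑ p ∈ G.walks i (G.head e), F (e :: p) := by
  have h : G.walks i v = (G.outEdges i v).biUnion
      fun e => (G.walks i (G.head e)).image (List.cons e) := by
    ext p
    simp only [Finset.mem_biUnion, Finset.mem_image, mem_walks, outEdges, Finset.mem_filter]
    constructor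
    · intro hp
      cases p with
      | nil => exact absurd hp hv
      | cons e p => exact ⟨e, ⟨hp.1, hp.2.1⟩, p, hp.2.2, rfl⟩
    · rintro ⟨e, ⟨h1, h2⟩, p, hp, rfl⟩
      exact ⟨h1, h2, hp⟩
  rw [h, Finset.sum_biUnion]
  · refine Finset.sum_congr rfl fun e _ => Finset.sum_image fun _ _ _ _ h => ?_
    exact (List.cons.inj h).2
  · intro e _ e' _ hne
    rw [Function.onFun, Finset.disjoint_left]
    intro p hp hp'
    obtain ⟨q, -, rfl⟩ := Finset.mem_image.1 hp
    obtain ⟨q', -, h⟩ := Finset.mem_image.1 hp'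
    exact hne (List.cons.inj h).1.symm

/-- The total weight of the walks from `v` to the destination, a walk being weighted by the product
of the weights `g` of its edges. -/
noncomputable def walkSum (i : Fin N) (g : E → ℝ) (v : V) : ℝ :=
  ∑ p ∈ G.walks i v, (p.map g).prod

theorem walkSum_dest (i : Fin N) (g : E → ℝ) : G.walkSum i g (G.dest i) = 1 := by
  simp [walkSum, walks_dest]

theorem walkSum_of_ne {i : Fin N} (g : E → ℝ) {v : V} (hv : v ≠ G.dest i) :
    G.walkSum i g v = ∑ e ∈ G.outEdges i v, g e * G.walkSum i g (G.head e) := by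
  simp [walkSum, G.sum_walks_of_ne hv, Finset.mul_sum]

theorem walkSum_nonneg (i : Fin N) {g : E → ℝ} (hg : ∀ e, 0 ≤ g e) (v : V) :
    0 ≤ G.walkSum i g v :=
  Finset.sum_nonneg fun p _ => List.prod_nonneg (by simpa using fun e _ => hg e)

theorem walkSum_pos (i : Fin N) {g : E → ℝ} (hg : ∀ e, 0 < g e) {v : V} {p : List E}
    (hp : p ∈ G.walks i v) : 0 < G.walkSum i g v :=
  Finset.sum_pos (fun p _ => List.prod_pos (by simpa using fun e _ => hg e)) ⟨p, hp⟩

theorem walkSum_origin_pos (i : Fin N) {g : E → ℝ} (hg : ∀ e, 0 < g e) :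
    0 < G.walkSum i g (G.origin i) :=
  let ⟨_, hp⟩ := G.exists_route i
  G.walkSum_pos i hg (mem_walks.2 hp)

/-- Induction along the reversed topological order. -/
theorem backward_induction (i : Fin N) {P : V → Prop}
    (h : ∀ v, (∀ e ∈ G.outEdges i v, P (G.head e)) → P v) (v : V) : P v := by
  induction hn : Fintype.card V - (G.order i).idxOf v using Nat.strong_induction_on generalizing v
  rename_i n ih
  refine h v fun e he => ih _ ?_ _ rfl
  obtain ⟨hs, rfl⟩ := Finset.mem_filter.1 he
  have h1 := G.order_lt i e hs
  have h2 := List.idxOf_lt_length_of_mem (G.mem_order i (G.head e))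
  rw [G.length_order] at h2
  omega

/-- Induction along the topological order. -/
theorem forward_induction (i : Fin N) {P : V → Prop}
    (h : ∀ v, (∀ e ∈ G.inEdges i v, P (G.tail e)) → P v) (v : V) : P v := by
  induction hn : (G.order i).idxOf v using Nat.strong_induction_on generalizing v
  rename_i n ih
  refine h v fun e he => ih _ ?_ _ rfl
  obtain ⟨hs, rfl⟩ := Finset.mem_filter.1 he
  rw [← hn]
  exact G.order_lt i e hs

variable {G} in
theorem mem_outEdges {i : Fin N} {e : E} {v : V} :
    e ∈ G.outEdges i v ↔ e ∈ G.subgraph i ∧ G.tail e = v := Finset.mem_filter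

variable {G} in
theorem mem_inEdges {i : Fin N} {e : E} {v : V} :
    e ∈ G.inEdges i v ↔ e ∈ G.subgraph i ∧ G.head e = v := Finset.mem_filter

theorem sum_outEdges (i : Fin N) (F : E → ℝ) :
    ∑ v, ∑ e ∈ G.outEdges i v, F e = ∑ e ∈ G.subgraph i, F e :=
  Finset.sum_fiberwise _ _ _

theorem sum_inEdges (i : Fin N) (F : E → ℝ) :
    ∑ v, ∑ e ∈ G.inEdges i v, F e = ∑ e ∈ G.subgraph i, F e :=
  Finset.sum_fiberwise _ _ _

/-! ## Edge flows -/

/-- The mass arriving at `v` under the edge loads `l`, if `m` enters at the origin. -/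
noncomputable def inflow (i : Fin N) (m : ℝ) (l : E → ℝ) (v : V) : ℝ :=
  if v = G.origin i then m else ∑ e ∈ G.inEdges i v, l e

/-- `l` is a flow of mass `m` from the origin to the destination of pair `i`. -/
structure IsEdgeFlow (i : Fin N) (m : ℝ) (l : E → ℝ) : Prop where
  nonneg : ∀ e ∈ G.subgraph i, 0 ≤ l e
  into_origin : ∀ e ∈ G.inEdges i (G.origin i), l e = 0
  out_dest : ∀ e ∈ G.outEdges i (G.dest i), l e = 0
  balance : ∀ v, v ≠ G.dest i → ∑ e ∈ G.outEdges i v, l e = G.inflow i m l v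

namespace IsEdgeFlow

variable {G} {i : Fin N} {m m' : ℝ} {l l' : E → ℝ}

theorem congr (h : G.IsEdgeFlow i m l) (hl : ∀ e ∈ G.subgraph i, l' e = l e) :
    G.IsEdgeFlow i m l' := by
  have h1 : ∀ v, ∀ e ∈ G.outEdges i v, l' e = l e := fun v e he => hl e (mem_outEdges.1 he).1
  have h2 : ∀ v, ∀ e ∈ G.inEdges i v, l' e = l e := fun v e he => hl e (mem_inEdges.1 he).1
  refine ⟨fun e he => (hl e he).symm ▸ h.nonneg e he,
    fun e he => (h2 _ e he).trans (h.into_origin e he),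
    fun e he => (h1 _ e he).trans (h.out_dest e he), fun v hv => ?_⟩
  rw [inflow, Finset.sum_congr rfl (h1 v), Finset.sum_congr rfl (h2 v)]
  exact h.balance v hv

theorem zero (i : Fin N) : G.IsEdgeFlow i 0 (0 : E → ℝ) :=
  ⟨by simp, by simp, by simp, by simp [inflow]⟩

theorem linear (h : G.IsEdgeFlow i m l) (h' : G.IsEdgeFlow i m' l') {a b : ℝ} (ha : 0 ≤ a)
    (hb : 0 ≤ b) : G.IsEdgeFlow i (a * m + b * m') fun e => a * l e + b * l' e := by
  refine ⟨fun e he => ?_, fun e he => ?_, fun e he => ?_, fun v hv => ?_⟩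
  · have := h.nonneg e he
    have := h'.nonneg e he
    positivity
  · simp [h.into_origin e he, h'.into_origin e he]
  · simp [h.out_dest e he, h'.out_dest e he]
  · rw [Finset.sum_add_distrib, ← Finset.mul_sum, ← Finset.mul_sum, h.balance v hv,
      h'.balance v hv]
    simp only [inflow]
    split_ifs
    · rfl
    · rw [Finset.sum_add_distrib, ← Finset.mul_sum, ← Finset.mul_sum]

theorem inflow_nonneg (h : G.IsEdgeFlow i m l) (hm : 0 ≤ m) (v : V) : 0 ≤ G.inflow i m l v := by
  rw [inflow]
  split_ifs
  · exact hm
  · exact Finset.sum_nonneg fun e he => h.nonneg e (mem_inEdges.1 he).1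

theorem inflow_head_ne_zero (h : G.IsEdgeFlow i m l) {e : E} (he : e ∈ G.subgraph i)
    (hl : l e ≠ 0) : G.inflow i m l (G.head e) ≠ 0 := by
  have ho : G.head e ≠ G.origin i := fun ho => hl (h.into_origin e (mem_inEdges.2 ⟨he, ho⟩))
  rw [inflow, if_neg ho]
  refine ne_of_gt (Finset.sum_pos' (fun e he => h.nonneg e (mem_inEdges.1 he).1)
    ⟨e, mem_inEdges.2 ⟨he, rfl⟩, lt_of_le_of_ne (h.nonneg e he) hl.symm⟩)

/-- Decomposition of an edge flow along walks: if the flow is routed by the local weights `g` and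
the walks from the vertices that carry traffic have total weight `1`, then the edge flow is the
load of the path flow `m ∏ g`. -/
theorem sum_mul (h : G.IsEdgeFlow i m l) {g : E → ℝ}
    (hg : ∀ e ∈ G.subgraph i, l e = g e * G.inflow i m l (G.tail e))
    (hW : ∀ v, G.inflow i m l v ≠ 0 → G.walkSum i g v = 1) (u : E → ℝ) :
    ∑ e ∈ G.subgraph i, u e * l e =
      m * ∑ p ∈ G.walks i (G.origin i), (p.map g).prod * (p.map u).sum := by
  set T : V → ℝ := fun v => ∑ p ∈ G.walks i v, (p.map g).prod * (p.map u).sum with hT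
  have hTd : T (G.dest i) = 0 := by simp [hT, walks_dest]
  have hTn : ∀ v, v ≠ G.dest i → T v = ∑ e ∈ G.outEdges i v,
      g e * (u e * G.walkSum i g (G.head e) + T (G.head e)) := fun v hv => by
    simp only [hT, G.sum_walks_of_ne hv, walkSum]
    refine Finset.sum_congr rfl fun e _ => ?_
    rw [Finset.mul_sum, ← Finset.sum_add_distrib, Finset.mul_sum]
    refine Finset.sum_congr rfl fun p _ => ?_
    simp only [List.map_cons, List.prod_cons, List.sum_cons]
    ring
  have hv : ∀ v, ∑ e ∈ G.outEdges i v, u e * l e =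
      G.inflow i m l v * T v - ∑ e ∈ G.outEdges i v, l e * T (G.head e) := by
    intro v
    by_cases hd : v = G.dest i
    · subst hd
      rw [hTd, mul_zero, zero_sub, Finset.sum_eq_zero fun e he => by rw [h.out_dest e he, mul_zero],
        Finset.sum_eq_zero fun e he => by rw [h.out_dest e he, zero_mul], neg_zero]
    · rw [hTn v hd, Finset.mul_sum, ← Finset.sum_sub_distrib]
      refine Finset.sum_congr rfl fun e he => ?_
      obtain ⟨hs, rfl⟩ := mem_outEdges.1 he
      have h1 : l e * G.walkSum i g (G.head e) = l e := by
        by_cases h0 : l e = 0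
        · rw [h0, zero_mul]
        · rw [hW _ (h.inflow_head_ne_zero hs h0), mul_one]
      have h2 := hg e hs
      calc u e * l e = u e * (l e * G.walkSum i g (G.head e)) := by rw [h1]
        _ = (g e * G.inflow i m l (G.tail e)) * (u e * G.walkSum i g (G.head e) + T (G.head e))
            - l e * T (G.head e) := by rw [← h2]; ring
        _ = _ := by ring
  rw [← G.sum_outEdges i, Finset.sum_congr rfl fun v _ => hv v, Finset.sum_sub_distrib,
    G.sum_outEdges i, ← G.sum_inEdges i, ← Finset.sum_sub_distrib,
    Finset.sum_eq_single (G.origin i)]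
  · rw [Finset.sum_eq_zero fun e he => by rw [h.into_origin e he, zero_mul], inflow, if_pos rfl,
      sub_zero]
  · intro v _ hv
    rw [inflow, if_neg hv, Finset.sum_mul, sub_eq_zero]
    refine Finset.sum_congr rfl fun e he => ?_
    rw [(mem_inEdges.1 he).2]
  · simp

end IsEdgeFlow

theorem sum_map_single_of_nodup {p : List E} (hp : p.Nodup) (e : E) :
    (p.map (Pi.single e (1 : ℝ))).sum = if e ∈ p then 1 else 0 := by
  induction p with
  | nil => simp
  | cons a p ih =>
    obtain ⟨h1, h2⟩ := List.nodup_cons.1 hp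
    rw [List.map_cons, List.sum_cons, ih h2, Pi.single_apply]
    by_cases h : a = e
    · subst h; simp [h1]
    · simp [h, Ne.symm h]

/-- The load of the pair `i` on the edge `e` under a path flow. -/
noncomputable def pairLoad (f : ∀ i, G.Route i → ℝ) (i : Fin N) (e : E) : ℝ :=
  ∑ p : G.Route i, if e ∈ p.1 then f i p else 0

theorem load_eq_sum_pairLoad (f : ∀ i, G.Route i → ℝ) (e : E) :
    G.load f e = ∑ i, G.pairLoad f i e := rfl

theorem pairLoad_of_notMem (f : ∀ i, G.Route i → ℝ) {i : Fin N} {e : E} (he : e ∉ G.subgraph i) :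
    G.pairLoad f i e = 0 :=
  Finset.sum_eq_zero fun p _ => if_neg fun h => he (p.2.mem h)

theorem IsEdgeFlow.pairLoad_eq {i : Fin N} {l g : E → ℝ} {m : ℝ} (h : G.IsEdgeFlow i m l)
    (hg : ∀ e ∈ G.subgraph i, l e = g e * G.inflow i m l (G.tail e))
    (hW : ∀ v, G.inflow i m l v ≠ 0 → G.walkSum i g v = 1) {f : ∀ i, G.Route i → ℝ}
    (hf : ∀ p, f i p = m * (p.1.map g).prod) {e : E} (he : e ∈ G.subgraph i) :
    G.pairLoad f i e = l e := by
  have := h.sum_mul hg hW (Pi.single e 1)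
  rw [Finset.sum_eq_single e (fun e' _ h => by rw [Pi.single_apply, if_neg h, zero_mul])
    (fun h => absurd he h), Pi.single_eq_same, one_mul] at this
  rw [this, ← G.sum_route i fun p => (p.map g).prod * (p.map (Pi.single e (1 : ℝ))).sum, pairLoad,
    Finset.mul_sum]
  refine Finset.sum_congr rfl fun p _ => ?_
  rw [sum_map_single_of_nodup (G.walk_nodup i _ _ _ p.2), hf]
  split_ifs <;> ring

/-! ## Matching an edge flow by local flows -/

/-- The local flow that realizes the edge loads `l`. -/
noncomputable def matching (i : Fin N) (l : E → ℝ) (e : E) : ℝ :=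
  if e ∈ G.subgraph i then l e / G.inflow i (G.demand i) l (G.tail e) else 0

namespace IsEdgeFlow

variable {G} {i : Fin N} {l : E → ℝ}

theorem eq_matching_mul (h : G.IsEdgeFlow i (G.demand i) l) {e : E} (he : e ∈ G.subgraph i) :
    l e = G.matching i l e * G.inflow i (G.demand i) l (G.tail e) := by
  rw [matching, if_pos he]
  by_cases h0 : G.inflow i (G.demand i) l (G.tail e) = 0
  · rw [h0, mul_zero]
    by_cases hd : G.tail e = G.dest i
    · exact h.out_dest e (mem_outEdges.2 ⟨he, hd⟩)
    · have := h.balance _ hd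
      rw [h0] at this
      exact (Finset.sum_eq_zero_iff_of_nonneg
        fun e he => h.nonneg e (mem_outEdges.1 he).1).1 this e (mem_outEdges.2 ⟨he, rfl⟩)
  · rw [div_mul_cancel₀ _ h0]

theorem walkSum_matching (h : G.IsEdgeFlow i (G.demand i) l) (v : V)
    (hv : G.inflow i (G.demand i) l v ≠ 0) : G.walkSum i (G.matching i l) v = 1 := by
  revert hv
  refine G.backward_induction i (P := fun v => G.inflow i (G.demand i) l v ≠ 0 →
    G.walkSum i (G.matching i l) v = 1) (fun v ih hv => ?_) v
  by_cases hd : v = G.dest i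
  · rw [hd, walkSum_dest]
  · rw [G.walkSum_of_ne _ hd]
    have : ∀ e ∈ G.outEdges i v, G.matching i l e * G.walkSum i (G.matching i l) (G.head e) =
        l e / G.inflow i (G.demand i) l v := by
      intro e he
      obtain ⟨hs, ht⟩ := mem_outEdges.1 he
      rw [matching, if_pos hs, ht]
      by_cases h0 : l e = 0
      · rw [h0, zero_div, zero_mul]
      · rw [ih e he (h.inflow_head_ne_zero hs h0), mul_one]
    rw [Finset.sum_congr rfl this, ← Finset.sum_div, h.balance v hd, div_self hv]

theorem arrival_matching (h : G.IsEdgeFlow i (G.demand i) l) (v : V) :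
    G.arrival i (G.matching i l) v = G.inflow i (G.demand i) l v := by
  refine G.forward_induction i (P := fun v => G.arrival i (G.matching i l) v =
    G.inflow i (G.demand i) l v) (fun v ih => ?_) v
  rw [arrival, inflow]
  split_ifs
  · rfl
  · rw [Finset.sum_coe_sort (G.inEdges i v)
      fun e => G.matching i l e * G.arrival i (G.matching i l) (G.tail e)]
    refine Finset.sum_congr rfl fun e he => ?_
    rw [ih e he, ← h.eq_matching_mul (mem_inEdges.1 he).1]

theorem matching_nonneg (h : G.IsEdgeFlow i (G.demand i) l) (e : E) : 0 ≤ G.matching i l e := by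
  rw [matching]
  split_ifs with he
  · exact div_nonneg (h.nonneg e he) (h.inflow_nonneg (G.demand_pos i).le _)
  · exact le_rfl

end IsEdgeFlow

theorem isFlow_pathFlow_matching {l : Fin N → E → ℝ}
    (h : ∀ i, G.IsEdgeFlow i (G.demand i) (l i)) :
    G.IsFlow (G.pathFlow fun i => G.matching i (l i)) := by
  refine fun i => ⟨fun p => mul_nonneg (G.demand_pos i).le (List.prod_nonneg ?_), ?_⟩
  · simpa using fun e _ => (h i).matching_nonneg e
  · simp only [pathFlow]
    rw [← Finset.mul_sum, G.sum_route i fun p => (p.map (G.matching i (l i))).prod]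
    have := (h i).walkSum_matching (G.origin i)
      (by rw [inflow, if_pos rfl]; exact (G.demand_pos i).ne')
    rw [walkSum] at this
    rw [this, mul_one]

theorem pairLoad_pathFlow_matching {l : Fin N → E → ℝ} {i : Fin N}
    (h : G.IsEdgeFlow i (G.demand i) (l i)) {e : E} (he : e ∈ G.subgraph i) :
    G.pairLoad (G.pathFlow fun i => G.matching i (l i)) i e = l i e :=
  h.pairLoad_eq G (fun _ he => h.eq_matching_mul he) h.walkSum_matching (fun _ => rfl) he

theorem load_pathFlow_matching {l : Fin N → E → ℝ} (h : ∀ i, G.IsEdgeFlow i (G.demand i) (l i))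
    (e : E) : G.load (G.pathFlow fun i => G.matching i (l i)) e =
      ∑ i, if e ∈ G.subgraph i then l i e else 0 := by
  rw [load_eq_sum_pairLoad]
  refine Finset.sum_congr rfl fun i _ => ?_
  split_ifs with he
  · exact G.pairLoad_pathFlow_matching (h i) he
  · exact G.pairLoad_of_notMem _ he

theorem localLoad_matching {l : Fin N → E → ℝ} (h : ∀ i, G.IsEdgeFlow i (G.demand i) (l i))
    (e : E) : G.localLoad (fun i => G.matching i (l i)) e =
      ∑ i, if e ∈ G.subgraph i then l i e else 0 := by
  refine Finset.sum_congr rfl fun i _ => ?_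
  split_ifs with he
  · rw [(h i).arrival_matching, ← (h i).eq_matching_mul he]
  · rfl

/-! ## The pivot flow -/

/-- The local flow that sends traffic along walks proportionally to their exponential weights. -/
noncomputable def pivot (i : Fin N) (w : E → ℝ) (e : E) : ℝ :=
  if e ∈ G.subgraph i then Real.exp (w e) * G.walkSum i (fun e => Real.exp (w e)) (G.head e) /
    G.walkSum i (fun e => Real.exp (w e)) (G.tail e) else 0

theorem pivot_nonneg (i : Fin N) (w : E → ℝ) (e : E) : 0 ≤ G.pivot i w e := by
  rw [pivot]
  have h := G.walkSum_nonneg i (g := fun e => Real.exp (w e)) fun e => (Real.exp_pos _).le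
  split_ifs
  · exact div_nonneg (mul_nonneg (Real.exp_pos _).le (h _)) (h _)
  · exact le_rfl

theorem prod_pivot (i : Fin N) (w : E → ℝ) {v : V} {p : List E} (hp : p ∈ G.walks i v) :
    (p.map (G.pivot i w)).prod =
      Real.exp (p.map w).sum / G.walkSum i (fun e => Real.exp (w e)) v := by
  induction p generalizing v with
  | nil =>
    obtain rfl : v = G.dest i := mem_walks.1 hp
    simp [walkSum_dest]
  | cons e p ih =>
    obtain ⟨h1, rfl, h3⟩ := mem_walks.1 hp
    have hp' := mem_walks.2 h3
    have := G.walkSum_pos i (g := fun e => Real.exp (w e)) (fun e => Real.exp_pos _) hp'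
    have := G.walkSum_pos i (g := fun e => Real.exp (w e)) (fun e => Real.exp_pos _) hp
    rw [List.map_cons, List.prod_cons, ih hp', List.map_cons, List.sum_cons, Real.exp_add, pivot,
      if_pos h1]
    field_simp

theorem walkSum_pivot (i : Fin N) (w : E → ℝ) (v : V)
    (hv : G.walkSum i (fun e => Real.exp (w e)) v ≠ 0) : G.walkSum i (G.pivot i w) v = 1 := by
  have hexp : ∑ p ∈ G.walks i v, Real.exp (p.map w).sum =
      G.walkSum i (fun e => Real.exp (w e)) v :=
    Finset.sum_congr rfl fun p _ => by simp [Real.exp_list_sum, Function.comp_def]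
  rw [walkSum, Finset.sum_congr rfl fun p hp => G.prod_pivot i w hp, ← Finset.sum_div, hexp,
    div_self hv]

/-- The loads of the pivot local flow. -/
noncomputable def pivotLoad (i : Fin N) (w : E → ℝ) (e : E) : ℝ :=
  G.pivot i w e * G.arrival i (G.pivot i w) (G.tail e)

theorem arrival_of_idx_lt (i : Fin N) (y : E → ℝ) (v : V)
    (hv : (G.order i).idxOf v < (G.order i).idxOf (G.origin i)) : G.arrival i y v = 0 := by
  revert hv
  refine G.forward_induction i (P := fun v => (G.order i).idxOf v <
    (G.order i).idxOf (G.origin i) → G.arrival i y v = 0) (fun v ih hv => ?_) v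
  rw [arrival, if_neg (fun h => by rw [h] at hv; exact lt_irrefl _ hv)]
  refine Finset.sum_eq_zero fun e _ => ?_
  obtain ⟨h1, h2⟩ := mem_inEdges.1 e.2
  have := G.order_lt i _ h1
  rw [h2] at this
  rw [ih e.1 e.2 (this.trans hv), mul_zero]

theorem arrival_eq_inflow (i : Fin N) (y : E → ℝ) (v : V) :
    G.arrival i y v =
      G.inflow i (G.demand i) (fun e => y e * G.arrival i y (G.tail e)) v := by
  rw [arrival, inflow]
  congr 1
  exact Finset.sum_coe_sort (G.inEdges i v) fun e => y e * G.arrival i y (G.tail e)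

theorem arrival_nonneg (i : Fin N) {y : E → ℝ} (hy : ∀ e, 0 ≤ y e) (v : V) :
    0 ≤ G.arrival i y v := by
  refine G.forward_induction i (P := fun v => 0 ≤ G.arrival i y v) (fun v ih => ?_) v
  rw [arrival]
  split_ifs
  · exact (G.demand_pos i).le
  · exact Finset.sum_nonneg fun e _ => mul_nonneg (hy _) (ih e.1 e.2)

theorem arrival_pivot_ne_zero (i : Fin N) (w : E → ℝ) (v : V)
    (h : G.arrival i (G.pivot i w) v ≠ 0) : G.walkSum i (fun e => Real.exp (w e)) v ≠ 0 := by
  rw [arrival_eq_inflow, inflow] at h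
  split_ifs at h with ho
  · rw [ho]; exact (G.walkSum_origin_pos i fun e => Real.exp_pos _).ne'
  · contrapose! h
    refine Finset.sum_eq_zero fun e he => ?_
    obtain ⟨h1, rfl⟩ := mem_inEdges.1 he
    rw [pivot, if_pos h1, h, mul_zero, zero_div, zero_mul]

theorem walkSum_head_of_tail_eq_dest (i : Fin N) (g : E → ℝ) {e : E}
    (he : e ∈ G.outEdges i (G.dest i)) : G.walkSum i g (G.head e) = 0 := by
  refine Finset.sum_eq_zero fun p hp => ?_
  obtain ⟨h1, h2⟩ := mem_outEdges.1 he
  have h3 := G.walk_idx_add_length_le i (mem_walks.1 hp)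
  have h4 := G.order_lt i e h1
  rw [h2] at h4
  omega

theorem isEdgeFlow_pivotLoad (i : Fin N) (w : E → ℝ) :
    G.IsEdgeFlow i (G.demand i) (G.pivotLoad i w) := by
  refine ⟨fun e _ => mul_nonneg (G.pivot_nonneg i w e)
    (G.arrival_nonneg i (G.pivot_nonneg i w) _), fun e he => ?_, fun e he => ?_, fun v hv => ?_⟩
  · obtain ⟨h1, h2⟩ := mem_inEdges.1 he
    have := G.order_lt i e h1
    rw [h2] at this
    rw [pivotLoad, G.arrival_of_idx_lt i _ _ this, mul_zero]
  · rw [pivotLoad, pivot, G.walkSum_head_of_tail_eq_dest i _ he]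
    simp
  · change _ = G.inflow i (G.demand i)
      (fun e => G.pivot i w e * G.arrival i (G.pivot i w) (G.tail e)) v
    rw [← arrival_eq_inflow]
    have h1 : ∀ e ∈ G.outEdges i v, G.pivotLoad i w e = Real.exp (w e) *
        G.walkSum i (fun e => Real.exp (w e)) (G.head e) *
        (G.arrival i (G.pivot i w) v / G.walkSum i (fun e => Real.exp (w e)) v) := fun e he => by
      obtain ⟨h1, rfl⟩ := mem_outEdges.1 he
      rw [pivotLoad, pivot, if_pos h1]
      ring
    rw [Finset.sum_congr rfl h1, ← Finset.sum_mul, ← G.walkSum_of_ne _ hv]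
    by_cases h0 : G.arrival i (G.pivot i w) v = 0
    · rw [h0, zero_div, mul_zero]
    · rw [mul_div_cancel₀ _ (G.arrival_pivot_ne_zero i w v h0)]

/-- The logit path flow with edge scores `θ`. -/
noncomputable def logit (θ : E → ℝ) (i : Fin N) (p : G.Route i) : ℝ :=
  G.demand i * (Real.exp (p.1.map θ).sum / ∑ p' : G.Route i, Real.exp (p'.1.map θ).sum)

theorem walkSum_exp_origin (i : Fin N) (θ : E → ℝ) :
    G.walkSum i (fun e => Real.exp (θ e)) (G.origin i) =
      ∑ p : G.Route i, Real.exp (p.1.map θ).sum := by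
  rw [G.sum_route i fun p => Real.exp (p.map θ).sum]
  exact Finset.sum_congr rfl fun p _ => by simp [Real.exp_list_sum, Function.comp_def]

theorem pivotLoad_eq {i : Fin N} {w θ : E → ℝ} (hw : ∀ e ∈ G.subgraph i, w e = θ e) {e : E}
    (he : e ∈ G.subgraph i) : G.pivotLoad i w e = G.pairLoad (G.logit θ) i e := by
  have hmap : ∀ p : G.Route i, p.1.map w = p.1.map θ := fun p =>
    List.map_congr_left fun e he => hw e (p.2.mem he)
  have har : ∀ v, G.arrival i (G.pivot i w) v = G.inflow i (G.demand i) (G.pivotLoad i w) v :=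
    G.arrival_eq_inflow i _
  refine ((G.isEdgeFlow_pivotLoad i w).pairLoad_eq G (g := G.pivot i w) (fun e _ => ?_)
    (fun v hv => ?_) (fun p => ?_) he).symm
  · rw [← har]; rfl
  · exact G.walkSum_pivot i w v (G.arrival_pivot_ne_zero i w v (by rwa [har]))
  · rw [G.prod_pivot i w (mem_walks.2 p.2), G.walkSum_exp_origin, logit]
    simp only [hmap]

end RoutingNetwork

theorem foldl_prefix_induction {α β : Type} (P : List α → β → Prop) (f : β → α → β) (l : List α)
    (b : β) (h0 : P [] b)
    (hs : ∀ l₁ a l₂, l = l₁ ++ a :: l₂ → ∀ b, P l₁ b → P (l₁ ++ [a]) (f b a)) :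
    P l (l.foldl f b) := by
  have key : ∀ l₂ l₁ b, l = l₁ ++ l₂ → P l₁ b → P l (l₂.foldl f b) := by
    intro l₂
    induction l₂ with
    | nil => intro l₁ b h hP; rw [h, List.append_nil]; exact hP
    | cons a l₂ ih =>
      intro l₁ b h hP
      exact ih (l₁ ++ [a]) (f b a) (by simp [h]) (hs l₁ a l₂ h b hP)
  exact key l [] b rfl h0

theorem mem_of_idxOf_lt {α : Type} [DecidableEq α] {l₁ l₂ : List α} {a x : α}
    (ha : a ∉ l₁) (h : (l₁ ++ a :: l₂).idxOf x < (l₁ ++ a :: l₂).idxOf a) : x ∈ l₁ := by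
  by_contra hx
  rw [List.idxOf_append_of_notMem hx, List.idxOf_append_of_notMem ha] at h
  simp at h

theorem mem_of_lt_idxOf {α : Type} [DecidableEq α] {l₁ l₂ : List α} {a x : α}
    (hx : x ∈ l₁ ++ a :: l₂) (ha : a ∉ l₁)
    (h : (l₁ ++ a :: l₂).idxOf a < (l₁ ++ a :: l₂).idxOf x) : x ∈ l₂ := by
  rcases List.mem_append.1 hx with h1 | h1
  · rw [List.idxOf_append_of_mem h1, List.idxOf_append_of_notMem ha] at h
    have := List.idxOf_lt_length_of_mem h1
    simp at h
    omega
  · rcases List.mem_cons.1 h1 with rfl | h1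
    · exact absurd h (lt_irrefl _)
    · exact h1

namespace RoutingNetwork

variable {V E : Type} [Fintype V] [DecidableEq V] [Fintype E] [DecidableEq E] {N : ℕ}
  (G : RoutingNetwork V E N)

open Counted

theorem sum_toList_map (s : Finset E) (f : E → ℝ) : (s.toList.map f).sum = ∑ e ∈ s, f e :=
  Finset.sum_map_toList s f

theorem pushBackward_val (i : Fin N) (w : E → ℝ) : (G.pushBackward i w).val = G.pivot i w := by
  set B := G.walkSum i (fun e => Real.exp (w e)) with hB
  let P : List V → (V → ℝ) × (E → ℝ) → Prop := fun l a =>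
    (∀ v ∈ l, a.1 v = B v) ∧
      ∀ e, a.2 e = if e ∈ G.subgraph i ∧ G.tail e ∈ l then G.pivot i w e else 0
  simp only [pushBackward, val_bind, val_pure, val_foldlM, val_alloc]
  suffices h : P (G.order i).reverse _ from by
    ext e
    rw [h.2 e]
    simp only [List.mem_reverse, G.mem_order, and_true]
    split_ifs with he
    · rfl
    · rw [pivot, if_neg he]
  refine foldl_prefix_induction P _ _ _ ⟨by simp, by simp⟩ ?_
  rintro l₁ v l₂ hl a ⟨ha1, ha2⟩
  have hl' : G.order i = l₂.reverse ++ v :: l₁.reverse := by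
    rw [← List.reverse_reverse (G.order i), hl]; simp
  have hnd := G.order_nodup i
  have hout : ∀ e ∈ G.outEdges i v, G.head e ∈ l₁ := fun e he => by
    obtain ⟨h1, rfl⟩ := mem_outEdges.1 he
    have h2 := G.order_lt i e h1
    have h3 := G.mem_order i (G.head e)
    rw [hl'] at h2 h3 hnd
    refine List.mem_reverse.1 (mem_of_lt_idxOf h3 ?_ h2)
    exact fun h => (List.disjoint_of_nodup_append hnd) h (by simp)
  have hvl : v ∉ l₁ := fun h => by
    rw [hl'] at hnd
    exact (List.nodup_cons.1 (List.nodup_append.1 hnd).2.1).1 (List.mem_reverse.2 h)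
  have hb : ∀ v', v' ∈ l₁ ++ [v] → Function.update a.1 v (B v) v' = B v' := fun v' hv' => by
    rw [Function.update_apply]
    split_ifs with h
    · rw [h]
    · exact ha1 v' (by simpa [h] using hv')
  have hq : ∀ e, (G.outEdges i v).toList.foldl (fun q e => Function.update q e
      (Real.exp (w e) * Function.update a.1 v (B v) (G.head e) / B v)) a.2 e =
      if e ∈ G.subgraph i ∧ G.tail e ∈ l₁ ++ [v] then G.pivot i w e else 0 := fun e => by
    rw [foldl_update (f := fun e => Real.exp (w e) * Function.update a.1 v (B v) (G.head e) / B v),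
      ha2]
    simp only [Finset.mem_toList]
    by_cases he : e ∈ G.outEdges i v
    · rw [if_pos he, hb _ (List.mem_append_left _ (hout e he))]
      obtain ⟨h1, rfl⟩ := mem_outEdges.1 he
      rw [if_pos ⟨h1, by simp⟩, pivot, if_pos h1]
    · rw [if_neg he]
      refine if_congr ?_ rfl rfl
      rw [mem_outEdges] at he
      simp only [List.mem_append, List.mem_singleton]
      tauto
  by_cases hv : v = G.dest i
  · simp only [if_pos hv, val_bind, val_pure, val_write, val_foldlM, val_exp, val_mul, val_div]
    rw [show (1 : ℝ) = B v by rw [hv, hB, walkSum_dest]]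
    exact ⟨hb, hq⟩
  · simp only [if_neg hv, val_bind, val_pure, val_write, val_foldlM, val_exp, val_mul, val_div,
      val_sumOver, sum_toList_map]
    rw [show ∑ e ∈ G.outEdges i v, a.1 (G.head e) * Real.exp (w e) = B v by
      rw [hB, G.walkSum_of_ne _ hv]
      exact Finset.sum_congr rfl fun e he => by rw [ha1 _ (hout e he), mul_comm]]
    exact ⟨hb, hq⟩

theorem foldl_pull (l : List E) (hl : l.Nodup) (x : E → ℝ) (α A : ℝ)
    (b : (E → ℝ) × (E → ℝ) × (E → ℝ)) :
    l.foldl (fun (b : (E → ℝ) × (E → ℝ) × (E → ℝ)) e => (Function.update b.1 e (x e),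
      Function.update b.2.1 e ((α * x e + b.2.2 e) / A),
      Function.update b.2.2 e (b.2.2 e + α * x e))) b =
    (fun e => if e ∈ l then x e else b.1 e,
      fun e => if e ∈ l then (α * x e + b.2.2 e) / A else b.2.1 e,
      fun e => if e ∈ l then b.2.2 e + α * x e else b.2.2 e) := by
  induction l generalizing b with
  | nil => simp
  | cons a l ih =>
    obtain ⟨h1, h2⟩ := List.nodup_cons.1 hl
    rw [List.foldl_cons, ih h2]
    refine Prod.ext ?_ (Prod.ext ?_ ?_) <;> ext e <;> by_cases he : e = a <;>
      simp [he, h1]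

theorem pullForward_val (i : Fin N) (q z : E → ℝ) (α A : ℝ) :
    (G.pullForward i q z α A).val =
      (fun e => if e ∈ G.subgraph i then
        (α * (q e * G.arrival i q (G.tail e)) + z e) / A else 0,
      fun e => if e ∈ G.subgraph i then
        z e + α * (q e * G.arrival i q (G.tail e)) else z e) := by
  set X : E → ℝ := fun e => q e * G.arrival i q (G.tail e) with hX
  let P : List V → (E → ℝ) × (E → ℝ) × (E → ℝ) → Prop := fun l a =>
    a = (fun e => if e ∈ G.subgraph i ∧ G.tail e ∈ l then X e else 0,
      fun e => if e ∈ G.subgraph i ∧ G.tail e ∈ l then (α * X e + z e) / A else 0,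
      fun e => if e ∈ G.subgraph i ∧ G.tail e ∈ l then z e + α * X e else z e)
  simp only [pullForward, val_bind, val_pure, val_foldlM, val_alloc]
  have fin : ∀ a, P (G.order i) a → a.2 =
      (fun e => if e ∈ G.subgraph i then (α * X e + z e) / A else 0,
      fun e => if e ∈ G.subgraph i then z e + α * X e else z e) := by
    intro a ha
    rw [ha]
    simp only [G.mem_order, and_true]
  refine fin _ (foldl_prefix_induction P _ _ _ (by simp [P]) ?_)
  rintro l₁ v l₂ hl a rfl
  have hnd := G.order_nodup i
  have hvl : v ∉ l₁ := fun h => by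
    rw [hl] at hnd
    exact (List.disjoint_of_nodup_append hnd) h (by simp)
  have hin : ∀ e ∈ G.inEdges i v, G.tail e ∈ l₁ := fun e he => by
    obtain ⟨h1, rfl⟩ := mem_inEdges.1 he
    have h2 := G.order_lt i e h1
    rw [hl] at h2
    exact mem_of_idxOf_lt hvl h2
  have key : P (l₁ ++ [v]) ((G.outEdges i v).toList.foldl (fun b e =>
      (Function.update b.1 e (G.arrival i q v * q e),
        Function.update b.2.1 e ((α * (G.arrival i q v * q e) + b.2.2 e) / A),
        Function.update b.2.2 e (b.2.2 e + α * (G.arrival i q v * q e))))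
      (fun e => if e ∈ G.subgraph i ∧ G.tail e ∈ l₁ then X e else 0,
      fun e => if e ∈ G.subgraph i ∧ G.tail e ∈ l₁ then (α * X e + z e) / A else 0,
      fun e => if e ∈ G.subgraph i ∧ G.tail e ∈ l₁ then z e + α * X e else z e)) := by
    rw [foldl_pull _ (Finset.nodup_toList _) (fun e => G.arrival i q v * q e)]
    have hx : ∀ e, e ∈ G.outEdges i v → G.arrival i q v * q e = X e := fun e he => by
      rw [hX, ← (mem_outEdges.1 he).2, mul_comm]
    have hcond : ∀ e, (e ∈ G.subgraph i ∧ G.tail e ∈ l₁ ++ [v]) ↔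
        (e ∈ G.outEdges i v ∨ (e ∈ G.subgraph i ∧ G.tail e ∈ l₁)) := fun e => by
      simp only [mem_outEdges, List.mem_append, List.mem_singleton]; tauto
    have hdis : ∀ e, e ∈ G.outEdges i v → ¬ (e ∈ G.subgraph i ∧ G.tail e ∈ l₁) :=
      fun e he h => hvl ((mem_outEdges.1 he).2 ▸ h.2)
    simp only [P, hcond, Finset.mem_toList]
    refine Prod.ext ?_ (Prod.ext ?_ ?_) <;> ext e <;> by_cases he : e ∈ G.outEdges i v <;>
      simp [he, hx, hdis]
  by_cases hv : v = G.origin i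
  · simp only [if_pos hv, val_bind, val_pure, val_write, val_foldlM, val_mul, val_add, val_div]
    rw [show G.demand i = G.arrival i q v by rw [arrival, if_pos hv]]
    exact key
  · simp only [if_neg hv, val_bind, val_pure, val_write, val_foldlM, val_mul, val_add, val_div,
      val_sumOver, sum_toList_map]
    rw [show ∑ e ∈ G.inEdges i v, (if e ∈ G.subgraph i ∧ G.tail e ∈ l₁ then X e else 0) =
      G.arrival i q v by
        rw [arrival_eq_inflow, inflow, if_neg hv]
        exact Finset.sum_congr rfl fun e he => if_pos ⟨(mem_inEdges.1 he).1, hin e he⟩]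
    exact key

theorem matchLoad_val (i : Fin N) (l : E → ℝ) : (G.matchLoad i l).val = G.matching i l := by
  let P : List V → (E → ℝ) → Prop := fun l₁ a =>
    ∀ e, a e = if e ∈ G.subgraph i ∧ G.tail e ∈ l₁ then G.matching i l e else 0
  simp only [matchLoad, val_bind, val_foldlM, val_alloc]
  have fin : ∀ a, P (G.order i) a → a = G.matching i l := by
    intro a ha
    ext e
    rw [ha e]
    simp only [G.mem_order, and_true]
    split_ifs with he
    · rfl
    · rw [matching, if_neg he]
  refine fin _ (foldl_prefix_induction P _ _ _ (by simp [P]) ?_)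
  intro l₁ v l₂ hl a ha
  have key : P (l₁ ++ [v]) ((G.outEdges i v).toList.foldl (fun y e =>
      Function.update y e (l e / G.inflow i (G.demand i) l v)) a) := fun e => by
    rw [foldl_update (f := fun e => l e / G.inflow i (G.demand i) l v), ha]
    simp only [Finset.mem_toList]
    by_cases he : e ∈ G.outEdges i v
    · rw [if_pos he]
      obtain ⟨h1, rfl⟩ := mem_outEdges.1 he
      rw [if_pos ⟨h1, by simp⟩, matching, if_pos h1]
    · rw [if_neg he]
      refine if_congr ?_ rfl rfl
      rw [mem_outEdges] at he
      simp only [List.mem_append, List.mem_singleton]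
      tauto
  rw [inflow] at key
  by_cases hv : v = G.origin i
  · simp only [if_pos hv, val_bind, val_pure, val_write, val_foldlM, val_div] at key ⊢
    exact key
  · simp only [if_neg hv, val_bind, val_pure, val_write, val_foldlM, val_div, val_sumOver,
      sum_toList_map] at key ⊢
    exact key

/-- The averaged loads of pair `i`. -/
noncomputable def averageLoad (i : Fin N) (z w : E → ℝ) (α A : ℝ) (e : E) : ℝ :=
  if e ∈ G.subgraph i then (α * G.pivotLoad i w e + z e) / A else 0

/-- The updated anchor of pair `i`. -/
noncomputable def nextAnchor (i : Fin N) (z w : E → ℝ) (α : ℝ) (e : E) : ℝ :=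
  if e ∈ G.subgraph i then z e + α * G.pivotLoad i w e else z e

theorem foldl_update_pair {ι α β : Type} [DecidableEq ι] (l : List ι) (f : ι → α) (g : ι → β)
    (r : (ι → α) × (ι → β)) :
    l.foldl (fun (r : (ι → α) × (ι → β)) i =>
      (Function.update r.1 i (f i), Function.update r.2 i (g i))) r =
    (fun i => if i ∈ l then f i else r.1 i, fun i => if i ∈ l then g i else r.2 i) := by
  induction l generalizing r with
  | nil => simp
  | cons a l ih =>
    rw [List.foldl_cons, ih]
    refine Prod.ext ?_ ?_ <;> ext i <;> by_cases he : i = a <;> simp [he]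

theorem pushPullMatch_val (z w : Fin N → E → ℝ) (α A : ℝ) :
    (G.pushPullMatch z w α A).val =
      (fun i => G.matching i (G.averageLoad i (z i) (w i) α A),
        fun i => G.nextAnchor i (z i) (w i) α) := by
  simp only [pushPullMatch, val_bind, val_foldlM, val_alloc, val_pure, val_write,
    pushBackward_val, pullForward_val, matchLoad_val]
  have := foldl_update_pair (List.finRange N)
    (fun i => G.matching i (G.averageLoad i (z i) (w i) α A))
    (fun i => G.nextAnchor i (z i) (w i) α) ((fun _ => (0 : E → ℝ)), z)
  simp only [List.mem_finRange, if_true] at this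
  exact this

/-! ## The algorithm in terms of path flows -/

theorem pairLoad_linear (f g : ∀ i, G.Route i → ℝ) (a b : ℝ) (i : Fin N) (e : E) :
    G.pairLoad (fun i p => a * f i p + b * g i p) i e =
      a * G.pairLoad f i e + b * G.pairLoad g i e := by
  simp only [pairLoad, Finset.mul_sum, ← Finset.sum_add_distrib]
  refine Finset.sum_congr rfl fun p _ => ?_
  split_ifs <;> simp

theorem load_linear (f g : ∀ i, G.Route i → ℝ) (a b : ℝ) (e : E) :
    G.load (fun i p => a * f i p + b * g i p) e = a * G.load f e + b * G.load g e := by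
  simp only [load_eq_sum_pairLoad, pairLoad_linear, Finset.sum_add_distrib, Finset.mul_sum]

/-- The state of the algorithm at the level of path flows: the negative cumulative costs, the
cumulative pivot flows, and the cumulative squared cost variations. -/
structure PathState where
  weight : E → ℝ
  anchor : ∀ i, G.Route i → ℝ
  rateSum : ℝ

/-- The sum of the first `t + 1` steps. -/
noncomputable def stepTotal (t : ℕ) : ℝ := (t + 1) * (t + 2) / 2

theorem stepTotal_pos (t : ℕ) : 0 < stepTotal t := by unfold stepTotal; positivity

namespace PathState

variable {G} {S : Type*} (c : E → ℝ → S → ℝ) (t : ℕ) (s : G.PathState)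

noncomputable def rate : ℝ := 1 / Real.sqrt (1 + s.rateSum)

/-- The average of the pivot flow with scores `θ` and the earlier pivot flows. -/
noncomputable def averageFlow (θ : E → ℝ) (i : Fin N) (p : G.Route i) : ℝ :=
  (t + 1) / stepTotal t * G.logit θ i p + 1 / stepTotal t * s.anchor i p

noncomputable def testScore (e : E) : ℝ := s.rate * s.weight e

noncomputable def testCost (x : S) (e : E) : ℝ :=
  c e (G.load (s.averageFlow t s.testScore) e) x

noncomputable def score (x : S) (e : E) : ℝ := s.rate * (s.weight e - (t + 1) * s.testCost c t x e)

/-- The recommended flow. -/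
noncomputable def flow (x : S) : ∀ i, G.Route i → ℝ := s.averageFlow t (s.score c t x)

noncomputable def cost (x x' : S) (e : E) : ℝ := c e (G.load (s.flow c t x) e) x'

noncomputable def next (x x' : S) : G.PathState where
  weight e := s.weight e - (t + 1) * s.cost c t x x' e
  anchor i p := s.anchor i p + (t + 1) * G.logit (s.score c t x) i p
  rateSum := s.rateSum +
    ((t + 1) * G.routeNorm fun e => s.cost c t x x' e - s.testCost c t x e) ^ 2

end PathState

/-- The states of the algorithm before the iterations. -/
noncomputable def pathRun {S : Type*} (c : E → ℝ → S → ℝ) (ζ : ℕ × Bool → S) : ℕ → G.PathState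
  | 0 => ⟨0, fun _ _ => 0, 0⟩
  | t + 1 => (pathRun c ζ t).next c t (ζ (t + 1, false)) (ζ (t + 1, true))

/-- The flow recommended in epoch `t + 1`. -/
noncomputable def runFlow {S : Type*} (c : E → ℝ → S → ℝ) (ζ : ℕ × Bool → S) (t : ℕ) :
    ∀ i, G.Route i → ℝ := (G.pathRun c ζ t).flow c t (ζ (t + 1, false))

theorem tabulate_val (f : Fin N → E → Counted ℝ) (i : Fin N) (e : E) :
    (G.tabulate f).val i e = if e ∈ G.subgraph i then (f i e).val else 0 := by
  simp only [tabulate, val_bind, val_foldlM, val_alloc, val_write]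
  rw [foldl_update (f := fun i => (G.subgraph i).toList.foldl
    (fun row e => Function.update row e (f i e).val) fun _ => 0), if_pos (List.mem_finRange i),
    foldl_update (f := fun e => (f i e).val)]
  simp

theorem measureCosts_val (cost : E → ℝ) : (measureCosts cost).val = cost := by
  simp only [measureCosts, val_bind, val_foldlM, val_alloc, val_write, val_op]
  ext e
  rw [foldl_update (f := cost)]
  simp

section Match

variable {G} {i : Fin N} {t : ℕ} {s : G.PathState} {z w θ : E → ℝ}

theorem averageLoad_eq (hz : ∀ e ∈ G.subgraph i, z e = G.pairLoad s.anchor i e)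
    (hw : ∀ e ∈ G.subgraph i, w e = θ e) {e : E} (he : e ∈ G.subgraph i) :
    G.averageLoad i z w (t + 1) (stepTotal t) e = G.pairLoad (s.averageFlow t θ) i e := by
  rw [averageLoad, if_pos he, G.pivotLoad_eq hw he, hz e he]
  unfold PathState.averageFlow
  rw [pairLoad_linear]
  ring

theorem isEdgeFlow_averageLoad (w : E → ℝ)
    (hz : G.IsEdgeFlow i (t * (t + 1) / 2 * G.demand i) z) :
    G.IsEdgeFlow i (G.demand i) (G.averageLoad i z w (t + 1) (stepTotal t)) := by
  have hA := stepTotal_pos t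
  have h := ((G.isEdgeFlow_pivotLoad i w).linear hz (a := (t + 1) / stepTotal t)
    (b := 1 / stepTotal t) (by positivity) (by positivity)).congr
    (l' := G.averageLoad i z w (t + 1) (stepTotal t))
    (fun e he => by rw [averageLoad, if_pos he]; ring)
  convert h using 1
  field_simp
  unfold stepTotal
  ring

theorem isEdgeFlow_nextAnchor (w : E → ℝ)
    (hz : G.IsEdgeFlow i (t * (t + 1) / 2 * G.demand i) z) :
    G.IsEdgeFlow i (stepTotal t * G.demand i) (G.nextAnchor i z w (t + 1)) := by
  have h := ((G.isEdgeFlow_pivotLoad i w).linear hz (a := (t + 1))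
    (b := 1) (by positivity) (by positivity)).congr
    (l' := G.nextAnchor i z w (t + 1))
    (fun e he => by rw [nextAnchor, if_pos he]; ring)
  convert h using 1
  unfold stepTotal
  ring

end Match

/-- The state `a` of the program before iteration `t + 1` represents the state `s`. -/
structure Represents (t : ℕ) (a : AdaState E N) (s : G.PathState) : Prop where
  weight : ∀ i, ∀ e ∈ G.subgraph i, a.weight i e = s.weight e
  isEdgeFlow : ∀ i, G.IsEdgeFlow i (t * (t + 1) / 2 * G.demand i) (a.anchor i)
  anchor : ∀ i, ∀ e ∈ G.subgraph i, a.anchor i e = G.pairLoad s.anchor i e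
  rate : a.rate = s.rate
  stepSum : a.stepSum = t * (t + 1) / 2
  rateSum : a.rateSum = s.rateSum

theorem sum_pairLoad_subgraph (f : ∀ i, G.Route i → ℝ) (e : E) :
    (∑ i, if e ∈ G.subgraph i then G.pairLoad f i e else 0) = G.load f e := by
  rw [load_eq_sum_pairLoad]
  refine Finset.sum_congr rfl fun i _ => ?_
  split_ifs with h
  · rfl
  · rw [G.pairLoad_of_notMem f h]

namespace Represents

variable {G} {t : ℕ} {a : AdaState E N} {s : G.PathState}

theorem pushPullMatch (h : G.Represents t a s) {w : Fin N → E → ℝ} {θ : E → ℝ}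
    (hw : ∀ i, ∀ e ∈ G.subgraph i, w i e = θ e) :
    let r := (G.pushPullMatch a.anchor w (t + 1) (stepTotal t)).val
    G.IsFlow (G.pathFlow r.1) ∧ (∀ e, G.load (G.pathFlow r.1) e = G.load (s.averageFlow t θ) e) ∧
    (∀ e, G.localLoad r.1 e = G.load (s.averageFlow t θ) e) ∧
    (∀ i, G.IsEdgeFlow i (stepTotal t * G.demand i) (r.2 i)) ∧
    ∀ i, ∀ e ∈ G.subgraph i,
      r.2 i e = G.pairLoad (fun i p => s.anchor i p + (t + 1) * G.logit θ i p) i e := by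
  have hf : ∀ i, G.IsEdgeFlow i (G.demand i)
      (G.averageLoad i (a.anchor i) (w i) (t + 1) (stepTotal t)) :=
    fun i => isEdgeFlow_averageLoad (w i) (h.isEdgeFlow i)
  have hl : ∀ e, (∑ i, if e ∈ G.subgraph i then
      G.averageLoad i (a.anchor i) (w i) (t + 1) (stepTotal t) e else 0) =
      G.load (s.averageFlow t θ) e := fun e => by
    rw [← sum_pairLoad_subgraph]
    refine Finset.sum_congr rfl fun i _ => ?_
    split_ifs with he
    · exact averageLoad_eq (h.anchor i) (hw i) he
    · rfl
  rw [pushPullMatch_val]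
  refine ⟨G.isFlow_pathFlow_matching hf, fun e => (G.load_pathFlow_matching hf e).trans (hl e),
    fun e => (G.localLoad_matching hf e).trans (hl e),
    fun i => isEdgeFlow_nextAnchor (w i) (h.isEdgeFlow i), fun i e he => ?_⟩
  change G.nextAnchor i (a.anchor i) (w i) (t + 1) e = _
  have := G.pairLoad_linear s.anchor (G.logit θ) 1 (t + 1) i e
  simp only [one_mul] at this
  rw [this, nextAnchor, if_pos he, G.pivotLoad_eq (hw i) he, h.anchor i e he]

theorem iteration (h : G.Represents t a s) {S : Type*} (c : E → ℝ → S → ℝ) (x x' : S) :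
    let a' := (G.iteration (fun y e => c e (G.localLoad y e) x)
      (fun y e => c e (G.localLoad y e) x') (t + 1) a).val
    G.Represents (t + 1) a' (s.next c t x x') ∧ G.IsFlow (G.pathFlow a'.localFlow) ∧
      ∀ e, G.load (G.pathFlow a'.localFlow) e = G.load (s.flow c t x) e := by
  have hA : a.stepSum + (t + 1 : ℝ) = stepTotal t := by rw [h.stepSum, stepTotal]; ring
  simp only [RoutingNetwork.iteration, val_bind, val_pure, val_add, val_mul, val_sqrt, val_div,
    hA, measureCosts_val, val_sub, val_foldlM, val_alloc, val_write, routeNormProgram_val]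
  obtain ⟨-, -, htest, -, -⟩ := h.pushPullMatch (θ := s.testScore)
    (w := (G.tabulate fun i e => Counted.mul a.rate (a.weight i e)).val) (fun i e he => by
      rw [tabulate_val, if_pos he, val_mul, h.rate, h.weight i e he]; rfl)
  set y₁ := (G.pushPullMatch a.anchor (G.tabulate fun i e => Counted.mul a.rate (a.weight i e)).val
    (t + 1) (stepTotal t)).val.1 with hy₁
  have hct : ∀ e, c e (G.localLoad y₁ e) x = s.testCost c t x e := fun e => by
    rw [htest]; rfl
  simp only [hct]
  obtain ⟨h1, h2, h3, h4, h5⟩ := h.pushPullMatch (θ := s.score c t x)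
    (w := (G.tabulate fun i e => Counted.mul a.rate ((G.tabulate fun i e => do
      let x ← Counted.mul (t + 1) (s.testCost c t x e)
      Counted.sub (a.weight i e) x).val i e)).val) (fun i e he => by
      rw [tabulate_val, if_pos he, val_mul, tabulate_val, if_pos he, h.rate]
      simp only [val_bind, val_mul, val_sub, h.weight i e he]; rfl)
  set r := (G.pushPullMatch a.anchor (G.tabulate fun i e => Counted.mul a.rate
    ((G.tabulate fun i e => do
      let x ← Counted.mul (t + 1) (s.testCost c t x e)
      Counted.sub (a.weight i e) x).val i e)).val (t + 1) (stepTotal t)).val with hr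
  have hcr : ∀ e, c e (G.localLoad r.1 e) x' = s.cost c t x x' e := fun e => by
    rw [h3]; rfl
  have hu : ((Finset.univ : Finset E).toList.foldl (fun u e =>
      Function.update u e (s.cost c t x x' e - s.testCost c t x e)) fun _ => 0) =
      fun e => s.cost c t x x' e - s.testCost c t x e := by
    ext e
    rw [foldl_update (f := fun e => s.cost c t x x' e - s.testCost c t x e)]
    simp
  simp only [hcr, hu]
  have hAt : ((t + 1 : ℕ) : ℝ) * ((t + 1 : ℕ) + 1) / 2 = stepTotal t := by
    rw [stepTotal]; push_cast; ring
  refine ⟨⟨fun i e he => ?_, fun i => ?_, h5, ?_, hAt.symm, ?_⟩, h1, h2⟩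
  · dsimp only
    rw [tabulate_val, if_pos he]
    simp only [val_bind, val_mul, val_sub, h.weight i e he]
    rfl
  · rw [hAt]; exact h4 i
  · simp only [PathState.rate, PathState.next, h.rateSum, sq]
  · simp only [PathState.next, h.rateSum, sq]

end Represents

theorem represents_adaLight {S : Type*} (c : E → ℝ → S → ℝ) (ζ : ℕ × Bool → S) (t : ℕ) :
    G.Represents t (G.adaLight c ζ t) (G.pathRun c ζ t) := by
  induction t with
  | zero =>
    refine ⟨fun _ _ _ => rfl, fun i => ?_, fun i e _ => ?_, ?_, ?_, rfl⟩
    · simpa [adaLight] using IsEdgeFlow.zero (G := G) i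
    · simp [adaLight, pathRun, pairLoad]
    · simp [adaLight, pathRun, PathState.rate]
    · simp [adaLight]
  | succ t ih => exact (ih.iteration c _ _).1

theorem isFlow_adaLightFlow {S : Type*} (c : E → ℝ → S → ℝ) (ζ : ℕ × Bool → S) (t : ℕ) :
    G.IsFlow (G.adaLightFlow c ζ (t + 1)) :=
  ((G.represents_adaLight c ζ t).iteration c _ _).2.1

theorem load_adaLightFlow {S : Type*} (c : E → ℝ → S → ℝ) (ζ : ℕ × Bool → S) (t : ℕ) (e : E) :
    G.load (G.adaLightFlow c ζ (t + 1)) e = G.load (G.runFlow c ζ t) e :=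
  ((G.represents_adaLight c ζ t).iteration c _ _).2.2 e

/-! ## The log-partition function -/

/-- Total cost of the path flow `f` for the edge costs `u`. -/
noncomputable def pairing (u : E → ℝ) (f : ∀ i, G.Route i → ℝ) : ℝ :=
  ∑ i, ∑ p : G.Route i, f i p * (p.1.map u).sum

/-- The `ℓ¹` distance of path flows. -/
noncomputable def flowDist (f g : ∀ i, G.Route i → ℝ) : ℝ :=
  ∑ i, ∑ p : G.Route i, |f i p - g i p|

noncomputable def partition (θ : E → ℝ) (i : Fin N) : ℝ :=
  ∑ p : G.Route i, Real.exp (p.1.map θ).sum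

noncomputable def logPartition (θ : E → ℝ) : ℝ :=
  ∑ i, G.demand i * Real.log (G.partition θ i)

theorem list_sum_map_linear (p : List E) (u v : E → ℝ) (a b : ℝ) :
    (p.map fun e => a * u e + b * v e).sum = a * (p.map u).sum + b * (p.map v).sum := by
  induction p with
  | nil => simp
  | cons e p ih => simp only [List.map_cons, List.sum_cons, ih]; ring

theorem pairing_linear (u v : E → ℝ) (a b : ℝ) (f : ∀ i, G.Route i → ℝ) :
    G.pairing (fun e => a * u e + b * v e) f = a * G.pairing u f + b * G.pairing v f := by
  simp only [pairing, Finset.mul_sum, ← Finset.sum_add_distrib, list_sum_map_linear]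
  exact Finset.sum_congr rfl fun i _ => Finset.sum_congr rfl fun p _ => by ring

theorem pairing_eq_sum_load (u : E → ℝ) (f : ∀ i, G.Route i → ℝ) :
    G.pairing u f = ∑ e, u e * G.load f e := by
  simp only [pairing, load, Finset.mul_sum]
  rw [Finset.sum_comm]
  refine Finset.sum_congr rfl fun i _ => ?_
  rw [Finset.sum_comm]
  refine Finset.sum_congr rfl fun p _ => ?_
  have hp : p.1.toFinset = Finset.univ.filter fun e => e ∈ p.1 := by ext; simp
  rw [← List.sum_toFinset u (G.walk_nodup i _ _ _ p.2), hp, Finset.sum_filter, Finset.mul_sum]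
  refine Finset.sum_congr rfl fun e _ => ?_
  split_ifs <;> ring

theorem flowDist_nonneg (f g : ∀ i, G.Route i → ℝ) : 0 ≤ G.flowDist f g :=
  Finset.sum_nonneg fun _ _ => Finset.sum_nonneg fun _ _ => abs_nonneg _

theorem flowDist_comm (f g : ∀ i, G.Route i → ℝ) : G.flowDist f g = G.flowDist g f := by
  simp only [flowDist, abs_sub_comm]

theorem IsFlow.sum_eq {f : ∀ i, G.Route i → ℝ} (hf : G.IsFlow f) :
    ∑ i, ∑ p, f i p = G.totalDemand :=
  Finset.sum_congr rfl fun i _ => (hf i).2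

theorem flowDist_le {f g : ∀ i, G.Route i → ℝ} (hf : G.IsFlow f) (hg : G.IsFlow g) :
    G.flowDist f g ≤ 2 * G.totalDemand := by
  rw [two_mul]
  nth_rewrite 1 [← hf.sum_eq]
  rw [← hg.sum_eq]
  simp only [← Finset.sum_add_distrib, flowDist]
  refine Finset.sum_le_sum fun i _ => Finset.sum_le_sum fun p _ => ?_
  have h1 := (hf i).1 p
  have h2 := (hg i).1 p
  exact abs_sub_le_iff.2 ⟨by linarith, by linarith⟩

theorem totalDemand_nonneg : 0 ≤ G.totalDemand :=
  Finset.sum_nonneg fun i _ => (G.demand_pos i).le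

theorem abs_list_sum_le (u : E → ℝ) (p : List E) :
    |(p.map u).sum| ≤ (p.map fun e => |u e|).sum := by
  induction p with
  | nil => simp
  | cons e p ih =>
    simp only [List.map_cons, List.sum_cons]
    exact (abs_add_le _ _).trans (add_le_add_right ih _)

theorem pairing_sub_le (u : E → ℝ) (f g : ∀ i, G.Route i → ℝ) :
    G.pairing u f - G.pairing u g ≤ G.routeNorm u * G.flowDist f g := by
  simp only [pairing, flowDist, ← Finset.sum_sub_distrib, Finset.mul_sum]
  refine Finset.sum_le_sum fun i _ => Finset.sum_le_sum fun p _ => ?_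
  rw [← sub_mul]
  refine (le_abs_self _).trans ?_
  rw [abs_mul, mul_comm]
  exact mul_le_mul_of_nonneg_right ((abs_list_sum_le u p.1).trans (G.le_routeNorm u i p))
    (abs_nonneg _)

theorem partition_pos (θ : E → ℝ) (i : Fin N) : 0 < G.partition θ i :=
  Finset.sum_pos (fun _ _ => Real.exp_pos _) Finset.univ_nonempty

theorem logit_pos (θ : E → ℝ) (i : Fin N) (p : G.Route i) : 0 < G.logit θ i p :=
  mul_pos (G.demand_pos i) (div_pos (Real.exp_pos _) (G.partition_pos θ i))

theorem isFlow_logit (θ : E → ℝ) : G.IsFlow (G.logit θ) := by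
  refine fun i => ⟨fun p => (G.logit_pos θ i p).le, ?_⟩
  simp only [logit]
  rw [← Finset.mul_sum, ← Finset.sum_div]
  exact (congrArg _ (div_self (G.partition_pos θ i).ne')).trans (mul_one _)

theorem log_logit (θ : E → ℝ) (i : Fin N) (p : G.Route i) :
    Real.log (G.logit θ i p) =
      Real.log (G.demand i) + ((p.1.map θ).sum - Real.log (G.partition θ i)) := by
  change Real.log (G.demand i * (Real.exp (p.1.map θ).sum / G.partition θ i)) = _
  rw [Real.log_mul (G.demand_pos i).ne'
    (div_pos (Real.exp_pos _) (G.partition_pos θ i)).ne', Real.log_div (Real.exp_pos _).ne'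
    (G.partition_pos θ i).ne', Real.log_exp]

theorem mul_log_sub_log_ge {a b : ℝ} (ha : 0 < a) (hb : 0 < b) :
    (Real.sqrt a - Real.sqrt b) ^ 2 + (a - b) ≤ a * (Real.log a - Real.log b) := by
  have h1 := Real.sqrt_pos.2 ha
  have h2 := Real.sqrt_pos.2 hb
  have h := Real.log_le_sub_one_of_pos (div_pos h2 h1)
  rw [Real.log_div h2.ne' h1.ne', Real.log_sqrt ha.le, Real.log_sqrt hb.le] at h
  have e1 := Real.sq_sqrt ha.le
  have e2 := Real.sq_sqrt hb.le
  have h3 : a * (Real.log b / 2 - Real.log a / 2) ≤ a * (Real.sqrt b / Real.sqrt a - 1) :=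
    mul_le_mul_of_nonneg_left h ha.le
  have h4 : a * (Real.sqrt b / Real.sqrt a - 1) = Real.sqrt a * Real.sqrt b - a := by
    nth_rewrite 1 [← e1]
    field_simp
    rw [mul_sub, ← sq, e1]
  nlinarith

theorem flowDist_sq_le {f g : ∀ i, G.Route i → ℝ} (hf : G.IsFlow f) (hg : G.IsFlow g) :
    G.flowDist f g ^ 2 ≤ 4 * G.totalDemand *
      ∑ i, ∑ p : G.Route i, (Real.sqrt (f i p) - Real.sqrt (g i p)) ^ 2 := by
  have h1 : G.flowDist f g = ∑ r : (Σ i, G.Route i),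
      |Real.sqrt (f r.1 r.2) - Real.sqrt (g r.1 r.2)| *
        (Real.sqrt (f r.1 r.2) + Real.sqrt (g r.1 r.2)) := by
    rw [Fintype.sum_sigma]
    refine Finset.sum_congr rfl fun i _ => Finset.sum_congr rfl fun p _ => ?_
    have e1 := Real.sq_sqrt ((hf i).1 p)
    have e2 := Real.sq_sqrt ((hg i).1 p)
    have h3 : 0 ≤ Real.sqrt (f i p) + Real.sqrt (g i p) := by positivity
    dsimp only
    rw [← abs_of_nonneg h3, ← abs_mul]
    nth_rewrite 1 [← e1]
    rw [← e2, Real.sqrt_sq (Real.sqrt_nonneg _)]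
    congr 1
    ring
  have h2 : ∑ r : (Σ i, G.Route i), (Real.sqrt (f r.1 r.2) + Real.sqrt (g r.1 r.2)) ^ 2 ≤
      4 * G.totalDemand := by
    have : ∑ r : (Σ i, G.Route i), (2 * f r.1 r.2 + 2 * g r.1 r.2) = 4 * G.totalDemand := by
      rw [Fintype.sum_sigma, Finset.sum_congr rfl fun i _ => Finset.sum_add_distrib,
        Finset.sum_add_distrib]
      simp only [← Finset.mul_sum]
      rw [hf.sum_eq, hg.sum_eq]
      ring
    rw [← this]
    refine Finset.sum_le_sum fun r _ => ?_
    have e1 := Real.sq_sqrt ((hf r.1).1 r.2)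
    have e2 := Real.sq_sqrt ((hg r.1).1 r.2)
    nlinarith [sq_nonneg (Real.sqrt (f r.1 r.2) - Real.sqrt (g r.1 r.2))]
  rw [h1]
  refine (Finset.sum_mul_sq_le_sq_mul_sq _ _ _).trans ?_
  simp only [sq_abs]
  rw [mul_comm, Fintype.sum_sigma (f := fun r : (Σ i, G.Route i) =>
    (Real.sqrt (f r.1 r.2) - Real.sqrt (g r.1 r.2)) ^ 2)]
  exact mul_le_mul_of_nonneg_right h2
    (Finset.sum_nonneg fun i _ => Finset.sum_nonneg fun p _ => sq_nonneg _)

/-- The Bregman divergence of the log-partition function at `b`, `a` dominates the squared distance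
of the logit flows. -/
theorem flowDist_logit_sq_le (a b : E → ℝ) :
    G.flowDist (G.logit a) (G.logit b) ^ 2 ≤ 4 * G.totalDemand *
      (G.logPartition b - G.logPartition a -
        (G.pairing b (G.logit a) - G.pairing a (G.logit a))) := by
  refine (G.flowDist_sq_le (G.isFlow_logit a) (G.isFlow_logit b)).trans
    (mul_le_mul_of_nonneg_left ?_ (mul_nonneg (by norm_num) G.totalDemand_nonneg))
  simp only [logPartition, pairing, ← Finset.sum_sub_distrib]
  refine Finset.sum_le_sum fun i _ => ?_
  have h := Finset.sum_le_sum fun (p : G.Route i) (_ : p ∈ Finset.univ) =>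
    mul_log_sub_log_ge (G.logit_pos a i p) (G.logit_pos b i p)
  rw [Finset.sum_add_distrib, Finset.sum_sub_distrib, (G.isFlow_logit a i).2,
    (G.isFlow_logit b i).2, sub_self, add_zero] at h
  refine h.trans (le_of_eq ?_)
  have h2 : G.demand i * Real.log (G.partition b i) - G.demand i * Real.log (G.partition a i) =
      ∑ p, G.logit a i p * (Real.log (G.partition b i) - Real.log (G.partition a i)) := by
    rw [← Finset.sum_mul, (G.isFlow_logit a i).2, mul_sub]
  rw [h2, ← Finset.sum_sub_distrib]
  refine Finset.sum_congr rfl fun p _ => ?_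
  rw [log_logit, log_logit]
  ring

theorem totalDemand_pos (hN : 1 ≤ N) : 0 < G.totalDemand :=
  Finset.sum_pos (fun i _ => G.demand_pos i) ⟨⟨0, hN⟩, Finset.mem_univ _⟩

theorem pairing_le_logPartition (θ : E → ℝ) {f : ∀ i, G.Route i → ℝ} (hf : G.IsFlow f) :
    G.pairing θ f ≤ G.logPartition θ := by
  refine Finset.sum_le_sum fun i _ => ?_
  rw [← (hf i).2, Finset.sum_mul]
  refine Finset.sum_le_sum fun p _ => mul_le_mul_of_nonneg_left ?_ ((hf i).1 p)
  rw [Real.le_log_iff_exp_le (G.partition_pos θ i)]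
  exact Finset.single_le_sum (f := fun p : G.Route i => Real.exp (p.1.map θ).sum)
    (fun _ _ => (Real.exp_pos _).le) (Finset.mem_univ p)

theorem logPartition_zero :
    G.logPartition 0 = ∑ i, G.demand i * Real.log (Fintype.card (G.Route i)) := by
  refine Finset.sum_congr rfl fun i _ => ?_
  have : ∀ p : List E, (p.map (0 : E → ℝ)).sum = 0 := fun p => by
    induction p with
    | nil => simp
    | cons a p ih => simp only [List.map_cons, List.sum_cons, ih]; simp
  simp [partition, this]

theorem logPartition_zero_le : G.logPartition 0 ≤ G.totalDemand * Real.log G.numRoutes := by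
  rw [logPartition_zero, totalDemand, Finset.sum_mul]
  refine Finset.sum_le_sum fun i _ => mul_le_mul_of_nonneg_left ?_ (G.demand_pos i).le
  refine Real.log_le_log (Nat.cast_pos.2 Fintype.card_pos) (Nat.cast_le.2 ?_)
  exact Finset.single_le_sum (f := fun i => Fintype.card (G.Route i)) (fun _ _ => Nat.zero_le _)
    (Finset.mem_univ i)

theorem logPartition_zero_nonneg : 0 ≤ G.logPartition 0 := by
  rw [logPartition_zero]
  exact Finset.sum_nonneg fun i _ => mul_nonneg (G.demand_pos i).le (Real.log_natCast_nonneg _)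

theorem logPartition_scale (hN : 1 ≤ N) (w : E → ℝ) {a b : ℝ} (ha : 0 ≤ a) (hab : a ≤ b) :
    b * G.logPartition (fun e => a * w e) ≤
      a * G.logPartition (fun e => b * w e) + (b - a) * G.logPartition 0 := by
  have hM := G.totalDemand_pos hN
  have h : ∀ x, 0 ≤ G.logPartition (fun e => x * w e) - G.logPartition (fun e => a * w e) -
      (x - a) * G.pairing w (G.logit fun e => a * w e) := fun x => by
    have h1 := (sq_nonneg _).trans (G.flowDist_logit_sq_le (fun e => a * w e) fun e => x * w e)
    have h2 := nonneg_of_mul_nonneg_right h1 (by linarith)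
    have h3 := fun x => G.pairing_linear w w x 0 (G.logit fun e => a * w e)
    simp only [zero_mul, add_zero] at h3
    rw [h3, h3] at h2
    linarith
  have h1 := h b
  have h2 := h 0
  simp only [zero_mul] at h2
  have h3 := mul_nonneg ha h1
  have h4 := mul_nonneg (sub_nonneg.2 hab) h2
  change b * _ ≤ a * _ + (b - a) * G.logPartition fun _ => 0
  nlinarith

end RoutingNetwork

/-! ## Scalar inequalities for adaptive rates -/

theorem adaptive_step_le {M ρ ρ' a r d : ℝ} (hM : 0 < M) (hρ : 0 < ρ) (hρ' : ρ ≤ ρ')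
    (ha : ρ' ^ 2 = ρ ^ 2 + a ^ 2) (hr0 : 0 ≤ r) (hr : r ≤ 2 * M) (hd0 : 0 ≤ d) (hd : d ≤ 2 * M) :
    a * r - ρ * ((r ^ 2 + d ^ 2) / (4 * M)) ≤ 4 * M * (ρ' - ρ) - ρ' * (d ^ 2 / (4 * M)) := by
  have hρ0 : 0 < ρ' := hρ.trans_le hρ'
  have hsq : ∀ x, 0 ≤ x → x ≤ 2 * M → x ^ 2 / (4 * M) ≤ M := fun x h0 hx => by
    rw [div_le_iff₀ (by linarith)]; nlinarith
  have h1 := mul_le_mul_of_nonneg_left (hsq r hr0 hr) (sub_nonneg.2 hρ')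
  have h2 := mul_le_mul_of_nonneg_left (hsq d hd0 hd) (sub_nonneg.2 hρ')
  have h3 : a * r ≤ ρ' * (r ^ 2 / (4 * M)) + M * (a ^ 2 / ρ') := by
    have : ρ' * (r ^ 2 / (4 * M)) + M * (a ^ 2 / ρ') - a * r =
        (ρ' * r - 2 * M * a) ^ 2 / (4 * M * ρ') := by field_simp; ring
    have h4 : 0 ≤ (ρ' * r - 2 * M * a) ^ 2 / (4 * M * ρ') := by positivity
    linarith
  have h4 : a ^ 2 / ρ' ≤ 2 * (ρ' - ρ) := by
    rw [div_le_iff₀ hρ0]; nlinarith [sq_nonneg (ρ' - ρ)]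
  have h5 := mul_le_mul_of_nonneg_left h4 hM.le
  rw [add_div]
  nlinarith

theorem adaptive_sum_le {B C γ : ℝ} (hB : 0 < B) (hC : 1 ≤ C) (hγ : 0 ≤ γ) {ρ a d σ : ℕ → ℝ}
    (hρ0 : ρ 0 = 1) (hρ : ∀ t, 0 ≤ ρ t) (hρs : ∀ t, ρ (t + 1) ^ 2 = ρ t ^ 2 + a t ^ 2)
    (ha : ∀ t, a t ^ 2 ≤ 2 * γ ^ 2 * d t ^ 2 + 2 * σ t ^ 2) (T : ℕ) :
    C * ρ T - ∑ t ∈ Finset.range T, ρ (t + 1) * (d t ^ 2 / B) ≤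
      C * Real.sqrt C * (1 + γ ^ 2 * B / 2) +
        C * Real.sqrt (2 * ∑ t ∈ Finset.range T, σ t ^ 2) := by
  have hq : 1 ≤ Real.sqrt C := Real.one_le_sqrt.2 hC
  have hqs : Real.sqrt C ^ 2 = C := Real.sq_sqrt (by linarith)
  have key : ∃ D, 0 ≤ D ∧ ρ T ^ 2 ≤ C + 2 * γ ^ 2 * D + 2 * ∑ t ∈ Finset.range T, σ t ^ 2 ∧
      Real.sqrt C * (D / B) ≤ ∑ t ∈ Finset.range T, ρ (t + 1) * (d t ^ 2 / B) := by
    induction T with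
    | zero => exact ⟨0, le_rfl, by simp [hρ0, hC], by simp⟩
    | succ T ih =>
      obtain ⟨D, hD, h1, h2⟩ := ih
      simp only [Finset.sum_range_succ]
      have hd : 0 ≤ d T ^ 2 / B := by positivity
      rcases le_total (ρ (T + 1)) (Real.sqrt C) with h | h
      · refine ⟨D, hD, ?_, h2.trans (le_add_of_nonneg_right (mul_nonneg (hρ _) hd))⟩
        have h3 : ρ (T + 1) ^ 2 ≤ C := by
          rw [← hqs]; exact pow_le_pow_left₀ (hρ _) h 2
        have h4 : 0 ≤ ∑ t ∈ Finset.range T, σ t ^ 2 := Finset.sum_nonneg fun _ _ => sq_nonneg _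
        have h5 : 0 ≤ 2 * γ ^ 2 * D := by positivity
        nlinarith [sq_nonneg (σ T)]
      · refine ⟨D + d T ^ 2, by positivity, ?_, ?_⟩
        · rw [hρs]; linarith [ha T]
        · rw [add_div, mul_add]
          exact add_le_add h2 (mul_le_mul_of_nonneg_right h hd)
  obtain ⟨D, hD, h1, h2⟩ := key
  set S := ∑ t ∈ Finset.range T, σ t ^ 2 with hS
  have hS0 : 0 ≤ S := Finset.sum_nonneg fun _ _ => sq_nonneg _
  set q := Real.sqrt C with hqd
  set u := Real.sqrt (2 * D) with hu
  set v := Real.sqrt (2 * S) with hv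
  have hus : u ^ 2 = 2 * D := Real.sq_sqrt (by linarith)
  have hvs : v ^ 2 = 2 * S := Real.sq_sqrt (by linarith)
  have hu0 : 0 ≤ u := Real.sqrt_nonneg _
  have hv0 : 0 ≤ v := Real.sqrt_nonneg _
  have h3 : ρ T ≤ q + γ * u + v := by
    refine le_of_sq_le_sq ?_ (by positivity)
    have e1 : 0 ≤ q * (γ * u) := by positivity
    have e2 : 0 ≤ q * v := by positivity
    have e3 : 0 ≤ γ * u * v := by positivity
    have e4 : (γ * u) ^ 2 = 2 * γ ^ 2 * D := by rw [mul_pow, hus]; ring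
    nlinarith
  have h4 : q ^ 2 * (γ * u) ≤ q * (D / B) + q ^ 2 * q * (γ ^ 2 * B / 2) := by
    have : q * (D / B) + q ^ 2 * q * (γ ^ 2 * B / 2) - q ^ 2 * (γ * u) =
        q / (2 * B) * (u - q * γ * B) ^ 2 := by
      rw [show D = u ^ 2 / 2 by rw [hus]; ring]
      field_simp
      ring
    have h5 : 0 ≤ q / (2 * B) * (u - q * γ * B) ^ 2 := by positivity
    linarith
  have h5 := mul_le_mul_of_nonneg_left h3 (by linarith : (0 : ℝ) ≤ C)
  rw [← hqs] at h5 ⊢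
  nlinarith

namespace RoutingNetwork

variable {V E : Type} [Fintype V] [DecidableEq V] [Fintype E] [DecidableEq E] {N : ℕ}
  (G : RoutingNetwork V E N)

/-! ## Regret of the pivot flows -/

namespace PathState

variable {G} {S : Type*} (c : E → ℝ → S → ℝ) (t : ℕ) (s : G.PathState)

noncomputable def invRate : ℝ := Real.sqrt (1 + s.rateSum)

/-- The pivot flow of the test phase. -/
noncomputable def testPoint : ∀ i, G.Route i → ℝ := G.logit s.testScore

/-- The pivot flow of the recommendation phase. -/
noncomputable def point (x : S) : ∀ i, G.Route i → ℝ := G.logit (s.score c t x)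

noncomputable def energy : ℝ := s.invRate * (G.logPartition s.testScore - G.logPartition 0)

theorem isFlow_point (x : S) : G.IsFlow (s.point c t x) := G.isFlow_logit _

theorem isFlow_testPoint : G.IsFlow s.testPoint := G.isFlow_logit _

theorem rate_eq : s.rate = 1 / s.invRate := rfl

variable {s}

theorem one_le_invRate (hs : 0 ≤ s.rateSum) : 1 ≤ s.invRate :=
  Real.one_le_sqrt.2 (by linarith)

theorem rateSum_le_next (x x' : S) : s.rateSum ≤ (s.next c t x x').rateSum :=
  le_add_of_nonneg_right (sq_nonneg _)

theorem rateSum_next_nonneg (hs : 0 ≤ s.rateSum) (x x' : S) : 0 ≤ (s.next c t x x').rateSum :=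
  hs.trans (rateSum_le_next c t x x')

theorem invRate_next_sq (hs : 0 ≤ s.rateSum) (x x' : S) :
    (s.next c t x x').invRate ^ 2 = s.invRate ^ 2 +
      ((t + 1) * G.routeNorm fun e => s.cost c t x x' e - s.testCost c t x e) ^ 2 := by
  have := rateSum_next_nonneg c t hs x x'
  rw [invRate, invRate, Real.sq_sqrt (by linarith), Real.sq_sqrt (by linarith)]
  simp only [next]; ring

theorem invRate_le_next (x x' : S) : s.invRate ≤ (s.next c t x x').invRate :=
  Real.sqrt_le_sqrt (by linarith [rateSum_le_next c t x x' (s := s)])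

theorem regret_step (hN : 1 ≤ N) (hs : 0 ≤ s.rateSum) (x x' : S) :
    (t + 1) * G.pairing (s.cost c t x x') (s.point c t x) ≤
      s.energy - (s.next c t x x').energy +
        4 * G.totalDemand * ((s.next c t x x').invRate - s.invRate) -
        (s.next c t x x').invRate *
          (G.flowDist (s.point c t x) s.testPoint ^ 2 / (4 * G.totalDemand)) := by
  have hM := G.totalDemand_pos hN
  set s' := s.next c t x x' with hs'
  have h1 : 1 ≤ s.invRate := one_le_invRate hs
  have h2 : s.invRate ≤ s'.invRate := invRate_le_next c t x x'
  have h0 : 0 < s.invRate := by linarith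
  have h0' : 0 < s'.invRate := by linarith
  have hr : s.rate = 1 / s.invRate := rfl
  have hr' : s'.rate = 1 / s'.invRate := rfl
  have hr0 : 0 < s.rate := by rw [hr]; positivity
  have hr0' : 0 < s'.rate := by rw [hr']; positivity
  have hrr : s'.rate ≤ s.rate := by rw [hr, hr']; exact one_div_le_one_div_of_le h0 h2
  set a := (t + 1) * G.routeNorm fun e => s.cost c t x x' e - s.testCost c t x e with ha
  set θ' : E → ℝ := fun e => s.rate * s'.weight e with hθ'
  set r := G.flowDist (G.logit θ') (s.point c t x) with hrd
  set d := G.flowDist (s.point c t x) s.testPoint with hdd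
  have hw : ∀ e, s'.weight e = s.weight e - (t + 1) * s.cost c t x x' e := fun e => rfl
  have hsc := adaptive_step_le (a := a) (r := r) (d := d) hM h0 h2 (invRate_next_sq c t hs x x')
    (G.flowDist_nonneg _ _) (G.flowDist_le (G.isFlow_logit _) (s.isFlow_point c t x))
    (G.flowDist_nonneg _ _) (G.flowDist_le (s.isFlow_point c t x) s.isFlow_testPoint)
  have hb1 := G.flowDist_logit_sq_le θ' (s.score c t x)
  have hb2 := G.flowDist_logit_sq_le (s.score c t x) s.testScore
  change r ^ 2 ≤ _ at hb1
  change d ^ 2 ≤ _ at hb2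
  rw [← div_le_iff₀' (by linarith)] at hb1 hb2
  have hmono := G.logPartition_scale hN s'.weight hr0'.le hrr
  have hp1 := G.pairing_sub_le (fun e => s.cost c t x x' e - s.testCost c t x e)
    (s.point c t x) (G.logit θ')
  rw [G.flowDist_comm, ← hrd] at hp1
  have lin1 : ∀ f, G.pairing θ' f =
      s.rate * G.pairing s.weight f - s.rate * (t + 1) * G.pairing (s.cost c t x x') f := by
    intro f
    have := G.pairing_linear s.weight (s.cost c t x x') s.rate (-(s.rate * (t + 1))) f
    rw [show θ' = fun e => s.rate * s.weight e + -(s.rate * (t + 1)) * s.cost c t x x' e from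
      funext fun e => by rw [hθ']; dsimp only; rw [hw]; ring, this]
    ring
  have lin2 : ∀ f, G.pairing (s.score c t x) f =
      s.rate * G.pairing s.weight f - s.rate * (t + 1) * G.pairing (s.testCost c t x) f := by
    intro f
    have := G.pairing_linear s.weight (s.testCost c t x) s.rate (-(s.rate * (t + 1))) f
    rw [show s.score c t x = fun e =>
      s.rate * s.weight e + -(s.rate * (t + 1)) * s.testCost c t x e from
      funext fun e => by rw [score]; ring, this]
    ring
  have lin3 : ∀ f, G.pairing s.testScore f = s.rate * G.pairing s.weight f := by
    intro f
    have := G.pairing_linear s.weight s.weight s.rate 0 f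
    simp only [zero_mul, add_zero] at this
    exact this
  have lin4 : ∀ f, G.pairing (fun e => s.cost c t x x' e - s.testCost c t x e) f =
      G.pairing (s.cost c t x x') f - G.pairing (s.testCost c t x) f := by
    intro f
    have := G.pairing_linear (s.cost c t x x') (s.testCost c t x) 1 (-1) f
    simp only [one_mul, neg_mul, ← sub_eq_add_neg] at this
    exact this
  rw [lin4, lin4] at hp1
  rw [lin1, lin2] at hb1
  rw [lin2, lin3] at hb2
  change _ ≤ G.logPartition s.testScore - G.logPartition (s.score c t x) -
    (s.rate * G.pairing s.weight (s.point c t x) - (s.rate * G.pairing s.weight (s.point c t x)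
      - s.rate * (t + 1) * G.pairing (s.testCost c t x) (s.point c t x))) at hb2
  have hmain : s.rate * ((t + 1) * G.pairing (s.cost c t x x') (s.point c t x)) ≤
      G.logPartition s.testScore - G.logPartition θ' + s.rate * (a * r) -
        (r ^ 2 + d ^ 2) / (4 * G.totalDemand) := by
    have hp2 := mul_le_mul_of_nonneg_left hp1 (by positivity : 0 ≤ s.rate * (t + 1 : ℝ))
    rw [add_div, ha]
    linarith
  have hmain' := mul_le_mul_of_nonneg_left hmain h0.le
  have hir : s.invRate * s.rate = 1 := by rw [hr]; field_simp
  have hir' : s'.invRate * s'.rate = 1 := by rw [hr']; field_simp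
  have hen : s'.energy ≤ s.invRate * (G.logPartition θ' - G.logPartition 0) := by
    have := mul_le_mul_of_nonneg_left hmono (mul_pos h0 h0').le
    have e1 : s.invRate * s'.invRate * (s.rate * G.logPartition fun e => s'.rate * s'.weight e) =
        s'.invRate * G.logPartition s'.testScore := by
      rw [show s.invRate * s'.invRate * (s.rate * G.logPartition fun e => s'.rate * s'.weight e) =
        (s.invRate * s.rate) * (s'.invRate * G.logPartition fun e => s'.rate * s'.weight e) by ring,
        hir, one_mul]
      rfl
    have e2 : s.invRate * s'.invRate * (s'.rate * G.logPartition θ' +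
        (s.rate - s'.rate) * G.logPartition 0) = (s'.invRate * s'.rate) * s.invRate *
          G.logPartition θ' + ((s.invRate * s.rate) * s'.invRate -
            (s'.invRate * s'.rate) * s.invRate) * G.logPartition 0 := by ring
    rw [e1] at this
    rw [e2, hir, hir'] at this
    rw [energy]
    linarith
  have e3 : s.invRate * (s.rate * ((t + 1) * G.pairing (s.cost c t x x') (s.point c t x))) =
      (t + 1) * G.pairing (s.cost c t x x') (s.point c t x) := by rw [← mul_assoc, hir, one_mul]
  have e4 : s.invRate * (G.logPartition s.testScore - G.logPartition θ' + s.rate * (a * r) -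
        (r ^ 2 + d ^ 2) / (4 * G.totalDemand)) =
      s.energy - s.invRate * (G.logPartition θ' - G.logPartition 0) +
        (s.invRate * s.rate) * (a * r) -
        s.invRate * ((r ^ 2 + d ^ 2) / (4 * G.totalDemand)) := by rw [energy]; ring
  rw [e3, e4, hir] at hmain'
  linarith

end PathState

section Run

variable {S : Type*} (c : E → ℝ → S → ℝ) (ζ : ℕ × Bool → S)

/-- The pivot flow of the recommendation phase of epoch `t + 1`. -/
noncomputable def runPoint (t : ℕ) : ∀ i, G.Route i → ℝ :=
  (G.pathRun c ζ t).point c t (ζ (t + 1, false))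

/-- The flow of the test phase of epoch `t + 1`. -/
noncomputable def runTestFlow (t : ℕ) : ∀ i, G.Route i → ℝ :=
  (G.pathRun c ζ t).averageFlow t (G.pathRun c ζ t).testScore

noncomputable def runCost (t : ℕ) : E → ℝ :=
  (G.pathRun c ζ t).cost c t (ζ (t + 1, false)) (ζ (t + 1, true))

noncomputable def runTestCost (t : ℕ) : E → ℝ :=
  (G.pathRun c ζ t).testCost c t (ζ (t + 1, false))

/-- The distance of the pivot flows of the two phases of epoch `t + 1`. -/
noncomputable def runDist (t : ℕ) : ℝ :=
  G.flowDist (G.runPoint c ζ t) (G.pathRun c ζ t).testPoint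

theorem rateSum_pathRun_nonneg (t : ℕ) : 0 ≤ (G.pathRun c ζ t).rateSum := by
  induction t with
  | zero => exact le_rfl
  | succ t ih => exact PathState.rateSum_next_nonneg c t ih _ _

theorem invRate_pathRun_zero : (G.pathRun c ζ 0).invRate = 1 := by
  simp [pathRun, PathState.invRate]

theorem pairing_weight_pathRun (T : ℕ) (f : ∀ i, G.Route i → ℝ) :
    G.pairing (G.pathRun c ζ T).weight f =
      -∑ t ∈ Finset.range T, ((t : ℝ) + 1) * G.pairing (G.runCost c ζ t) f := by
  induction T with
  | zero => simp [pairing_eq_sum_load, pathRun]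
  | succ T ih =>
    have := G.pairing_linear (G.pathRun c ζ T).weight (G.runCost c ζ T) 1 (-(T + 1)) f
    simp only [one_mul, neg_mul, ← sub_eq_add_neg] at this
    rw [Finset.sum_range_succ, neg_add, ← ih, ← sub_eq_add_neg, ← this]
    rfl

theorem regret_le (hN : 1 ≤ N) (T : ℕ) {f : ∀ i, G.Route i → ℝ} (hf : G.IsFlow f) :
    ∑ t ∈ Finset.range T, ((t : ℝ) + 1) *
        (G.pairing (G.runCost c ζ t) (G.runPoint c ζ t) - G.pairing (G.runCost c ζ t) f) ≤
      (G.logPartition 0 + 4 * G.totalDemand) * (G.pathRun c ζ T).invRate -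
        ∑ t ∈ Finset.range T, (G.pathRun c ζ (t + 1)).invRate *
          (G.runDist c ζ t ^ 2 / (4 * G.totalDemand)) := by
  have hM := G.totalDemand_pos hN
  have h1 : ∑ t ∈ Finset.range T,
      ((t : ℝ) + 1) * G.pairing (G.runCost c ζ t) (G.runPoint c ζ t) ≤
      -(G.pathRun c ζ T).energy + 4 * G.totalDemand * ((G.pathRun c ζ T).invRate - 1) -
        ∑ t ∈ Finset.range T, (G.pathRun c ζ (t + 1)).invRate *
          (G.runDist c ζ t ^ 2 / (4 * G.totalDemand)) := by
    induction T with
    | zero =>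
      have : (G.pathRun c ζ 0).testScore = 0 := by ext e; simp [pathRun, PathState.testScore]
      simp [PathState.energy, this, invRate_pathRun_zero]
    | succ T ih =>
      rw [Finset.sum_range_succ, Finset.sum_range_succ]
      have := PathState.regret_step c T hN (G.rateSum_pathRun_nonneg c ζ T) (ζ (T + 1, false))
        (ζ (T + 1, true))
      change ((T : ℝ) + 1) * G.pairing (G.runCost c ζ T) (G.runPoint c ζ T) ≤
        (G.pathRun c ζ T).energy - (G.pathRun c ζ (T + 1)).energy + 4 * G.totalDemand *
          ((G.pathRun c ζ (T + 1)).invRate - (G.pathRun c ζ T).invRate) -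
          (G.pathRun c ζ (T + 1)).invRate * (G.runDist c ζ T ^ 2 / (4 * G.totalDemand)) at this
      linarith
  have h2 := G.pairing_le_logPartition (G.pathRun c ζ T).testScore hf
  have h3 := G.pairing_linear (G.pathRun c ζ T).weight (G.pathRun c ζ T).weight
    (G.pathRun c ζ T).rate 0 f
  simp only [zero_mul, add_zero] at h3
  change G.pairing (G.pathRun c ζ T).testScore f = _ at h3
  rw [h3] at h2
  have h4 := PathState.one_le_invRate (G.rateSum_pathRun_nonneg c ζ T)
  have h5 := mul_le_mul_of_nonneg_left h2 (by linarith : 0 ≤ (G.pathRun c ζ T).invRate)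
  rw [← mul_assoc, PathState.rate_eq, mul_one_div_cancel (by linarith), one_mul,
    pairing_weight_pathRun] at h5
  simp only [mul_sub, Finset.sum_sub_distrib]
  rw [PathState.energy] at h1
  linarith

end Run

theorem pairing_linear_right (u : E → ℝ) (f g : ∀ i, G.Route i → ℝ) (a b : ℝ) :
    G.pairing u (fun i p => a * f i p + b * g i p) = a * G.pairing u f + b * G.pairing u g := by
  simp only [pairing_eq_sum_load, load_linear, Finset.mul_sum, ← Finset.sum_add_distrib]
  exact Finset.sum_congr rfl fun e _ => by ring

theorem pairing_sub_left (u v : E → ℝ) (f : ∀ i, G.Route i → ℝ) :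
    G.pairing (fun e => u e - v e) f = G.pairing u f - G.pairing v f := by
  have := G.pairing_linear u v 1 (-1) f
  simp only [one_mul, neg_mul, ← sub_eq_add_neg] at this
  exact this

theorem abs_load_sub_le (f g : ∀ i, G.Route i → ℝ) (e : E) :
    |G.load f e - G.load g e| ≤ G.flowDist f g := by
  simp only [load, flowDist, ← Finset.sum_sub_distrib]
  refine (Finset.abs_sum_le_sum_abs _ _).trans (Finset.sum_le_sum fun i _ =>
    (Finset.abs_sum_le_sum_abs _ _).trans (Finset.sum_le_sum fun p _ => ?_))
  split_ifs
  · exact le_rfl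
  · simp

theorem routeNorm_add_le (u v : E → ℝ) :
    G.routeNorm (fun e => u e + v e) ≤ G.routeNorm u + G.routeNorm v := by
  refine G.routeNorm_le (add_nonneg (G.routeNorm_nonneg u) (G.routeNorm_nonneg v)) fun i p => ?_
  refine le_trans ?_ (add_le_add (G.le_routeNorm u i p) (G.le_routeNorm v i p))
  rw [← List.sum_map_add]
  exact List.sum_le_sum fun e _ => abs_add_le _ _

theorem routeNorm_neg (u : E → ℝ) : G.routeNorm (fun e => -u e) = G.routeNorm u := by
  simp [routeNorm]

theorem routeNorm_le_of_abs_le {K : ℕ} (hK : ∀ i (p : G.Route i), p.1.length ≤ K) {u : E → ℝ}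
    {b : ℝ} (hb : 0 ≤ b) (hu : ∀ e, |u e| ≤ b) : G.routeNorm u ≤ K * b := by
  refine G.routeNorm_le (by positivity) fun i p => ?_
  refine (List.sum_le_card_nsmul _ b ?_).trans ?_
  · simpa using fun e _ => hu e
  · rw [List.length_map, nsmul_eq_mul]
    exact mul_le_mul_of_nonneg_right (Nat.cast_le.2 (hK i p)) hb

/-- Cost functions with the properties of a cost model at all loads, jointly measurable. -/
structure _root_.IsRegularCost {E S : Type*} [MeasurableSpace S] (c : E → ℝ → S → ℝ) (L H : ℝ) :
    Prop where
  measurable : ∀ e, Measurable fun p : ℝ × S => c e p.1 p.2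
  monotone : ∀ e s, Monotone fun x => c e x s
  bounded : ∀ e x s, |c e x s| ≤ H
  lipschitz : ∀ e s x y, |c e x s - c e y s| ≤ L * |x - y|

section Mean

variable {S : Type*} [MeasurableSpace S] {μ : Measure S} [IsProbabilityMeasure μ]
  {c : E → ℝ → S → ℝ} {L H : ℝ}

theorem _root_.IsRegularCost.measurable_state {c : E → ℝ → S → ℝ} {L H : ℝ}
    (hc : IsRegularCost c L H) (e : E) (x : ℝ) : Measurable (c e x) :=
  (hc.measurable e).comp measurable_prodMk_left

theorem _root_.IsRegularCost.integrable (hc : IsRegularCost c L H) (e : E) (x : ℝ) :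
    Integrable (c e x) μ :=
  Integrable.of_bound (hc.measurable_state e x).aestronglyMeasurable H
    (Filter.Eventually.of_forall (hc.bounded e x))

theorem monotone_meanCost (hc : IsRegularCost c L H) (e : E) : Monotone (meanCost μ c e) :=
  fun x y h => integral_mono (hc.integrable e x) (hc.integrable e y) fun s => hc.monotone e s h

theorem abs_meanCost_sub_le (hc : IsRegularCost c L H) (e : E) (x y : ℝ) :
    |meanCost μ c e x - meanCost μ c e y| ≤ L * |x - y| := by
  rw [meanCost, meanCost, ← integral_sub (hc.integrable e x) (hc.integrable e y)]
  refine (abs_integral_le_integral_abs).trans ?_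
  refine (integral_mono ((hc.integrable e x).sub (hc.integrable e y)).abs (integrable_const _)
    fun s => hc.lipschitz e s x y).trans ?_
  simp

theorem abs_meanCost_le (hc : IsRegularCost c L H) (e : E) (x : ℝ) :
    |meanCost μ c e x| ≤ H := by
  rw [meanCost]
  refine (abs_integral_le_integral_abs).trans ?_
  refine (integral_mono (hc.integrable e x).abs (integrable_const _)
    fun s => hc.bounded e x s).trans ?_
  simp

theorem integral_sub_integral_le {φ : ℝ → ℝ} (hφ : Monotone φ) (a b : ℝ) :
    (∫ x in (0 : ℝ)..a, φ x) - ∫ x in (0 : ℝ)..b, φ x ≤ φ a * (a - b) := by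
  have hi : ∀ a b : ℝ, IntervalIntegrable φ volume a b := fun a b => hφ.intervalIntegrable
  rw [intervalIntegral.integral_interval_sub_left (hi _ _) (hi _ _)]
  rcases le_total b a with h | h
  · refine (intervalIntegral.integral_mono_on h (hi _ _) intervalIntegrable_const
      fun x hx => hφ hx.2).trans ?_
    rw [intervalIntegral.integral_const, smul_eq_mul, mul_comm]
  · rw [intervalIntegral.integral_symm]
    have := intervalIntegral.integral_mono_on h (intervalIntegrable_const (c := φ a)) (hi _ _)
      fun x hx => hφ hx.1
    rw [intervalIntegral.integral_const, smul_eq_mul] at this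
    linarith

theorem potential_sub_le (hc : IsRegularCost c L H) (f g : ∀ i, G.Route i → ℝ) :
    G.potential μ c f - G.potential μ c g ≤
      G.pairing (fun e => meanCost μ c e (G.load f e)) f -
        G.pairing (fun e => meanCost μ c e (G.load f e)) g := by
  simp only [potential, pairing_eq_sum_load, ← Finset.sum_sub_distrib]
  refine Finset.sum_le_sum fun e _ => ?_
  rw [← mul_sub]
  exact integral_sub_integral_le (monotone_meanCost hc e) _ _

end Mean

section Run

variable {S : Type*} [MeasurableSpace S] (μ : Measure S) (c : E → ℝ → S → ℝ) (ζ : ℕ × Bool → S)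

noncomputable def runMean (t : ℕ) (e : E) : ℝ := meanCost μ c e (G.load (G.runFlow c ζ t) e)

noncomputable def runTestMean (t : ℕ) (e : E) : ℝ :=
  meanCost μ c e (G.load (G.runTestFlow c ζ t) e)

/-- The noise of the costs observed in the recommendation phase of epoch `t + 1`. -/
noncomputable def runNoise (t : ℕ) (e : E) : ℝ := G.runCost c ζ t e - G.runMean μ c ζ t e

/-- The noise of the costs observed in the test phase of epoch `t + 1`. -/
noncomputable def runTestNoise (t : ℕ) (e : E) : ℝ :=
  G.runTestCost c ζ t e - G.runTestMean μ c ζ t e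

variable {μ} {c} [IsProbabilityMeasure μ] {L H : ℝ}

theorem stepTotal_succ (t : ℕ) : stepTotal (t + 1) = stepTotal t + ((t + 1 : ℕ) + 1) := by
  simp only [stepTotal]; push_cast; ring

theorem anchor_pathRun_succ (t : ℕ) (i : Fin N) (p : G.Route i) :
    (G.pathRun c ζ (t + 1)).anchor i p = stepTotal t * G.runFlow c ζ t i p := by
  have := (stepTotal_pos t).ne'
  simp only [pathRun, PathState.next, runFlow, PathState.flow, PathState.averageFlow]
  field_simp
  ring

theorem stepTotal_mul_pairing_runFlow_succ (t : ℕ) (u : E → ℝ) :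
    stepTotal (t + 1) * G.pairing u (G.runFlow c ζ (t + 1)) =
      ((t + 1 : ℕ) + 1) * G.pairing u (G.runPoint c ζ (t + 1)) +
        stepTotal t * G.pairing u (G.runFlow c ζ t) := by
  have h := (stepTotal_pos (t + 1)).ne'
  have : G.runFlow c ζ (t + 1) = fun i p =>
      (((t + 1 : ℕ) + 1) / stepTotal (t + 1)) * G.runPoint c ζ (t + 1) i p +
        (stepTotal t / stepTotal (t + 1)) * G.runFlow c ζ t i p := by
    funext i p
    have h1 : G.runFlow c ζ (t + 1) i p =
      (((t + 1 : ℕ) + 1) / stepTotal (t + 1)) * G.runPoint c ζ (t + 1) i p +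
        1 / stepTotal (t + 1) * (G.pathRun c ζ (t + 1)).anchor i p := rfl
    rw [h1, anchor_pathRun_succ]
    ring
  rw [this, pairing_linear_right]
  field_simp

theorem gap_le_regret (hc : IsRegularCost c L H) (T : ℕ) (f : ∀ i, G.Route i → ℝ) :
    stepTotal T * (G.potential μ c (G.runFlow c ζ T) - G.potential μ c f) ≤
      ∑ t ∈ Finset.range (T + 1), ((t : ℝ) + 1) *
        (G.pairing (G.runMean μ c ζ t) (G.runPoint c ζ t) - G.pairing (G.runMean μ c ζ t) f) := by
  induction T with
  | zero =>
    have h : G.runFlow c ζ 0 = G.runPoint c ζ 0 := by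
      funext i p
      simp only [runFlow, PathState.flow, PathState.averageFlow, pathRun, runPoint,
        PathState.point, stepTotal]
      norm_num
    have := G.potential_sub_le (μ := μ) hc (G.runFlow c ζ 0) f
    simp only [zero_add, Finset.sum_range_one, Nat.cast_zero, one_mul]
    rw [show stepTotal 0 = 1 by norm_num [stepTotal], one_mul]
    refine this.trans (le_of_eq ?_)
    rw [← h]
    rfl
  | succ T ih =>
    rw [Finset.sum_range_succ]
    have h1 := G.potential_sub_le (μ := μ) hc (G.runFlow c ζ (T + 1)) f
    have h2 := G.potential_sub_le (μ := μ) hc (G.runFlow c ζ (T + 1)) (G.runFlow c ζ T)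
    change _ ≤ G.pairing (G.runMean μ c ζ (T + 1)) _ - G.pairing (G.runMean μ c ζ (T + 1)) _ at h1
    change _ ≤ G.pairing (G.runMean μ c ζ (T + 1)) _ - G.pairing (G.runMean μ c ζ (T + 1)) _ at h2
    have h3 := G.stepTotal_mul_pairing_runFlow_succ (c := c) ζ T (G.runMean μ c ζ (T + 1))
    have h4 := mul_le_mul_of_nonneg_left h1 (by positivity : (0 : ℝ) ≤ ((T + 1 : ℕ) + 1))
    have h5 := mul_le_mul_of_nonneg_left h2 (stepTotal_pos T).le
    rw [stepTotal_succ] at h3 ⊢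
    linarith

theorem runTest_variation_le (hL : 0 ≤ L) {K : ℕ} (hK : ∀ i (p : G.Route i), p.1.length ≤ K)
    (hc : IsRegularCost c L H) (t : ℕ) :
    (t + 1) * G.routeNorm (fun e => G.runCost c ζ t e - G.runTestCost c ζ t e) ≤
      2 * K * L * G.runDist c ζ t + (t + 1) *
        G.routeNorm fun e => G.runNoise μ c ζ t e - G.runTestNoise μ c ζ t e := by
  have hA := stepTotal_pos t
  have hd : 0 ≤ G.runDist c ζ t := G.flowDist_nonneg _ _
  have hload : ∀ e, G.load (G.runFlow c ζ t) e - G.load (G.runTestFlow c ζ t) e =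
      (t + 1) / stepTotal t * (G.load (G.runPoint c ζ t) e -
        G.load (G.pathRun c ζ t).testPoint e) := fun e => by
    have h1 := G.load_linear (G.runPoint c ζ t) (G.pathRun c ζ t).anchor ((t + 1) / stepTotal t)
      (1 / stepTotal t) e
    have h2 := G.load_linear (G.pathRun c ζ t).testPoint (G.pathRun c ζ t).anchor
      ((t + 1) / stepTotal t) (1 / stepTotal t) e
    change G.load (G.runFlow c ζ t) e = _ at h1
    change G.load (G.runTestFlow c ζ t) e = _ at h2
    rw [h1, h2]
    ring
  have h1 : G.routeNorm (fun e => G.runMean μ c ζ t e - G.runTestMean μ c ζ t e) ≤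
      K * (L * ((t + 1) / stepTotal t * G.runDist c ζ t)) := by
    refine G.routeNorm_le_of_abs_le hK (by positivity) fun e =>
      (abs_meanCost_sub_le hc e _ _).trans (mul_le_mul_of_nonneg_left ?_ hL)
    rw [hload, abs_mul, abs_of_nonneg (by positivity : 0 ≤ ((t : ℝ) + 1) / stepTotal t)]
    exact mul_le_mul_of_nonneg_left (G.abs_load_sub_le _ _ e) (by positivity)
  have h2 := G.routeNorm_add_le (fun e => G.runMean μ c ζ t e - G.runTestMean μ c ζ t e)
    fun e => G.runNoise μ c ζ t e - G.runTestNoise μ c ζ t e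
  have h3 : (fun e => G.runMean μ c ζ t e - G.runTestMean μ c ζ t e +
      (G.runNoise μ c ζ t e - G.runTestNoise μ c ζ t e)) =
      fun e => G.runCost c ζ t e - G.runTestCost c ζ t e := by
    funext e; rw [runNoise, runTestNoise]; ring
  rw [h3] at h2
  have h4 : ((t : ℝ) + 1) * ((t + 1) / stepTotal t) ≤ 2 := by
    rw [← mul_div_assoc, div_le_iff₀ hA, stepTotal]
    nlinarith
  have h5 := mul_le_mul_of_nonneg_left (h2.trans (add_le_add_left h1 _))
    (by positivity : (0 : ℝ) ≤ t + 1)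
  have h6 := mul_le_mul_of_nonneg_right h4 (by positivity : 0 ≤ K * L * G.runDist c ζ t)
  nlinarith

/-- The constant in front of the adaptive rates. -/
noncomputable def rateConst : ℝ := G.logPartition 0 + 4 * G.totalDemand + 1

theorem one_le_rateConst : 1 ≤ G.rateConst := by
  have := G.logPartition_zero_nonneg
  have := G.totalDemand_nonneg
  rw [rateConst]; linarith

theorem pathwise_gap_le (hN : 1 ≤ N) (hL : 0 ≤ L) {K : ℕ}
    (hK : ∀ i (p : G.Route i), p.1.length ≤ K) (hc : IsRegularCost c L H) (T : ℕ)
    {f : ∀ i, G.Route i → ℝ} (hf : G.IsFlow f) :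
    stepTotal T * (G.potential μ c (G.runFlow c ζ T) - G.potential μ c f) ≤
      G.rateConst * Real.sqrt G.rateConst * (1 + 8 * K ^ 2 * L ^ 2 * G.totalDemand) +
      G.rateConst * Real.sqrt (2 * ∑ t ∈ Finset.range (T + 1), (((t : ℝ) + 1) *
        G.routeNorm fun e => G.runNoise μ c ζ t e - G.runTestNoise μ c ζ t e) ^ 2) -
      ∑ t ∈ Finset.range (T + 1), ((t : ℝ) + 1) *
        (G.pairing (G.runNoise μ c ζ t) (G.runPoint c ζ t) - G.pairing (G.runNoise μ c ζ t) f) := by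
  have hM := G.totalDemand_pos hN
  have h1 := G.gap_le_regret (μ := μ) ζ hc T f
  have h2 := G.regret_le c ζ hN (T + 1) hf
  have h3 := adaptive_sum_le (B := 4 * G.totalDemand) (C := G.rateConst) (γ := 2 * K * L)
    (ρ := fun t => (G.pathRun c ζ t).invRate) (d := fun t => G.runDist c ζ t)
    (a := fun t => (t + 1) * G.routeNorm (fun e => G.runCost c ζ t e - G.runTestCost c ζ t e))
    (σ := fun t => (t + 1) *
        G.routeNorm fun e => G.runNoise μ c ζ t e - G.runTestNoise μ c ζ t e)
    (by linarith) G.one_le_rateConst (by positivity) (G.invRate_pathRun_zero c ζ)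
    (fun t => Real.sqrt_nonneg _)
    (fun t => PathState.invRate_next_sq c t (G.rateSum_pathRun_nonneg c ζ t) _ _) (fun t => by
      have h := G.runTest_variation_le (μ := μ) ζ hL hK hc t
      have h0 : 0 ≤ (t + 1) *
        G.routeNorm (fun e => G.runCost c ζ t e - G.runTestCost c ζ t e) :=
        mul_nonneg (by positivity) (G.routeNorm_nonneg _)
      have h' := pow_le_pow_left₀ h0 h 2
      nlinarith [sq_nonneg (2 * K * L * G.runDist c ζ t - (t + 1) *
        G.routeNorm fun e => G.runNoise μ c ζ t e - G.runTestNoise μ c ζ t e)]) (T + 1)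
  have h4 : ∀ t f, G.pairing (G.runNoise μ c ζ t) f =
      G.pairing (G.runCost c ζ t) f - G.pairing (G.runMean μ c ζ t) f :=
    fun t f => G.pairing_sub_left _ _ f
  have h5 : ∑ t ∈ Finset.range (T + 1), ((t : ℝ) + 1) *
        (G.pairing (G.runNoise μ c ζ t) (G.runPoint c ζ t) - G.pairing (G.runNoise μ c ζ t) f) =
      ∑ t ∈ Finset.range (T + 1), ((t : ℝ) + 1) *
        (G.pairing (G.runCost c ζ t) (G.runPoint c ζ t) - G.pairing (G.runCost c ζ t) f) -
      ∑ t ∈ Finset.range (T + 1), ((t : ℝ) + 1) *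
        (G.pairing (G.runMean μ c ζ t) (G.runPoint c ζ t) - G.pairing (G.runMean μ c ζ t) f) := by
    rw [← Finset.sum_sub_distrib]
    exact Finset.sum_congr rfl fun t _ => by rw [h4, h4]; ring
  have h6 : (2 * K * L) ^ 2 * (4 * G.totalDemand) / 2 = 8 * K ^ 2 * L ^ 2 * G.totalDemand := by
    ring
  rw [h6] at h3
  have h7 := Real.sqrt_nonneg (1 + (G.pathRun c ζ (T + 1)).rateSum)
  change 0 ≤ (G.pathRun c ζ (T + 1)).invRate at h7
  have h8 : (G.logPartition 0 + 4 * G.totalDemand) * (G.pathRun c ζ (T + 1)).invRate ≤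
      G.rateConst * (G.pathRun c ζ (T + 1)).invRate :=
    mul_le_mul_of_nonneg_right (by rw [rateConst]; linarith) h7
  rw [h5]
  linarith

end Run

end RoutingNetwork

/-! ## Integration over a fresh independent coordinate -/

theorem integral_fresh_le {ι S Ω : Type*} [DecidableEq ι] [MeasurableSpace S] [MeasurableSpace Ω]
    {μ : Measure S}
    [IsProbabilityMeasure μ] {P : Measure Ω} [IsProbabilityMeasure P] {ζ : ι → Ω → S}
    (hm : ∀ k, Measurable (ζ k)) (hlaw : ∀ k, P.map (ζ k) = μ) (hind : iIndepFun ζ P)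
    {J : Finset ι} {k : ι} (hk : k ∉ J) {f : (ι → S) → S → ℝ}
    (hf : Measurable fun p : (ι → S) × S => f p.1 p.2) {b : ℝ} (hb : ∀ x s, |f x s| ≤ b)
    (hdep : ∀ x x' : ι → S, (∀ j ∈ J, x j = x' j) → f x = f x') {B : ℝ}
    (hB : ∀ x, ∫ s, f x s ∂μ ≤ B) :
    ∫ ω, f (fun j => ζ j ω) (ζ k ω) ∂P ≤ B := by
  obtain ⟨ω₀⟩ : Nonempty Ω := nonempty_of_isProbabilityMeasure P
  let ext : (J → S) → ι → S := fun y j => if h : j ∈ J then y ⟨j, h⟩ else ζ k ω₀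
  have hext : Measurable ext := measurable_pi_iff.2 fun j => by
    by_cases h : j ∈ J
    · simp only [ext, h, dif_pos]; exact measurable_pi_apply _
    · simp only [ext, h, dif_neg, not_false_eq_true]; exact measurable_const
  let X : Ω → J → S := fun ω j => ζ j ω
  have hX : Measurable X := measurable_pi_iff.2 fun j => hm j
  have hi : IndepFun X (ζ k) P := by
    have := hind.indepFun_finset J {k} (Finset.disjoint_singleton_right.2 hk) hm
    exact this.comp (φ := id) (ψ := fun y : ({k} : Finset ι) → S => y ⟨k, by simp⟩) measurable_id
      (measurable_pi_apply _)
  let g : (J → S) × S → ℝ := fun p => f (ext p.1) p.2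
  have hg : Measurable g :=
    hf.comp ((hext.comp measurable_fst).prodMk measurable_snd)
  have h1 : (fun ω => f (fun j => ζ j ω) (ζ k ω)) = fun ω => g (X ω, ζ k ω) := by
    funext ω
    refine congrFun (hdep _ _ fun j hj => ?_) _
    simp [ext, hj, X]
  have hmap := (indepFun_iff_map_prod_eq_prod_map_map hX.aemeasurable (hm k).aemeasurable).1 hi
  rw [hlaw k] at hmap
  have : IsProbabilityMeasure (P.map X) := Measure.isProbabilityMeasure_map hX.aemeasurable
  rw [h1, ← integral_map (φ := fun ω => (X ω, ζ k ω)) (hX.prodMk (hm k)).aemeasurable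
    hg.aestronglyMeasurable, hmap]
  have hgi : Integrable g ((P.map X).prod μ) :=
    Integrable.of_bound hg.aestronglyMeasurable b (Filter.Eventually.of_forall fun p => hb _ _)
  rw [integral_prod _ hgi]
  refine (integral_mono hgi.integral_prod_left (integrable_const B) fun y => hB (ext y)).trans ?_
  simp

namespace RoutingNetwork

variable {V E : Type} [Fintype V] [DecidableEq V] [Fintype E] [DecidableEq E] {N : ℕ}
  (G : RoutingNetwork V E N)

/-! ## Measurability of the algorithm -/

section Measurability

variable {X S : Type*} [MeasurableSpace X] [MeasurableSpace S]

theorem measurable_list_sum {θ : X → E → ℝ} (h : ∀ e, Measurable fun x => θ x e) (p : List E) :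
    Measurable fun x => (p.map (θ x)).sum := by
  induction p with
  | nil => simp
  | cons e p ih =>
    simp only [List.map_cons, List.sum_cons]
    exact (h e).add ih

theorem measurable_logit {θ : X → E → ℝ} (h : ∀ e, Measurable fun x => θ x e) (i : Fin N)
    (p : G.Route i) : Measurable fun x => G.logit (θ x) i p :=
  ((Real.measurable_exp.comp (measurable_list_sum h _)).div (Finset.measurable_sum _ fun p _ =>
    Real.measurable_exp.comp (measurable_list_sum h p.1))).const_mul _

theorem measurable_load {f : X → ∀ i, G.Route i → ℝ} (h : ∀ i p, Measurable fun x => f x i p)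
    (e : E) : Measurable fun x => G.load (f x) e :=
  Finset.measurable_sum _ fun i _ => Finset.measurable_sum _ fun p _ => by
    split_ifs
    · exact h i p
    · exact measurable_const

theorem measurable_routeNorm {u : X → E → ℝ} (h : ∀ e, Measurable fun x => u x e) :
    Measurable fun x => G.routeNorm (u x) :=
  Measurable.iSup fun r => measurable_list_sum
    (fun e => continuous_abs.measurable.comp (h e)) r.2.1

theorem measurable_pairing {u : X → E → ℝ} (h : ∀ e, Measurable fun x => u x e)
    {f : X → ∀ i, G.Route i → ℝ} (hf : ∀ i p, Measurable fun x => f x i p) :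
    Measurable fun x => G.pairing (u x) (f x) :=
  Finset.measurable_sum _ fun i _ => Finset.measurable_sum _ fun p _ =>
    (hf i p).mul (measurable_list_sum h p.1)

/-- A random state of the algorithm, measurable in every component. -/
structure MeasurableState (s : X → G.PathState) : Prop where
  weight : ∀ e, Measurable fun x => (s x).weight e
  anchor : ∀ i p, Measurable fun x => (s x).anchor i p
  rateSum : Measurable fun x => (s x).rateSum

namespace MeasurableState

variable {G} {s : X → G.PathState} (hs : G.MeasurableState s) {c : E → ℝ → S → ℝ} {L H : ℝ}
  (hc : IsRegularCost c L H) (t : ℕ) {ξ ξ' : X → S} (hξ : Measurable ξ) (hξ' : Measurable ξ')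

include hs

theorem rate : Measurable fun x => (s x).rate :=
  measurable_const.div (Real.continuous_sqrt.measurable.comp (hs.rateSum.const_add 1))

theorem averageFlow {θ : X → E → ℝ} (h : ∀ e, Measurable fun x => θ x e) (i : Fin N)
    (p : G.Route i) : Measurable fun x => (s x).averageFlow t (θ x) i p :=
  ((G.measurable_logit h i p).const_mul _).add ((hs.anchor i p).const_mul _)

theorem testScore (e : E) : Measurable fun x => (s x).testScore e := hs.rate.mul (hs.weight e)

theorem testFlow (i : Fin N) (p : G.Route i) :
    Measurable fun x => (s x).averageFlow t (s x).testScore i p := hs.averageFlow t hs.testScore i p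

include hc hξ

theorem testCost (e : E) : Measurable fun x => (s x).testCost c t (ξ x) e :=
  (hc.measurable e).comp ((G.measurable_load (hs.testFlow t) e).prodMk hξ)

theorem score (e : E) : Measurable fun x => (s x).score c t (ξ x) e :=
  hs.rate.mul ((hs.weight e).sub ((hs.testCost hc t hξ e).const_mul _))

theorem point (i : Fin N) (p : G.Route i) : Measurable fun x => (s x).point c t (ξ x) i p :=
  G.measurable_logit (hs.score hc t hξ) i p

theorem flow (i : Fin N) (p : G.Route i) : Measurable fun x => (s x).flow c t (ξ x) i p :=
  hs.averageFlow t (hs.score hc t hξ) i p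

include hξ'

theorem cost (e : E) : Measurable fun x => (s x).cost c t (ξ x) (ξ' x) e :=
  (hc.measurable e).comp ((G.measurable_load (hs.flow hc t hξ) e).prodMk hξ')

theorem next : G.MeasurableState fun x => (s x).next c t (ξ x) (ξ' x) where
  weight e := (hs.weight e).sub ((hs.cost hc t hξ hξ' e).const_mul _)
  anchor i p := (hs.anchor i p).add ((hs.point hc t hξ i p).const_mul _)
  rateSum := hs.rateSum.add (((G.measurable_routeNorm fun e =>
    (hs.cost hc t hξ hξ' e).sub (hs.testCost hc t hξ e)).const_mul _).pow_const 2)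

end MeasurableState

theorem measurableState_pathRun {c : E → ℝ → S → ℝ} {L H : ℝ} (hc : IsRegularCost c L H) (t : ℕ) :
    G.MeasurableState fun ζ : ℕ × Bool → S => G.pathRun c ζ t := by
  induction t with
  | zero => exact ⟨fun _ => measurable_const, fun _ _ => measurable_const, measurable_const⟩
  | succ t ih => exact ih.next hc t (measurable_pi_apply _) (measurable_pi_apply _)

end Measurability

theorem pathRun_congr {S : Type*} (c : E → ℝ → S → ℝ) {ζ ζ' : ℕ × Bool → S} {t : ℕ}
    (h : ∀ k : ℕ × Bool, k.1 ≤ t → ζ k = ζ' k) : G.pathRun c ζ t = G.pathRun c ζ' t := by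
  induction t with
  | zero => rfl
  | succ t ih =>
    rw [pathRun, pathRun, ih fun k hk => h k (hk.trans t.le_succ), h _ le_rfl, h _ le_rfl]

/-! ## Feasibility of the averaged flows -/

section Feasible

variable {S : Type*} (c : E → ℝ → S → ℝ) (ζ : ℕ × Bool → S)

theorem anchor_pathRun_nonneg (t : ℕ) (i : Fin N) (p : G.Route i) :
    0 ≤ (G.pathRun c ζ t).anchor i p := by
  induction t with
  | zero => exact le_rfl
  | succ t ih =>
    exact add_nonneg ih (mul_nonneg (by positivity) (G.logit_pos _ i p).le)

theorem sum_anchor_pathRun (t : ℕ) (i : Fin N) :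
    ∑ p, (G.pathRun c ζ t).anchor i p = t * (t + 1) / 2 * G.demand i := by
  induction t with
  | zero => simp [pathRun]
  | succ t ih =>
    simp only [pathRun, PathState.next]
    rw [Finset.sum_add_distrib, ih, ← Finset.mul_sum, (G.isFlow_logit _ i).2]
    push_cast
    ring

theorem isFlow_averageFlow (t : ℕ) (θ : E → ℝ) :
    G.IsFlow ((G.pathRun c ζ t).averageFlow t θ) := by
  have hA := stepTotal_pos t
  refine fun i => ⟨fun p => ?_, ?_⟩
  · have h1 := (G.logit_pos θ i p).le
    have h2 := G.anchor_pathRun_nonneg c ζ t i p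
    rw [PathState.averageFlow]
    positivity
  · simp only [PathState.averageFlow]
    rw [Finset.sum_add_distrib, ← Finset.mul_sum, ← Finset.mul_sum, (G.isFlow_logit _ i).2,
      sum_anchor_pathRun]
    field_simp
    rw [stepTotal]
    ring

theorem isFlow_runFlow (t : ℕ) : G.IsFlow (G.runFlow c ζ t) := G.isFlow_averageFlow c ζ t _

theorem isFlow_runTestFlow (t : ℕ) : G.IsFlow (G.runTestFlow c ζ t) :=
  G.isFlow_averageFlow c ζ t _

variable {G} in
theorem IsFlow.load_mem {f : ∀ i, G.Route i → ℝ} (hf : G.IsFlow f) (e : E) :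
    G.load f e ∈ Set.Icc 0 G.totalDemand := by
  refine ⟨Finset.sum_nonneg fun i _ => Finset.sum_nonneg fun p _ => ?_, ?_⟩
  · split_ifs
    · exact (hf i).1 p
    · exact le_rfl
  · rw [← hf.sum_eq]
    refine Finset.sum_le_sum fun i _ => Finset.sum_le_sum fun p _ => ?_
    split_ifs
    · exact le_rfl
    · exact (hf i).1 p

end Feasible

/-! ## Expectation of the gap -/

section Expectation

variable {S : Type*} [MeasurableSpace S] {μ : Measure S} [IsProbabilityMeasure μ]
  {c : E → ℝ → S → ℝ} {L H : ℝ}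

/-- Deviation of the costs from their means under the path flow `f`. -/
noncomputable def deviation (μ : Measure S) (c : E → ℝ → S → ℝ) (f : ∀ i, G.Route i → ℝ) (s : S)
    (e : E) : ℝ := c e (G.load f e) s - meanCost μ c e (G.load f e)

theorem abs_deviation_le (hc : IsRegularCost c L H) (f : ∀ i, G.Route i → ℝ) (s : S) (e : E) :
    |G.deviation μ c f s e| ≤ 2 * |H| := by
  have h1 := (hc.bounded e (G.load f e) s).trans (le_abs_self H)
  have h2 := (abs_meanCost_le (μ := μ) hc e (G.load f e)).trans (le_abs_self H)
  rw [two_mul]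
  exact (abs_sub _ _).trans (add_le_add h1 h2)

theorem routeNorm_deviation_le (hc : IsRegularCost c L H) (f : ∀ i, G.Route i → ℝ) (s : S) :
    G.routeNorm (G.deviation μ c f s) ≤ Fintype.card V * (2 * |H|) :=
  G.routeNorm_le_of_abs_le (fun i p => G.walk_length_le i p.2) (by positivity)
    (G.abs_deviation_le hc f s)

theorem integral_routeNorm_deviation_le (hc : IsRegularCost c L H) {f : ∀ i, G.Route i → ℝ}
    (hf : G.IsFlow f) :
    ∫ s, G.routeNorm (G.deviation μ c f s) ^ 2 ∂μ ≤ G.noiseLevel μ c ^ 2 := by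
  have hbdd : BddAbove (Set.range fun f : {f : ∀ i, G.Route i → ℝ // G.IsFlow f} =>
      ∫ s, G.routeNorm (G.deviation μ c f.1 s) ^ 2 ∂μ) := by
    refine ⟨(Fintype.card V * (2 * |H|)) ^ 2, ?_⟩
    rintro _ ⟨f, rfl⟩
    refine (integral_mono_of_nonneg (Filter.Eventually.of_forall fun s => sq_nonneg _)
      (integrable_const ((Fintype.card V * (2 * |H|)) ^ 2)) (Filter.Eventually.of_forall fun s =>
        pow_le_pow_left₀ (G.routeNorm_nonneg _) (G.routeNorm_deviation_le hc f.1 s) 2)).trans ?_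
    simp
  rw [noiseLevel, Real.sq_sqrt]
  · exact le_ciSup hbdd ⟨f, hf⟩
  · exact Real.iSup_nonneg fun f => integral_nonneg fun s => sq_nonneg _

theorem integral_pairing_deviation (hc : IsRegularCost c L H) (f g : ∀ i, G.Route i → ℝ) :
    ∫ s, G.pairing (G.deviation μ c f s) g ∂μ = 0 := by
  simp only [pairing_eq_sum_load]
  have hi : ∀ e, Integrable (fun s => G.deviation μ c f s e) μ := fun e =>
    (hc.integrable e _).sub (integrable_const _)
  rw [integral_finsetSum _ fun e _ => (hi e).mul_const _]
  refine Finset.sum_eq_zero fun e _ => ?_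
  rw [integral_mul_const]
  have : ∫ s, G.deviation μ c f s e ∂μ = 0 := by
    simp only [deviation]
    rw [integral_sub (hc.integrable e _) (integrable_const _), integral_const]
    simp [meanCost]
  rw [this, zero_mul]

theorem abs_pairing_le {f : ∀ i, G.Route i → ℝ} (hf : G.IsFlow f) (u : E → ℝ) :
    |G.pairing u f| ≤ G.routeNorm u * G.totalDemand := by
  rw [← hf.sum_eq, pairing, Finset.mul_sum]
  refine (Finset.abs_sum_le_sum_abs _ _).trans (Finset.sum_le_sum fun i _ => ?_)
  rw [Finset.mul_sum]
  refine (Finset.abs_sum_le_sum_abs _ _).trans (Finset.sum_le_sum fun p _ => ?_)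
  rw [abs_mul, abs_of_nonneg ((hf i).1 p), mul_comm]
  exact mul_le_mul_of_nonneg_right ((abs_list_sum_le u p.1).trans (G.le_routeNorm u i p))
    ((hf i).1 p)

theorem continuous_meanCost (hc : IsRegularCost c L H) (e : E) : Continuous (meanCost μ c e) := by
  have h : LipschitzWith L.toNNReal (meanCost μ c e) := LipschitzWith.of_dist_le_mul fun x y => by
    rw [Real.dist_eq, Real.dist_eq]
    exact (abs_meanCost_sub_le hc e x y).trans
      (mul_le_mul_of_nonneg_right (Real.le_coe_toNNReal L) (abs_nonneg _))
  exact h.continuous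

theorem measurable_deviation {X : Type*} [MeasurableSpace X] (hc : IsRegularCost c L H)
    {f : X → ∀ i, G.Route i → ℝ} (hf : ∀ i p, Measurable fun x => f x i p) {ξ : X → S}
    (hξ : Measurable ξ) (e : E) : Measurable fun x => G.deviation μ c (f x) (ξ x) e :=
  ((hc.measurable e).comp ((G.measurable_load hf e).prodMk hξ)).sub
    ((continuous_meanCost hc e).measurable.comp (G.measurable_load hf e))

theorem measurable_potential {X : Type*} [MeasurableSpace X] (hc : IsRegularCost c L H)
    {f : X → ∀ i, G.Route i → ℝ} (hf : ∀ i p, Measurable fun x => f x i p) :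
    Measurable fun x => G.potential μ c (f x) :=
  Finset.measurable_sum _ fun e _ => (intervalIntegral.continuous_primitive
    (fun a b => (continuous_meanCost hc e).intervalIntegrable a b) 0).measurable.comp
      (G.measurable_load hf e)

theorem abs_potential_le (hc : IsRegularCost c L H) {f : ∀ i, G.Route i → ℝ} (hf : G.IsFlow f) :
    |G.potential μ c f| ≤ Fintype.card E * (|H| * G.totalDemand) := by
  refine (Finset.abs_sum_le_sum_abs _ _).trans ?_
  refine (Finset.sum_le_card_nsmul _ _ (|H| * G.totalDemand) fun e _ => ?_).trans_eq
    (by rw [Finset.card_univ, nsmul_eq_mul])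
  have h := hf.load_mem e
  have := intervalIntegral.norm_integral_le_of_norm_le_const (a := 0) (b := G.load f e)
    (f := meanCost μ c e) (C := |H|) fun x _ =>
      (abs_meanCost_le hc e x).trans (le_abs_self H)
  rw [Real.norm_eq_abs] at this
  refine this.trans (mul_le_mul_of_nonneg_left ?_ (abs_nonneg _))
  rw [sub_zero, abs_of_nonneg h.1]
  exact h.2

end Expectation

end RoutingNetwork

theorem integral_sqrt_le {Ω : Type*} [MeasurableSpace Ω] {P : Measure Ω} [IsProbabilityMeasure P]
    {g : Ω → ℝ} (hg : Measurable g) (h0 : ∀ ω, 0 ≤ g ω) {b : ℝ} (hb : ∀ ω, g ω ≤ b) :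
    ∫ ω, Real.sqrt (g ω) ∂P ≤ Real.sqrt (∫ ω, g ω ∂P) := by
  have hm : MemLp (fun ω => Real.sqrt (g ω)) 2 P :=
    MemLp.of_bound (Real.continuous_sqrt.measurable.comp hg).aestronglyMeasurable (Real.sqrt b)
      (Filter.Eventually.of_forall fun ω => by
        rw [Real.norm_of_nonneg (Real.sqrt_nonneg _)]; exact Real.sqrt_le_sqrt (hb ω))
  have h := variance_nonneg (fun ω => Real.sqrt (g ω)) P
  rw [variance_eq_sub hm] at h
  simp only [Pi.pow_apply, Real.sq_sqrt (h0 _)] at h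
  exact Real.le_sqrt_of_sq_le (by linarith)

namespace RoutingNetwork

variable {V E : Type} [Fintype V] [DecidableEq V] [Fintype E] [DecidableEq E] {N : ℕ}
  (G : RoutingNetwork V E N)

section Expectation

variable {S : Type*} [MeasurableSpace S] {μ : Measure S} [IsProbabilityMeasure μ]
  {c : E → ℝ → S → ℝ} {L H : ℝ} {Ω : Type*} [MeasurableSpace Ω] {P : Measure Ω}
  [IsProbabilityMeasure P] {ζ : ℕ × Bool → Ω → S}

/-- The states of nature observed before the test phase of epoch `t + 1`. -/
def past (t : ℕ) : Finset (ℕ × Bool) := Finset.range (t + 1) ×ˢ Finset.univ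

theorem mem_past {t : ℕ} {k : ℕ × Bool} : k ∈ past t ↔ k.1 ≤ t := by
  simp [past]

theorem pathRun_congr_past {x x' : ℕ × Bool → S} {t : ℕ}
    (h : ∀ k ∈ insert (t + 1, false) (past t), x k = x' k) :
    G.pathRun c x t = G.pathRun c x' t ∧ x (t + 1, false) = x' (t + 1, false) :=
  ⟨G.pathRun_congr c fun k hk => h k (Finset.mem_insert_of_mem (mem_past.2 hk)),
    h _ (Finset.mem_insert_self _ _)⟩

theorem measurable_runFlow (hc : IsRegularCost c L H) (t : ℕ) (i : Fin N) (p : G.Route i) :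
    Measurable fun x => G.runFlow c x t i p :=
  (G.measurableState_pathRun hc t).flow hc t (measurable_pi_apply _) i p

theorem measurable_runTestFlow (hc : IsRegularCost c L H) (t : ℕ) (i : Fin N) (p : G.Route i) :
    Measurable fun x => G.runTestFlow c x t i p :=
  (G.measurableState_pathRun hc t).testFlow t i p

theorem measurable_runPoint (hc : IsRegularCost c L H) (t : ℕ) (i : Fin N) (p : G.Route i) :
    Measurable fun x => G.runPoint c x t i p :=
  (G.measurableState_pathRun hc t).point hc t (measurable_pi_apply _) i p

theorem measurable_runNoise (hc : IsRegularCost c L H) (t : ℕ) (e : E) :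
    Measurable fun x => G.runNoise μ c x t e :=
  G.measurable_deviation hc (G.measurable_runFlow hc t) (measurable_pi_apply _) e

theorem measurable_runTestNoise (hc : IsRegularCost c L H) (t : ℕ) (e : E) :
    Measurable fun x => G.runTestNoise μ c x t e :=
  G.measurable_deviation hc (G.measurable_runTestFlow hc t) (measurable_pi_apply _) e

theorem sq_routeNorm_deviation_le (hc : IsRegularCost c L H) (f : ∀ i, G.Route i → ℝ) (s : S) :
    |G.routeNorm (G.deviation μ c f s) ^ 2| ≤ (Fintype.card V * (2 * |H|)) ^ 2 := by
  rw [abs_of_nonneg (sq_nonneg _)]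
  exact pow_le_pow_left₀ (G.routeNorm_nonneg _) (G.routeNorm_deviation_le hc f s) 2

section Independence

variable (hm : ∀ k, Measurable (ζ k)) (hlaw : ∀ k, P.map (ζ k) = μ) (hind : iIndepFun ζ P)

include hm hlaw hind

theorem integral_sq_runNoise_le (hc : IsRegularCost c L H) (t : ℕ) :
    ∫ ω, G.routeNorm (G.runNoise μ c (fun k => ζ k ω) t) ^ 2 ∂P ≤ G.noiseLevel μ c ^ 2 := by
  refine integral_fresh_le hm hlaw hind (J := insert (t + 1, false) (past t)) (k := (t + 1, true))
    (f := fun x s => G.routeNorm (G.deviation μ c (G.runFlow c x t) s) ^ 2)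
    (by simp [mem_past]) ?_ (fun x s => G.sq_routeNorm_deviation_le hc _ s) ?_
    fun x => G.integral_routeNorm_deviation_le hc (G.isFlow_runFlow c x t)
  · exact (G.measurable_routeNorm (G.measurable_deviation hc
      (fun i p => (G.measurable_runFlow hc t i p).comp measurable_fst) measurable_snd)).pow_const 2
  · intro x x' h
    obtain ⟨h1, h2⟩ := G.pathRun_congr_past (c := c) h
    simp only [runFlow, h1, h2]

theorem integral_sq_runTestNoise_le (hc : IsRegularCost c L H) (t : ℕ) :
    ∫ ω, G.routeNorm (G.runTestNoise μ c (fun k => ζ k ω) t) ^ 2 ∂P ≤ G.noiseLevel μ c ^ 2 := by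
  refine integral_fresh_le hm hlaw hind (J := past t) (k := (t + 1, false))
    (f := fun x s => G.routeNorm (G.deviation μ c (G.runTestFlow c x t) s) ^ 2)
    (by simp [mem_past]) ?_ (fun x s => G.sq_routeNorm_deviation_le hc _ s) ?_
    fun x => G.integral_routeNorm_deviation_le hc (G.isFlow_runTestFlow c x t)
  · exact (G.measurable_routeNorm (G.measurable_deviation hc
      (fun i p => (G.measurable_runTestFlow hc t i p).comp measurable_fst)
      measurable_snd)).pow_const 2
  · intro x x' h
    simp only [runTestFlow, G.pathRun_congr c fun k hk => h k (mem_past.2 hk)]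

theorem integral_pairing_runNoise_nonneg (hc : IsRegularCost c L H) (t : ℕ)
    {f : ∀ i, G.Route i → ℝ} (hf : G.IsFlow f) :
    0 ≤ ∫ ω, (G.pairing (G.runNoise μ c (fun k => ζ k ω) t) (G.runPoint c (fun k => ζ k ω) t) -
      G.pairing (G.runNoise μ c (fun k => ζ k ω) t) f) ∂P := by
  rw [← neg_nonpos, ← integral_neg]
  have hdev : ∀ e, Measurable fun x : (ℕ × Bool → S) × S =>
      G.deviation μ c (G.runFlow c x.1 t) x.2 e := G.measurable_deviation hc
        (fun i p => (G.measurable_runFlow hc t i p).comp measurable_fst) measurable_snd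
  have m1 : Measurable fun x : (ℕ × Bool → S) × S =>
      G.pairing (G.deviation μ c (G.runFlow c x.1 t) x.2) (G.runPoint c x.1 t) :=
    G.measurable_pairing hdev fun i p => (G.measurable_runPoint hc t i p).comp measurable_fst
  have m2 : Measurable fun x : (ℕ × Bool → S) × S =>
      G.pairing (G.deviation μ c (G.runFlow c x.1 t) x.2) f :=
    G.measurable_pairing hdev fun i p => measurable_const
  refine integral_fresh_le hm hlaw hind (J := insert (t + 1, false) (past t)) (k := (t + 1, true))
    (f := fun x s => -(G.pairing (G.deviation μ c (G.runFlow c x t) s) (G.runPoint c x t) -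
      G.pairing (G.deviation μ c (G.runFlow c x t) s) f))
    (b := Fintype.card V * (2 * |H|) * G.totalDemand + Fintype.card V * (2 * |H|) * G.totalDemand)
    (by simp [mem_past]) ?_ (fun x s => ?_) ?_ fun x => ?_
  · exact (m1.sub m2).neg
  · have h := mul_le_mul_of_nonneg_right
      (G.routeNorm_deviation_le (μ := μ) hc (G.runFlow c x t) s) G.totalDemand_nonneg
    rw [abs_neg]
    exact (abs_sub _ _).trans (add_le_add
      ((G.abs_pairing_le (PathState.isFlow_point c t _ _) _).trans h)
      ((G.abs_pairing_le hf _).trans h))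
  · intro x x' h
    obtain ⟨h1, h2⟩ := G.pathRun_congr_past (c := c) h
    simp only [runFlow, runPoint, h1, h2]
  · have hi : ∀ g : ∀ i, G.Route i → ℝ,
        Integrable (fun s => G.pairing (G.deviation μ c (G.runFlow c x t) s) g) μ := fun g => by
      simp only [pairing_eq_sum_load]
      exact integrable_finsetSum _ fun e _ =>
        ((hc.integrable e _).sub (integrable_const _)).mul_const _
    rw [integral_neg, integral_sub (hi _) (hi _), G.integral_pairing_deviation hc,
      G.integral_pairing_deviation hc]
    simp

theorem expected_gap_le (hN : 1 ≤ N) (hL : 0 ≤ L) {K : ℕ}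
    (hK : ∀ i (p : G.Route i), p.1.length ≤ K) (hc : IsRegularCost c L H) (T : ℕ)
    {f : ∀ i, G.Route i → ℝ} (hf : G.IsFlow f) :
    stepTotal T * (∫ ω, G.potential μ c (G.runFlow c (fun k => ζ k ω) T) ∂P - G.potential μ c f) ≤
      G.rateConst * Real.sqrt G.rateConst * (1 + 8 * K ^ 2 * L ^ 2 * G.totalDemand) +
      G.rateConst * (3 * G.noiseLevel μ c * ((T + 1) * Real.sqrt (T + 1))) := by
  have hZ : Measurable fun ω => fun k => ζ k ω := measurable_pi_iff.2 hm
  set b : ℝ := Fintype.card V * (2 * |H|) with hb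
  have hb0 : 0 ≤ b := by positivity
  have hn : ∀ x t, G.routeNorm (G.runNoise μ c x t) ≤ b := fun x t => G.routeNorm_deviation_le hc _ _
  have hn' : ∀ x t, G.routeNorm (G.runTestNoise μ c x t) ≤ b :=
    fun x t => G.routeNorm_deviation_le hc _ _
  have hd : ∀ x t, (G.routeNorm fun e => G.runNoise μ c x t e - G.runTestNoise μ c x t e) ≤
      G.routeNorm (G.runNoise μ c x t) + G.routeNorm (G.runTestNoise μ c x t) := fun x t => by
    have := G.routeNorm_add_le (G.runNoise μ c x t) fun e => -G.runTestNoise μ c x t e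
    rw [routeNorm_neg] at this
    exact this
  have hd2 : ∀ x t, (G.routeNorm fun e => G.runNoise μ c x t e - G.runTestNoise μ c x t e) ^ 2 ≤
      2 * G.routeNorm (G.runNoise μ c x t) ^ 2 + 2 * G.routeNorm (G.runTestNoise μ c x t) ^ 2 :=
    fun x t => (pow_le_pow_left₀ (G.routeNorm_nonneg _) (hd x t) 2).trans (by
      nlinarith [sq_nonneg (G.routeNorm (G.runNoise μ c x t) -
        G.routeNorm (G.runTestNoise μ c x t))])
  let W : (ℕ × Bool → S) → ℝ := fun x => 2 * ∑ t ∈ Finset.range (T + 1), (((t : ℝ) + 1) *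
    G.routeNorm fun e => G.runNoise μ c x t e - G.runTestNoise μ c x t e) ^ 2
  let D : (ℕ × Bool → S) → ℕ → ℝ := fun x t =>
    G.pairing (G.runNoise μ c x t) (G.runPoint c x t) - G.pairing (G.runNoise μ c x t) f
  have mN := G.measurable_runNoise (μ := μ) hc
  have mN' := G.measurable_runTestNoise (μ := μ) hc
  have mW : Measurable fun ω => W fun k => ζ k ω := by
    refine Measurable.comp (g := W) ?_ hZ
    exact (Finset.measurable_sum _ fun t _ => ((G.measurable_routeNorm fun e =>
      (mN t e).sub (mN' t e)).const_mul _).pow_const 2).const_mul _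
  have W0 : ∀ x, 0 ≤ W x := fun x =>
    mul_nonneg zero_le_two (Finset.sum_nonneg fun t _ => sq_nonneg _)
  have Wb : ∀ x, W x ≤ 2 * ∑ t ∈ Finset.range (T + 1), (((t : ℝ) + 1) * (b + b)) ^ 2 := fun x =>
    mul_le_mul_of_nonneg_left (Finset.sum_le_sum fun t _ => pow_le_pow_left₀
      (mul_nonneg (by positivity) (G.routeNorm_nonneg _)) (mul_le_mul_of_nonneg_left
        ((hd x t).trans (add_le_add (hn x t) (hn' x t))) (by positivity)) 2) zero_le_two
  have iD : ∀ t, Integrable (fun ω => D (fun k => ζ k ω) t) P := fun t => by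
    refine Integrable.of_bound (C := b * G.totalDemand + b * G.totalDemand) ?_
      (Filter.Eventually.of_forall fun ω => ?_)
    · refine (Measurable.comp (g := fun x => D x t) ?_ hZ).aestronglyMeasurable
      exact (G.measurable_pairing (mN t) (G.measurable_runPoint hc t)).sub
        (G.measurable_pairing (mN t) fun _ _ => measurable_const)
    · have h := mul_le_mul_of_nonneg_right (hn (fun k => ζ k ω) t) G.totalDemand_nonneg
      exact (abs_sub _ _).trans (add_le_add
        ((G.abs_pairing_le (PathState.isFlow_point c t _ _) _).trans h)
        ((G.abs_pairing_le hf _).trans h))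
  have iN : ∀ t, Integrable (fun ω => G.routeNorm (G.runNoise μ c (fun k => ζ k ω) t) ^ 2) P :=
    fun t => Integrable.of_bound (C := b ^ 2) ((Measurable.comp
      (g := fun x => G.routeNorm (G.runNoise μ c x t) ^ 2)
      ((G.measurable_routeNorm (mN t)).pow_const 2) hZ).aestronglyMeasurable)
      (Filter.Eventually.of_forall fun ω => G.sq_routeNorm_deviation_le hc _ _)
  have iN' : ∀ t,
      Integrable (fun ω => G.routeNorm (G.runTestNoise μ c (fun k => ζ k ω) t) ^ 2) P :=
    fun t => Integrable.of_bound (C := b ^ 2) ((Measurable.comp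
      (g := fun x => G.routeNorm (G.runTestNoise μ c x t) ^ 2)
      ((G.measurable_routeNorm (mN' t)).pow_const 2) hZ).aestronglyMeasurable)
      (Filter.Eventually.of_forall fun ω => G.sq_routeNorm_deviation_le hc _ _)
  have iNN : ∀ t : ℕ, Integrable (fun ω => 4 * ((t : ℝ) + 1) ^ 2 *
        (G.routeNorm (G.runNoise μ c (fun k => ζ k ω) t) ^ 2 +
          G.routeNorm (G.runTestNoise μ c (fun k => ζ k ω) t) ^ 2)) P :=
    fun t => ((iN t).add (iN' t)).const_mul _
  have iΦ : Integrable (fun ω => G.potential μ c (G.runFlow c (fun k => ζ k ω) T)) P :=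
    Integrable.of_bound (((G.measurable_potential hc (G.measurable_runFlow hc T)).comp
      hZ).aestronglyMeasurable)
      _ (Filter.Eventually.of_forall fun ω => G.abs_potential_le hc (G.isFlow_runFlow c _ T))
  have iS : Integrable (fun ω => Real.sqrt (W fun k => ζ k ω)) P :=
    Integrable.of_bound (Real.continuous_sqrt.measurable.comp mW).aestronglyMeasurable _
      (Filter.Eventually.of_forall fun ω => by
        rw [Real.norm_of_nonneg (Real.sqrt_nonneg _)]; exact Real.sqrt_le_sqrt (Wb _))
  have iW : Integrable (fun ω => W fun k => ζ k ω) P :=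
    Integrable.of_bound mW.aestronglyMeasurable _ (Filter.Eventually.of_forall fun ω => by
      rw [Real.norm_of_nonneg (W0 _)]; exact Wb _)
  have hσ := Real.sqrt_nonneg (⨆ f : {f : ∀ i, G.Route i → ℝ // G.IsFlow f},
    ∫ s, G.routeNorm (fun e => c e (G.load f.1 e) s - meanCost μ c e (G.load f.1 e)) ^ 2 ∂μ)
  change 0 ≤ G.noiseLevel μ c at hσ
  have hW : ∫ ω, W (fun k => ζ k ω) ∂P ≤ 8 * G.noiseLevel μ c ^ 2 * (T + 1 : ℝ) ^ 3 := by
    have h1 : ∫ ω, W (fun k => ζ k ω) ∂P ≤ ∫ ω, ∑ t ∈ Finset.range (T + 1), 4 * ((t : ℝ) + 1) ^ 2 *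
        (G.routeNorm (G.runNoise μ c (fun k => ζ k ω) t) ^ 2 +
          G.routeNorm (G.runTestNoise μ c (fun k => ζ k ω) t) ^ 2) ∂P := by
      refine integral_mono iW (integrable_finsetSum _ fun t _ => iNN t) fun ω => ?_
      simp only [W, Finset.mul_sum]
      refine Finset.sum_le_sum fun t _ => ?_
      have := mul_le_mul_of_nonneg_left (hd2 (fun k => ζ k ω) t)
        (by positivity : 0 ≤ 2 * ((t : ℝ) + 1) ^ 2)
      rw [mul_pow]
      linarith
    refine h1.trans ?_
    rw [integral_finsetSum _ fun t _ => iNN t]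
    have h2 : ∀ t ∈ Finset.range (T + 1), ∫ ω, 4 * ((t : ℝ) + 1) ^ 2 *
        (G.routeNorm (G.runNoise μ c (fun k => ζ k ω) t) ^ 2 +
          G.routeNorm (G.runTestNoise μ c (fun k => ζ k ω) t) ^ 2) ∂P ≤
        8 * G.noiseLevel μ c ^ 2 * (T + 1 : ℝ) ^ 2 := fun t ht => by
      rw [integral_const_mul, integral_add (iN t) (iN' t)]
      have e1 := G.integral_sq_runNoise_le hm hlaw hind hc t
      have e2 := G.integral_sq_runTestNoise_le hm hlaw hind hc t
      have e3 : ((t : ℝ) + 1) ^ 2 ≤ (T + 1 : ℝ) ^ 2 := by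
        have : t ≤ T := Nat.lt_succ_iff.1 (Finset.mem_range.1 ht)
        gcongr
      calc 4 * ((t : ℝ) + 1) ^ 2 * _ ≤ 4 * ((t : ℝ) + 1) ^ 2 *
            (G.noiseLevel μ c ^ 2 + G.noiseLevel μ c ^ 2) :=
          mul_le_mul_of_nonneg_left (add_le_add e1 e2) (by positivity)
        _ ≤ 4 * (T + 1 : ℝ) ^ 2 * (G.noiseLevel μ c ^ 2 + G.noiseLevel μ c ^ 2) := by gcongr
        _ = _ := by ring
    refine (Finset.sum_le_card_nsmul _ _ _ h2).trans_eq ?_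
    rw [Finset.card_range, nsmul_eq_mul]
    push_cast
    ring
  have hS : ∫ ω, Real.sqrt (W fun k => ζ k ω) ∂P ≤
      3 * G.noiseLevel μ c * ((T + 1) * Real.sqrt (T + 1)) := by
    refine (integral_sqrt_le mW (fun ω => W0 _) fun ω => Wb _).trans ?_
    refine Real.sqrt_le_iff.2 ⟨by positivity, hW.trans ?_⟩
    have : Real.sqrt ((T : ℝ) + 1) ^ 2 = T + 1 := Real.sq_sqrt (by positivity)
    rw [mul_pow, mul_pow, mul_pow, this]
    have h3 : 0 ≤ G.noiseLevel μ c ^ 2 * (T + 1 : ℝ) ^ 3 := by positivity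
    nlinarith
  have hDn : 0 ≤ ∑ t ∈ Finset.range (T + 1), ((t : ℝ) + 1) * ∫ ω, D (fun k => ζ k ω) t ∂P :=
    Finset.sum_nonneg fun t _ => mul_nonneg (by positivity)
      (G.integral_pairing_runNoise_nonneg hm hlaw hind hc t hf)
  have iR1 : Integrable (fun ω => G.rateConst * Real.sqrt G.rateConst *
      (1 + 8 * K ^ 2 * L ^ 2 * G.totalDemand) + G.rateConst * Real.sqrt (W fun k => ζ k ω)) P :=
    (integrable_const _).add (iS.const_mul _)
  have iR2 : Integrable (fun ω => ∑ t ∈ Finset.range (T + 1),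
      ((t : ℝ) + 1) * D (fun k => ζ k ω) t) P :=
    integrable_finsetSum _ fun t _ => (iD t).const_mul _
  have hmain := integral_mono (((iΦ.sub (integrable_const (G.potential μ c f))).const_mul
    (stepTotal T))) (iR1.sub iR2)
    fun ω => G.pathwise_gap_le (fun k => ζ k ω) hN hL hK hc T hf
  simp only [Pi.sub_apply] at hmain
  rw [integral_const_mul, integral_sub iΦ (integrable_const _), integral_sub iR1 iR2,
    integral_add (integrable_const _) (iS.const_mul _), integral_const_mul,
    integral_finsetSum _ fun t _ => (iD t).const_mul _] at hmain
  simp only [integral_const_mul, integral_const, probReal_univ, one_smul] at hmain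
  have h9 := mul_le_mul_of_nonneg_left hS (zero_le_one.trans G.one_le_rateConst)
  linarith

end Independence

end Expectation

/-! ## Extension of the costs to all loads -/

section Clamp

variable {S : Type*} (c : E → ℝ → S → ℝ)

/-- The cost functions continued by constants outside the range of possible loads. -/
noncomputable def clampCost (e : E) (x : ℝ) (s : S) : ℝ :=
  c e (Set.projIcc 0 G.totalDemand G.totalDemand_nonneg x) s

theorem clampCost_of_mem {x : ℝ} (hx : x ∈ Set.Icc 0 G.totalDemand) (e : E) (s : S) :
    G.clampCost c e x s = c e x s := by
  rw [clampCost, Set.projIcc_of_mem _ hx]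

theorem pathRun_clampCost (ζ : ℕ × Bool → S) (t : ℕ) :
    G.pathRun (G.clampCost c) ζ t = G.pathRun c ζ t := by
  induction t with
  | zero => rfl
  | succ t ih =>
    have h1 : ∀ x, (G.pathRun c ζ t).testCost (G.clampCost c) t x =
        (G.pathRun c ζ t).testCost c t x := fun x => funext fun e =>
      G.clampCost_of_mem c ((G.isFlow_averageFlow c ζ t _).load_mem e) e x
    have h2 : ∀ x, (G.pathRun c ζ t).score (G.clampCost c) t x =
        (G.pathRun c ζ t).score c t x := fun x => funext fun e => by
      rw [PathState.score, PathState.score, h1]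
    have h3 : ∀ x x', (G.pathRun c ζ t).cost (G.clampCost c) t x x' =
        (G.pathRun c ζ t).cost c t x x' := fun x x' => funext fun e => by
      rw [PathState.cost, PathState.cost, PathState.flow, PathState.flow, h2]
      exact G.clampCost_of_mem c ((G.isFlow_averageFlow c ζ t _).load_mem e) e x'
    rw [pathRun, pathRun, ih, PathState.next, PathState.next]
    simp only [h1, h2, h3]

theorem runFlow_clampCost (ζ : ℕ × Bool → S) (t : ℕ) :
    G.runFlow (G.clampCost c) ζ t = G.runFlow c ζ t := by
  have h2 : ∀ x, (G.pathRun c ζ t).score (G.clampCost c) t x =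
      (G.pathRun c ζ t).score c t x := fun x => funext fun e => by
    rw [PathState.score, PathState.score]
    congr 3
    exact G.clampCost_of_mem c ((G.isFlow_averageFlow c ζ t _).load_mem e) e x
  rw [runFlow, runFlow, pathRun_clampCost, PathState.flow, PathState.flow, h2]

variable {c} [MeasurableSpace S] {L : ℝ}

theorem isRegularCost_clampCost (hc : G.IsCostModel c L) :
    ∃ H, IsRegularCost (G.clampCost c) |L| H := by
  obtain ⟨H, hH⟩ := hc.bounded
  have hlip : ∀ e s x y, |G.clampCost c e x s - G.clampCost c e y s| ≤ |L| * |x - y| := by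
    intro e s x y
    refine (hc.lipschitz e s _ (Subtype.coe_prop _) _ (Subtype.coe_prop _)).trans ?_
    refine mul_le_mul (le_abs_self L) ?_ (abs_nonneg _) (abs_nonneg _)
    exact Set.abs_projIcc_sub_projIcc G.totalDemand_nonneg
  have hm : ∀ e x, Measurable (G.clampCost c e x) := fun e x =>
    hc.measurable e _ (Subtype.coe_prop _)
  refine ⟨H, fun e => ?_, fun e s x y h => ?_, fun e x s => hH e s _ (Subtype.coe_prop _), hlip⟩
  · refine measurable_uncurry_of_continuous_of_measurable (u := fun x s => G.clampCost c e x s)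
      (fun s => ?_) (hm e)
    have : LipschitzWith |L|.toNNReal (fun x => G.clampCost c e x s) :=
      LipschitzWith.of_dist_le_mul fun x y => by
        rw [Real.dist_eq, Real.dist_eq, Real.coe_toNNReal _ (abs_nonneg L)]
        exact hlip e s x y
    exact this.continuous
  · exact hc.monotone e s (Subtype.coe_prop _) (Subtype.coe_prop _) (Set.monotone_projIcc _ h)

variable (μ : Measure S) (c)

theorem meanCost_clampCost {x : ℝ} (hx : x ∈ Set.Icc 0 G.totalDemand) (e : E) :
    meanCost μ (G.clampCost c) e x = meanCost μ c e x := by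
  simp only [meanCost, G.clampCost_of_mem c hx]

theorem potential_clampCost {f : ∀ i, G.Route i → ℝ} (hf : G.IsFlow f) :
    G.potential μ (G.clampCost c) f = G.potential μ c f := by
  refine Finset.sum_congr rfl fun e _ => intervalIntegral.integral_congr fun x hx => ?_
  have h := hf.load_mem e
  rw [Set.uIcc_of_le h.1] at hx
  exact G.meanCost_clampCost c μ ⟨hx.1, hx.2.trans h.2⟩ e

theorem gap_clampCost {f : ∀ i, G.Route i → ℝ} (hf : G.IsFlow f) :
    G.gap μ (G.clampCost c) f = G.gap μ c f := by
  rw [gap, gap, G.potential_clampCost c μ hf,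
    Set.image_congr (s := {g | G.IsFlow g}) fun g hg => G.potential_clampCost c μ hg]

theorem noiseLevel_clampCost : G.noiseLevel μ (G.clampCost c) = G.noiseLevel μ c := by
  rw [noiseLevel, noiseLevel]
  congr 2
  ext f
  simp only [G.clampCost_of_mem c (f.2.load_mem _), G.meanCost_clampCost c μ (f.2.load_mem _)]

theorem gap_congr_load {f g : ∀ i, G.Route i → ℝ} (h : ∀ e, G.load f e = G.load g e) :
    G.gap μ c f = G.gap μ c g := by
  simp only [gap, potential, h]

theorem gap_adaLightFlow (ζ : ℕ × Bool → S) (t : ℕ) :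
    G.gap μ c (G.adaLightFlow c ζ (t + 1)) =
      G.gap μ (G.clampCost c) (G.runFlow (G.clampCost c) ζ t) := by
  rw [G.gap_congr_load c μ (G.load_adaLightFlow c ζ t), G.gap_clampCost c μ
    (G.isFlow_runFlow _ ζ t), runFlow_clampCost]

end Clamp

/-! ## Convergence rates -/

theorem nonempty_flows : {f | G.IsFlow f}.Nonempty := ⟨G.logit 0, G.isFlow_logit 0⟩

theorem gap_eq_zero_of_numRoutes_le_one (h : G.numRoutes ≤ 1) {S : Type*} [MeasurableSpace S]
    (μ : Measure S) (c : E → ℝ → S → ℝ) {f : ∀ i, G.Route i → ℝ} (hf : G.IsFlow f) :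
    G.gap μ c f = 0 := by
  have hu : ∀ g, G.IsFlow g → ∀ i (p : G.Route i), g i p = G.demand i := fun g hg i p => by
    have hcard : Fintype.card (G.Route i) ≤ 1 :=
      (Finset.single_le_sum (f := fun i => Fintype.card (G.Route i)) (fun _ _ => Nat.zero_le _)
        (Finset.mem_univ i)).trans h
    have := Fintype.card_le_one_iff_subsingleton.1 hcard
    rw [← (hg i).2, Fintype.sum_subsingleton _ p]
  have : {g | G.IsFlow g} = {f} := by
    ext g
    constructor
    · intro hg
      exact funext fun i => funext fun p => (hu g hg i p).trans (hu f hf i p).symm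
    · rintro rfl; exact hf
  rw [gap, this, Set.image_singleton, csInf_singleton, sub_self]

theorem mul_sqrt_eq_rpow {x : ℝ} (hx : 0 < x) : x * Real.sqrt x = x ^ (3 / 2 : ℝ) := by
  rw [Real.sqrt_eq_rpow, show (3 / 2 : ℝ) = 1 + 1 / 2 by norm_num, Real.rpow_add hx, Real.rpow_one]

/-- Factor by which the constant of the rates depends on the number of pairs and the demands. -/
noncomputable def demandFactor (N : ℕ) (M : ℝ) : ℝ := N * |M| + (4 * (N * |M|) + 1) / Real.log 2

theorem demandFactor_pos (N : ℕ) (M : ℝ) : 0 < demandFactor N M := by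
  have := Real.log_pos one_lt_two
  unfold demandFactor
  positivity

variable {G} in
theorem totalDemand_le {M : ℝ} (hM : ∀ i, G.demand i ≤ M) : G.totalDemand ≤ N * |M| := by
  refine (Finset.sum_le_card_nsmul _ _ |M| fun i _ => (hM i).trans (le_abs_self M)).trans_eq ?_
  simp

variable {G} in
theorem rateConst_mul_sqrt_le {M : ℝ} (hM : ∀ i, G.demand i ≤ M) (h2 : 2 ≤ G.numRoutes) :
    G.rateConst * Real.sqrt G.rateConst ≤
      demandFactor N M ^ (3 / 2 : ℝ) * Real.log G.numRoutes ^ (3 / 2 : ℝ) := by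
  have hl2 := Real.log_pos one_lt_two
  have hl : Real.log 2 ≤ Real.log G.numRoutes :=
    Real.log_le_log zero_lt_two (by exact_mod_cast h2)
  have hd := totalDemand_le hM
  have h1 := G.logPartition_zero_le
  have h3 := G.one_le_rateConst
  have hle : G.rateConst ≤ demandFactor N M * Real.log G.numRoutes := by
    have e1 : G.totalDemand * Real.log G.numRoutes ≤ N * |M| * Real.log G.numRoutes :=
      mul_le_mul_of_nonneg_right hd (by linarith)
    have e2 : 4 * (N * |M|) + 1 ≤ (4 * (N * |M|) + 1) / Real.log 2 * Real.log G.numRoutes := by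
      rw [div_mul_eq_mul_div, le_div_iff₀ hl2]
      exact mul_le_mul_of_nonneg_left hl (by positivity)
    rw [demandFactor, add_mul, rateConst]
    linarith
  rw [mul_sqrt_eq_rpow (by linarith), ← Real.mul_rpow (demandFactor_pos N M).le (by linarith)]
  exact Real.rpow_le_rpow (by linarith) hle (by norm_num)

theorem le_rate_of_stepTotal_mul_le {g Q r b σ : ℝ} {T : ℕ} (hr : r ≤ Q) (hb : 0 ≤ b)
    (hQ : 0 ≤ Q) (hσ : 0 ≤ σ)
    (h : stepTotal T * g ≤ Q * b + r * (3 * σ * ((T + 1) * Real.sqrt (T + 1)))) :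
    g ≤ Q * (2 * b + 6) * (σ / Real.sqrt (T + 1) + 1 / (T + 1 : ℝ) ^ 2) := by
  have hn : (0 : ℝ) < T + 1 := by positivity
  have hs : 0 < Real.sqrt (T + 1 : ℝ) := Real.sqrt_pos.2 hn
  have hss : Real.sqrt (T + 1 : ℝ) ^ 2 = T + 1 := Real.sq_sqrt hn.le
  have hS : (T + 1 : ℝ) ^ 2 / 2 ≤ stepTotal T := by rw [stepTotal]; nlinarith
  refine le_of_mul_le_mul_left (h.trans ?_) (stepTotal_pos T)
  refine le_trans ?_ (mul_le_mul_of_nonneg_right hS (by positivity))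
  have e : (T + 1 : ℝ) ^ 2 / 2 * (Q * (2 * b + 6) * (σ / Real.sqrt (T + 1) + 1 / (T + 1 : ℝ) ^ 2)) =
      Q * (b + 3) * (σ * ((T + 1) * Real.sqrt (T + 1)) + 1) := by
    have : (T + 1 : ℝ) ^ 2 / Real.sqrt (T + 1) = (T + 1) * Real.sqrt (T + 1) := by
      rw [div_eq_iff hs.ne']
      linear_combination -(T + 1 : ℝ) * hss
    calc _ = Q * (b + 3) * (σ * ((T + 1 : ℝ) ^ 2 / Real.sqrt (T + 1)) +
          (T + 1 : ℝ) ^ 2 / (T + 1 : ℝ) ^ 2) := by ring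
      _ = _ := by rw [this, div_self (by positivity)]
  rw [e]
  have h1 : 0 ≤ σ * ((T + 1) * Real.sqrt (T + 1 : ℝ)) := by positivity
  have h2 := mul_le_mul_of_nonneg_right hr h1
  have h3 : 0 ≤ Q * b * (σ * ((T + 1) * Real.sqrt (T + 1 : ℝ))) := by positivity
  nlinarith

theorem sub_sInf_le_of_forall {A : Set ℝ} (hA : A.Nonempty) {x b s : ℝ} (hs : 0 < s)
    (h : ∀ y ∈ A, s * (x - y) ≤ b) : s * (x - sInf A) ≤ b := by
  have : x - b / s ≤ sInf A := le_csInf hA fun y hy => by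
    have := (le_div_iff₀' hs).2 (h y hy)
    linarith
  rw [← le_div_iff₀' hs]
  linarith

/-- The constant of the convergence rates. -/
noncomputable def convergenceConst (N K : ℕ) (L M : ℝ) : ℝ :=
  demandFactor N M ^ (3 / 2 : ℝ) * (2 * (1 + 8 * K ^ 2 * |L| ^ 2 * (N * |M|)) + 6)

section Rates

variable {G} {K : ℕ} {L M : ℝ} (hK : ∀ i (p : G.Route i), p.1.length ≤ K)
  (hM : ∀ i, G.demand i ≤ M) (h2 : 2 ≤ G.numRoutes) {S : Type*} [MeasurableSpace S]
  {μ : Measure S} [IsProbabilityMeasure μ] {c : E → ℝ → S → ℝ} (hc : G.IsCostModel c L)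

include hM h2

theorem pos_of_two_le_numRoutes : 1 ≤ N := by
  rcases Nat.eq_zero_or_pos N with rfl | h
  · simp [numRoutes] at h2
  · exact h

theorem rate_le_convergenceConst {g r σ : ℝ} {T : ℕ} (hσ : 0 ≤ σ) (hr : r ≤ G.rateConst)
    (h : stepTotal T * g ≤
      G.rateConst * Real.sqrt G.rateConst * (1 + 8 * K ^ 2 * |L| ^ 2 * G.totalDemand) +
        r * (3 * σ * ((T + 1) * Real.sqrt (T + 1)))) :
    g ≤ convergenceConst N K L M * Real.log G.numRoutes ^ (3 / 2 : ℝ) *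
      (σ / Real.sqrt (T + 1) + 1 / (T + 1 : ℝ) ^ 2) := by
  have hQ := rateConst_mul_sqrt_le hM h2
  have h1 := G.one_le_rateConst
  have hd := totalDemand_le hM
  have hsq : 1 ≤ Real.sqrt G.rateConst := Real.one_le_sqrt.2 h1
  have hrQ : G.rateConst ≤ G.rateConst * Real.sqrt G.rateConst :=
    le_mul_of_one_le_right (by linarith) hsq
  have h3 := G.totalDemand_nonneg
  refine (le_rate_of_stepTotal_mul_le (Q := demandFactor N M ^ (3 / 2 : ℝ) *
    Real.log G.numRoutes ^ (3 / 2 : ℝ)) (b := 1 + 8 * K ^ 2 * |L| ^ 2 * (N * |M|)) (σ := σ)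
    (hr.trans (hrQ.trans hQ)) (by positivity) (by linarith) hσ
    (h.trans (add_le_add_left (mul_le_mul hQ (by gcongr) (by positivity) (by linarith)) _))).trans_eq
    ?_
  rw [convergenceConst]
  ring

include hK hc

theorem gap_le_of_static
    (hst : ∀ e, ∀ x ∈ Set.Icc 0 G.totalDemand, ∀ s s', c e x s = c e x s') (ζ : ℕ × Bool → S)
    (T : ℕ) :
    G.gap μ c (G.adaLightFlow c ζ (T + 1)) ≤
      convergenceConst N K L M * Real.log G.numRoutes ^ (3 / 2 : ℝ) / (T + 1 : ℝ) ^ 2 := by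
  obtain ⟨H, hreg⟩ := G.isRegularCost_clampCost hc
  rw [gap_adaLightFlow]
  have hmean : ∀ e x s, meanCost μ (G.clampCost c) e x = G.clampCost c e x s := fun e x s => by
    have : ∀ s', G.clampCost c e x s' = G.clampCost c e x s := fun s' =>
      hst e _ (Subtype.coe_prop _) s' s
    simp [meanCost, this]
  have hz : G.pairing (0 : E → ℝ) = fun _ => 0 := funext fun f => by simp [pairing_eq_sum_load]
  have hn : ∀ t, G.runNoise μ (G.clampCost c) ζ t = 0 := fun t => funext fun e =>
    sub_eq_zero.2 (hmean e _ _).symm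
  have hn' : ∀ t, G.runTestNoise μ (G.clampCost c) ζ t = 0 := fun t => funext fun e =>
    sub_eq_zero.2 (hmean e _ _).symm
  have hz' : G.routeNorm (fun _ => 0) = 0 :=
    le_antisymm (G.routeNorm_le le_rfl fun i p => by simp) (G.routeNorm_nonneg _)
  have key := sub_sInf_le_of_forall (G.nonempty_flows.image (G.potential μ (G.clampCost c)))
    (stepTotal_pos T) (x := G.potential μ (G.clampCost c) (G.runFlow (G.clampCost c) ζ T))
    (b := G.rateConst * Real.sqrt G.rateConst * (1 + 8 * K ^ 2 * |L| ^ 2 * G.totalDemand)) (by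
      rintro _ ⟨f, hf, rfl⟩
      have := G.pathwise_gap_le (μ := μ) ζ (pos_of_two_le_numRoutes hM h2) (abs_nonneg L) hK hreg T
        hf
      simpa [hn, hn', hz, hz'] using this)
  have := rate_le_convergenceConst (σ := 0) (r := 0) (K := K) (L := L) hM h2 le_rfl
    (by linarith [G.one_le_rateConst]) (key.trans (by simp))
  refine this.trans_eq ?_
  rw [zero_div, zero_add, mul_one_div]

variable {Ω : Type*} [MeasurableSpace Ω] {P : Measure Ω} [IsProbabilityMeasure P]
  {ζ : ℕ × Bool → Ω → S} (hm : ∀ k, Measurable (ζ k)) (hlaw : ∀ k, P.map (ζ k) = μ)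
  (hind : iIndepFun ζ P)

include hm hlaw hind

theorem integral_gap_le (T : ℕ) :
    ∫ ω, G.gap μ c (G.adaLightFlow c (fun k => ζ k ω) (T + 1)) ∂P ≤
      convergenceConst N K L M * Real.log G.numRoutes ^ (3 / 2 : ℝ) *
        (G.noiseLevel μ c / Real.sqrt (T + 1) + 1 / (T + 1 : ℝ) ^ 2) := by
  obtain ⟨H, hreg⟩ := G.isRegularCost_clampCost hc
  have iΦ : Integrable (fun ω => G.potential μ (G.clampCost c)
      (G.runFlow (G.clampCost c) (fun k => ζ k ω) T)) P :=
    Integrable.of_bound (((G.measurable_potential hreg (G.measurable_runFlow hreg T)).comp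
      (measurable_pi_iff.2 hm)).aestronglyMeasurable)
      _ (Filter.Eventually.of_forall fun ω => G.abs_potential_le hreg (G.isFlow_runFlow _ _ T))
  simp only [gap_adaLightFlow]
  simp only [gap]
  rw [integral_sub iΦ (integrable_const _), integral_const, probReal_univ, one_smul,
    ← noiseLevel_clampCost]
  exact rate_le_convergenceConst hM h2 (Real.sqrt_nonneg _) le_rfl
    (sub_sInf_le_of_forall (G.nonempty_flows.image _) (stepTotal_pos T) (by
      rintro _ ⟨f, hf, rfl⟩
      exact G.expected_gap_le hm hlaw hind (pos_of_two_le_numRoutes hM h2) (abs_nonneg L) hK hreg T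
        hf))

end Rates

theorem integrable_gap_adaLightFlow {S : Type*} [MeasurableSpace S] {μ : Measure S}
    [IsProbabilityMeasure μ] {c : E → ℝ → S → ℝ} {L : ℝ} (hc : G.IsCostModel c L) {Ω : Type*}
    [MeasurableSpace Ω] {P : Measure Ω} [IsProbabilityMeasure P] {ζ : ℕ × Bool → Ω → S}
    (hm : ∀ k, Measurable (ζ k)) (T : ℕ) :
    Integrable (fun ω => G.gap μ c (G.adaLightFlow c (fun k => ζ k ω) (T + 1))) P := by
  obtain ⟨H, hreg⟩ := G.isRegularCost_clampCost hc
  simp only [gap_adaLightFlow]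
  exact (Integrable.of_bound (((G.measurable_potential hreg (G.measurable_runFlow hreg T)).comp
      (measurable_pi_iff.2 hm)).aestronglyMeasurable)
      _ (Filter.Eventually.of_forall fun ω =>
        G.abs_potential_le hreg (G.isFlow_runFlow _ _ T))).sub (integrable_const _)

end RoutingNetwork

theorem mainTheorem2 :
    (∀ (N K : ℕ) (L M : ℝ), ∃ C : ℝ,
      ∀ (V E : Type) [Fintype V] [DecidableEq V] [Fintype E] [DecidableEq E]
        (G : RoutingNetwork V E N),
        (∀ i (p : G.Route i), p.1.length ≤ K) → (∀ i, G.demand i ≤ M) →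
      ∀ (S : Type*) [MeasurableSpace S] (μ : Measure S) [IsProbabilityMeasure μ]
        (c : E → ℝ → S → ℝ), G.IsCostModel c L →
      ∀ (Ω : Type*) [MeasurableSpace Ω] (P : Measure Ω) [IsProbabilityMeasure P]
        (ζ : ℕ × Bool → Ω → S),
        (∀ k, Measurable (ζ k)) → (∀ k, P.map (ζ k) = μ) → iIndepFun ζ P →
      ∀ T : ℕ, 1 ≤ T →
        (∀ ω, G.IsFlow (G.adaLightFlow c (fun k => ζ k ω) T)) ∧
        Integrable (fun ω => G.gap μ c (G.adaLightFlow c (fun k => ζ k ω) T)) P ∧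
        ∫ ω, G.gap μ c (G.adaLightFlow c (fun k => ζ k ω) T) ∂P ≤
          C * Real.log G.numRoutes ^ (3 / 2 : ℝ) *
            (G.noiseLevel μ c / Real.sqrt T + 1 / (T : ℝ) ^ 2) ∧
        ((∀ e, ∀ x ∈ Set.Icc 0 G.totalDemand, ∀ s s', c e x s = c e x s') →
          ∀ ω, G.gap μ c (G.adaLightFlow c (fun k => ζ k ω) T) ≤
            C * Real.log G.numRoutes ^ (3 / 2 : ℝ) / (T : ℝ) ^ 2)) ∧
    (∃ C : ℕ,
      ∀ (V E : Type) [Fintype V] [DecidableEq V] [Fintype E] [DecidableEq E] (N : ℕ)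
        (G : RoutingNetwork V E N), 1 ≤ N →
        (∀ u : E → ℝ, (G.routeNormProgram u).val = G.routeNorm u) ∧
        ∀ (testCost cost : (Fin N → E → ℝ) → E → ℝ) (α : ℝ) (s : AdaState E N),
          (G.iteration testCost cost α s).ops ≤
            C * (N * Fintype.card V * Fintype.card E)) := by
  refine ⟨fun N K L M => ⟨RoutingNetwork.convergenceConst N K L M, ?_⟩, 120,
    fun V E _ _ _ _ N G hN => ⟨G.routeNormProgram_val, G.ops_iteration_le hN⟩⟩
  intro V E _ _ _ _ G hK hM S _ μ _ c hc Ω _ P _ ζ hm hlaw hind T hT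
  obtain ⟨T, rfl⟩ := Nat.exists_eq_add_of_le' hT
  have hflow : ∀ ω, G.IsFlow (G.adaLightFlow c (fun k => ζ k ω) (T + 1)) :=
    fun ω => G.isFlow_adaLightFlow c _ T
  refine ⟨hflow, G.integrable_gap_adaLightFlow hc hm T, ?_⟩
  rcases Nat.lt_or_ge G.numRoutes 2 with h | h
  · have hgap := fun ω => G.gap_eq_zero_of_numRoutes_le_one (Nat.lt_succ_iff.1 h) μ c (hflow ω)
    have hlog : Real.log G.numRoutes = 0 := by
      interval_cases G.numRoutes <;> simp
    simp only [hgap, hlog, integral_zero, Real.zero_rpow (by norm_num : (3 / 2 : ℝ) ≠ 0)]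
    simp
  · push_cast
    exact ⟨RoutingNetwork.integral_gap_le hK hM h hc hm hlaw hind T,
      fun hst ω => RoutingNetwork.gap_le_of_static hK hM h hc hst _ T⟩
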